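/- **Theorem.** There are absolute constants $c, e, \Delta \in \mathbb{N}$ and explicit families of algebraic circuits (numerators $P_{d_1,d_2,k}$, denominators $Q_{d_1,d_2,k}$, tests $T_{d_1,d_2,k}$, for $0 \le k < s(d_1,d_2)$) such that the following holds for all $d_1,d_2 \in \mathbb{N}$ and every field $\mathbb{K}$, of any characteristic, with $|\mathbb{K}| \ge (d_1d_2)^c$. The circuits are circuits over $\mathbb{K}$ with sum and product gates of unbounded fan-in and with constants from $\mathbb{K}$ and input variables at the leaves. They take as input the coefficient vectors of a polynomial of degree $d_1$ and a polynomial of degree $d_2$. Each test circuit has one output, and each numerator and denominator circuit has $\min(d_1,d_2)+1$ outputs, indexed by $j = 0,\dots,\min(d_1,d_2)$. The sum of the sizes (numbers of gates and wires) of all the circuits for given $d_1,d_2$ is at most $(d_1+d_2+2)^e$, and every circuit has depth at most $\Delta$. For all monic $f, g \in \mathbb{K}[y]$ with $\deg f = d_1$, $\deg g = d_2$, some test circuit is nonzero at $(\overline{\mathrm{coeff}}(f),\overline{\mathrm{coeff}}(g))$; and if $$r = \max\{k < s(d_1,d_2) : T_{d_1,d_2,k}(\overline{\mathrm{coeff}}(f),\overline{\mathrm{coeff}}(g))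 \neq 0\},$$ then for every $j \le \min(d_1,d_2)$ the $j$-th output of $Q_{d_1,d_2,r}$ is nonzero there, and the coefficient of $y^j$ in the monic polynomial $\gcd(f,g)$ is $$\frac{P_{d_1,d_2,r}(\overline{\mathrm{coeff}}(f),\overline{\mathrm{coeff}}(g))_j}{Q_{d_1,d_2,r}(\overline{\mathrm{coeff}}(f),\overline{\mathrm{coeff}}(g))_j}.$$ Here "explicit" means: there are fixed algorithms, independent of the field, that run in space logarithmic in $d_1,d_2,k$ and the further arguments (hence in polynomial time) and compute the number $s(d_1,d_2)$ of pieces, the number of gates of each circuit, the type and the incoming wires of each gate, the output gates, and a straight-line program which, by the field operations $+,-,\cdot,/$, computes the field constants of the circuit from $0$, $1$ and $(d_1d_2)^c$ distinct elements of $\mathbb{K}$. These elements may be chosen arbitrarily, and the circuits obtained from any choice have the properties above. -/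

import Mathlib

noncomputable section

namespace GcdCircuit

/-! ### Algebraic circuits -/

/-- A gate of an algebraic circuit over `K` with `n` input variables. Leaves are field constants or
input variables; inner gates are sums and products of unbounded fan-in, the list giving the positions
of the gates that are wired into it (repetitions allowed). -/
inductive Gate (K : Type*) (n : ℕ) where
  | const (a : K) : Gate K n
  | input (i : Fin n) : Gate K n
  | add (l : List ℕ) : Gate K n
  | mul (l : List ℕ) : Gate K n

/-- The gates wired into a gate. -/
def Gate.children {K : Type*} {n : ℕ} : Gate K n → List ℕ
  | .const _ => []
  | .input _ => []
  | .add l => l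
  | .mul l => l

/-- An algebraic circuit over `K` with `n` inputs and `m` outputs: a directed acyclic graph of gates,
numbered `0, …, numGates - 1` in a topological order. (Values of `gate` at positions beyond
`numGates` play no role.) -/
structure Circuit (K : Type*) (n m : ℕ) where
  numGates : ℕ
  gate : ℕ → Gate K n
  acyclic : ∀ i, ∀ j ∈ (gate i).children, j < i
  output : Fin m → ℕ
  output_lt : ∀ j, output j < numGates

namespace Circuit

variable {K : Type*} {n m : ℕ}

/-- The value computed at position `i` on input `x`. -/
def value [Field K] (C : Circuit K n m) (x : Fin n → K) (i : ℕ) : K :=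
  match _h : C.gate i with
  | .const a => a
  | .input j => x j
  | .add l => (l.attach.map fun j => C.value x j.1).sum
  | .mul l => (l.attach.map fun j => C.value x j.1).prod
termination_by i
decreasing_by
  · exact C.acyclic i j.1 (by rw [_h]; exact j.2)
  · exact C.acyclic i j.1 (by rw [_h]; exact j.2)

/-- The function computed by the circuit. -/
def eval [Field K] (C : Circuit K n m) (x : Fin n → K) (j : Fin m) : K :=
  C.value x (C.output j)

/-- The length of a longest path from a leaf to the gate at position `i`. -/
def depthAt (C : Circuit K n m) (i : ℕ) : ℕ :=
  ((C.gate i).children.attach.map fun j => C.depthAt j.1 + 1).foldr max 0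
termination_by i
decreasing_by exact C.acyclic i j.1 j.2

/-- The depth of the circuit. -/
def depth (C : Circuit K n m) : ℕ :=
  (Finset.range C.numGates).sup C.depthAt

/-- The size of the circuit: the number of gates plus the number of wires. -/
def size (C : Circuit K n m) : ℕ :=
  C.numGates + ∑ i ∈ Finset.range C.numGates, (C.gate i).children.length

end Circuit

/-! ### Piece-wise rational circuits -/

/-- A piece-wise rational circuit with `n` inputs and `m` outputs: numerator, denominator and test
circuits, one of each for every piece `k < pieces`. -/
structure PiecewiseRationalCircuit (K : Type*) (n m : ℕ) where
  pieces : ℕ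
  num : ℕ → Circuit K n m
  den : ℕ → Circuit K n m
  test : ℕ → Circuit K n 1

namespace PiecewiseRationalCircuit

variable {K : Type*} {n m : ℕ}

/-- The size: the sum of the sizes of all circuits. -/
def size (W : PiecewiseRationalCircuit K n m) : ℕ :=
  ∑ k ∈ Finset.range W.pieces, ((W.num k).size + (W.den k).size + (W.test k).size)

/-- The depth: the maximal depth of the circuits. -/
def depth (W : PiecewiseRationalCircuit K n m) : ℕ :=
  (Finset.range W.pieces).sup fun k =>
    max (W.num k).depth (max (W.den k).depth (W.test k).depth)

/-- On input `x`, the circuit computes the vector `b`: some test is nonzero, and for the largest `r`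
whose test is nonzero, every entry of `b` is the quotient of the corresponding outputs of the
`r`-th numerator and denominator circuits (the denominators being nonzero). -/
def ComputesAt [Field K] (W : PiecewiseRationalCircuit K n m) (x : Fin n → K) (b : Fin m → K) :
    Prop :=
  ∃ r, IsGreatest {k | k < W.pieces ∧ (W.test k).eval x 0 ≠ 0} r ∧
    ∀ j, (W.den r).eval x j ≠ 0 ∧ b j = (W.num r).eval x j / (W.den r).eval x j

end PiecewiseRationalCircuit

/-! ### Explicitness

A family of circuits is explicit if its circuits are constructed uniformly, by one algorithm that does
not depend on the field. The combinatorial data (gates, wires, outputs) are computed from the index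
of the circuit; the field constants are computed from a list of distinct elements of the field
by an equally explicit straight-line program with field operations. -/

/-- `F` is computable in logarithmic space (numbers being measured by their value): a fixed
partial recursive program computes `F n`, and every number to which a subprogram is applied in the
course of the computation is less than a fixed power of `n + 2`. (`Nat.Partrec.Code.evaln k` is
evaluation that fails as soon as a subprogram is applied to a number `≥ k`.) Every loop of the program
then makes at most that many rounds, and the program is fixed, so the running time is polynomial in
`n` too. -/
def LogSpace (F : ℕ → ℕ) : Prop :=
  ∃ (c : Nat.Partrec.Code) (e : ℕ), ∀ n, F n ∈ Nat.Partrec.Code.evaln ((n + 2) ^ e) c n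

/-- `LogSpace` for functions of two arguments. -/
def LogSpace₂ (F : ℕ → ℕ → ℕ) : Prop :=
  LogSpace fun n => F n.unpair.1 n.unpair.2

/-- `LogSpace` for functions of three arguments. -/
def LogSpace₃ (F : ℕ → ℕ → ℕ → ℕ) : Prop :=
  LogSpace₂ fun n u => F n.unpair.1 n.unpair.2 u

/-- One step of a straight-line program for field constants. Arguments of arithmetic operations are
positions of earlier steps; `node i` is the `i`-th of the given distinct field elements. -/
inductive ConstOp where
  | zero : ConstOp
  | one : ConstOp
  | node (i : ℕ) : ConstOp
  | add (i j : ℕ) : ConstOp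
  | sub (i j : ℕ) : ConstOp
  | mul (i j : ℕ) : ConstOp
  | div (i j : ℕ) : ConstOp

/-- The numerical code of a step. -/
def ConstOp.code : ConstOp → ℕ
  | .zero => Nat.pair 0 0
  | .one => Nat.pair 1 0
  | .node i => Nat.pair 2 i
  | .add i j => Nat.pair 3 (Nat.pair i j)
  | .sub i j => Nat.pair 4 (Nat.pair i j)
  | .mul i j => Nat.pair 5 (Nat.pair i j)
  | .div i j => Nat.pair 6 (Nat.pair i j)

/-- `v t` is the result of the step `op` at position `t`, the earlier results being `v i`, `i < t`. -/
def ConstOp.Holds {K : Type*} [Field K] {N : ℕ} (a : Fin N → K) (v : ℕ → K) (t : ℕ) :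
    ConstOp → Prop
  | .zero => v t = 0
  | .one => v t = 1
  | .node i => ∃ h : i < N, v t = a ⟨i, h⟩
  | .add i j => i < t ∧ j < t ∧ v t = v i + v j
  | .sub i j => i < t ∧ j < t ∧ v t = v i - v j
  | .mul i j => i < t ∧ j < t ∧ v t = v i * v j
  | .div i j => i < t ∧ j < t ∧ v j ≠ 0 ∧ v t = v i / v j

/-- The type of a gate: a constant (given by its position in the straight-line program for the
constants), an input variable, or a sum or product of the given fan-in. -/
inductive GateLabel where
  | const (t : ℕ) : GateLabel
  | input (i : ℕ) : GateLabel
  | add (arity : ℕ) : GateLabel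
  | mul (arity : ℕ) : GateLabel

/-- The numerical code of a label. -/
def GateLabel.code : GateLabel → ℕ
  | .const t => Nat.pair 0 t
  | .input i => Nat.pair 1 i
  | .add r => Nat.pair 2 r
  | .mul r => Nat.pair 3 r

/-- A field-independent description of a family of circuits; the first argument of every function
is the index of the circuit in the family. `wire s i u` is the `u`-th gate wired into gate `i`. -/
structure CircuitDescription where
  numGates : ℕ → ℕ
  label : ℕ → ℕ → GateLabel
  wire : ℕ → ℕ → ℕ → ℕ
  output : ℕ → ℕ → ℕ
  numConsts : ℕ → ℕ
  constOp : ℕ → ℕ → ConstOp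

namespace CircuitDescription

/-- All parts of the description are computable in logarithmic space. -/
structure Explicit (D : CircuitDescription) : Prop where
  numGates : LogSpace D.numGates
  label : LogSpace₂ fun s i => (D.label s i).code
  wire : LogSpace₃ D.wire
  output : LogSpace₂ D.output
  numConsts : LogSpace D.numConsts
  constOp : LogSpace₂ fun s i => (D.constOp s i).code

/-- The description of a single gate, `v` being the list of constants. -/
def DescribesGate (D : CircuitDescription) (s : ℕ) {K : Type*} {n : ℕ} (v : ℕ → K) (i : ℕ) :
    Gate K n → Prop
  | .const b => ∃ t < D.numConsts s, D.label s i = .const t ∧ b = v t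
  | .input j => D.label s i = .input j
  | .add l => D.label s i = .add l.length ∧ ∀ (u : ℕ) (h : u < l.length), l[u] = D.wire s i u
  | .mul l => D.label s i = .mul l.length ∧ ∀ (u : ℕ) (h : u < l.length), l[u] = D.wire s i u

/-- `C` is the circuit with index `s` in the family described by `D`, over the field `K`, with the
field constants computed from the elements `a 0, …, a (N - 1)`. -/
def Describes (D : CircuitDescription) (s : ℕ) {K : Type*} [Field K] {N n m : ℕ} (a : Fin N → K)
    (C : Circuit K n m) : Prop :=
  C.numGates = D.numGates s ∧ (∀ j, C.output j = D.output s j) ∧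
    ∃ v : ℕ → K, (∀ t < D.numConsts s, (D.constOp s t).Holds a v t) ∧
      ∀ i < C.numGates, D.DescribesGate s v i (C.gate i)

end CircuitDescription

/-! ### The greatest common divisor and coefficient vectors -/

open Classical in
/-- The (monic) greatest common divisor of two polynomials. -/
def monicGcd {K : Type*} [Field K] (f g : Polynomial K) : Polynomial K :=
  normalize (EuclideanDomain.gcd f g)

/-- The coefficients of `f` up to degree `d₁`, followed by those of `g` up to degree `d₂`. -/
def coeffVec {K : Type*} [Field K] (d₁ d₂ : ℕ) (f g : Polynomial K) :
    Fin ((d₁ + 1) + (d₂ + 1)) → K :=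
  Fin.append (fun i : Fin (d₁ + 1) => f.coeff i) (fun j : Fin (d₂ + 1) => g.coeff j)

end GcdCircuit

end

noncomputable section

namespace GcdCircuit

-- Write `f = d f'` and `g = d g'` with `d` the monic gcd, put `ℓ = x - y`, and take the resultant
-- in `y` of `F = f - tℓ` and `G = g + stℓ`. From `f' G = tℓ (g' + s f') + F g'` and the
-- multiplicativity of the resultant with the monic `F` one gets `Res(F, G) = ± t^(deg d) d(x)
-- Res(F, g' + s f')` (`resultant_pencil`). So the coefficients of `t^r` with `r < deg d` vanish,
-- and the coefficient of `t^(deg d)` is `± d(x) Res(f, g' + s f')`, a scalar multiple of `d(x)`.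
-- The scalar is nonzero once `f` and `g' + s f'` are coprime, which happens for some `s` among any
-- `deg d + 1` distinct elements (`exists_isCoprime_add`). A piece is a guess of `deg d` and of `s`.
-- Its test asks whether the coefficient of `t^r x^r` is nonzero, and pieces with smaller `r` come
-- later, so the last piece that passes has `r = deg d`. Division by that coefficient makes the
-- multiple of `d` monic (`CoeffData.IsValid.exists_isGreatest`).
--
-- The resultant itself is computed in constant depth, in any characteristic, by a deformation. With
-- distinct nodes `a i` write `F = ∏ (y - a i) + u` and consider `∏ (y - a i) + z u`. Its roots are
-- power series in `z` with constant terms `a i` (`deformation_eq_prod`), so its resultant with `G`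
-- is the product of the values of `G` at these series. As a polynomial in `z` this has degree at
-- most `n + m`, hence its value at `z = 1` is the sum of its first `n + m + 1` coefficients
-- (`resultant_eq_sum_coeff`). The coefficients of `G` at a root come from Lagrange inversion in the
-- division-free form `[z^k] H(φ) = [y^k] H ψ^(k-1) (ψ - y ψ')`, packaged as a ring homomorphism
-- (`lagrangeHom`). Every extraction of a coefficient is an interpolation at the nodes, that is, one
-- weighted sum, and the weights are constants: coefficients of Lagrange basis polynomials,
-- tabulated by the straight-line program (`constOp_holds`).
--
-- If `deg f ≤ 1` or `deg g = 0`, then `d` is `1` or the linear polynomial `f`, and one evaluation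
-- of `g` decides (`exists_isGreatest_of_degenerate`).
--
-- Explicitness is carried along compositionally: functions computable in logarithmic space are
-- closed under composition and polynomially bounded recursion (`LogSpace.prec`), and explicit
-- constant-depth families are closed under sums, products and case distinctions on the index
-- (`ConstDepth`). `exists_description_of_constDepth` turns such families into circuits with the
-- required size, depth and description.

universe u

/-! ### Logarithmic space: composition and bounded recursion for partial recursive codes. -/

section

open Nat.Partrec (Code)
open Nat.Partrec.Code

section EvalBounded

variable {k n : ℕ} {cf cg : Code}

theorem mem_evaln_zero (h : n < k) : 0 ∈ evaln k zero n := by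
  obtain ⟨k, rfl⟩ : ∃ l, k = l + 1 := ⟨k - 1, by omega⟩
  simp [evaln, Nat.lt_succ_iff.1 h, guard]

theorem mem_evaln_succ (h : n < k) : n + 1 ∈ evaln k succ n := by
  obtain ⟨k, rfl⟩ : ∃ l, k = l + 1 := ⟨k - 1, by omega⟩
  simp [evaln, Nat.lt_succ_iff.1 h]

theorem mem_evaln_left (h : n < k) : n.unpair.1 ∈ evaln k left n := by
  obtain ⟨k, rfl⟩ : ∃ l, k = l + 1 := ⟨k - 1, by omega⟩
  simp [evaln, Nat.lt_succ_iff.1 h]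

theorem mem_evaln_right (h : n < k) : n.unpair.2 ∈ evaln k right n := by
  obtain ⟨k, rfl⟩ : ∃ l, k = l + 1 := ⟨k - 1, by omega⟩
  simp [evaln, Nat.lt_succ_iff.1 h]

theorem mem_evaln_pair {x y : ℕ} (hx : x ∈ evaln k cf n) (hy : y ∈ evaln k cg n) :
    Nat.pair x y ∈ evaln k (pair cf cg) n := by
  have h := evaln_bound hx
  obtain ⟨k, rfl⟩ : ∃ l, k = l + 1 := ⟨k - 1, by omega⟩
  simp only [Option.mem_def] at hx hy
  simp [evaln, Nat.lt_succ_iff.1 h, hx, hy, Seq.seq]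

theorem mem_evaln_comp {x y : ℕ} (hx : x ∈ evaln k cg n) (hy : y ∈ evaln k cf x) :
    y ∈ evaln k (comp cf cg) n := by
  have h := evaln_bound hx
  obtain ⟨k, rfl⟩ : ∃ l, k = l + 1 := ⟨k - 1, by omega⟩
  simp only [Option.mem_def] at hx hy
  simp [evaln, Nat.lt_succ_iff.1 h, hx, hy]

theorem mem_evaln_prec_zero {a x : ℕ} (h : Nat.pair a 0 < k) (hx : x ∈ evaln k cf a) :
    x ∈ evaln k (prec cf cg) (Nat.pair a 0) := by
  obtain ⟨k, rfl⟩ : ∃ l, k = l + 1 := ⟨k - 1, by omega⟩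
  simp only [Option.mem_def] at hx
  simp [evaln, Nat.lt_succ_iff.1 h, hx]

theorem mem_evaln_prec_succ {a y i x : ℕ} (h : Nat.pair a (y + 1) < k + 1)
    (hi : i ∈ evaln k (prec cf cg) (Nat.pair a y))
    (hx : x ∈ evaln (k + 1) cg (Nat.pair a (Nat.pair y i))) :
    x ∈ evaln (k + 1) (prec cf cg) (Nat.pair a (y + 1)) := by
  simp only [Option.mem_def] at hx hi
  simp [evaln, Nat.lt_succ_iff.1 h, hi, hx]

theorem add_two_pow_le (n a b : ℕ) : ((n + 2) ^ a + 2) ^ b ≤ (n + 2) ^ ((a + 2) * b) := by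
  rw [pow_mul]
  refine Nat.pow_le_pow_left ?_ b
  have h : 1 ≤ (n + 2) ^ a := Nat.one_le_pow _ _ (by omega)
  have : (n + 2) ^ (a + 2) = (n + 2) ^ a * (n + 2) ^ 2 := pow_add _ _ _
  have h4 : 2 ^ 2 ≤ (n + 2) ^ 2 := Nat.pow_le_pow_left (by omega) 2
  rw [this]
  nlinarith [Nat.mul_le_mul_left ((n + 2) ^ a) h4]

theorem pair_le_sq (x y b : ℕ) (hx : x ≤ b) (hy : y ≤ b) : Nat.pair x y ≤ (b + 2) ^ 2 :=
  (Nat.pair_lt_max_add_one_sq x y).le.trans (Nat.pow_le_pow_left (by have := max_le hx hy; omega) 2)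

/-- Only pairing can push an output beyond the fuel, and the code contains a fixed number of
pairings, each of which roughly squares the bound. A composition or a recursion returns what its
last subprogram returns, and an unbounded search returns part of an argument that is below the fuel.
-/
theorem exists_evaln_le (c : Code) : ∃ e, ∀ k n x, x ∈ evaln k c n → x ≤ (k + 2) ^ e := by
  have self (k : ℕ) : k ≤ (k + 2) ^ 1 := by rw [pow_one]; omega
  have grow {k e e' : ℕ} (h : e ≤ e') : (k + 2) ^ e ≤ (k + 2) ^ e' :=
    Nat.pow_le_pow_right (by omega) h
  induction c with
  | zero =>
    refine ⟨1, fun k n x h => ?_⟩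
    have := mem_evaln_zero (evaln_bound h)
    cases Option.mem_unique h this; exact Nat.zero_le _
  | succ =>
    refine ⟨1, fun k n x h => ?_⟩
    have h1 := evaln_bound h
    have := mem_evaln_succ h1
    cases Option.mem_unique h this; exact (by omega : n + 1 ≤ k).trans (self k)
  | left =>
    refine ⟨1, fun k n x h => ?_⟩
    have h1 := evaln_bound h
    have := mem_evaln_left h1
    cases Option.mem_unique h this
    exact ((Nat.unpair_left_le n).trans h1.le).trans (self k)
  | right =>
    refine ⟨1, fun k n x h => ?_⟩
    have h1 := evaln_bound h
    have := mem_evaln_right h1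
    cases Option.mem_unique h this
    exact ((Nat.unpair_right_le n).trans h1.le).trans (self k)
  | pair cf cg hf hg =>
    obtain ⟨e, he⟩ := hf
    obtain ⟨e', he'⟩ := hg
    refine ⟨(max e e' + 2) * 2, fun k n x h => ?_⟩
    obtain ⟨l, rfl⟩ : ∃ l, k = l + 1 := ⟨k - 1, by have := evaln_bound h; omega⟩
    simp only [evaln, Option.mem_def, Option.bind_eq_bind, Option.bind_eq_some_iff, Seq.seq,
      Option.map_eq_map, Option.map_eq_some_iff] at h
    obtain ⟨_, -, g, ⟨x, hx, rfl⟩, y, hy, rfl⟩ := h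
    exact (pair_le_sq x y _ ((he _ _ _ hx).trans (grow (le_max_left _ _)))
      ((he' _ _ _ hy).trans (grow (le_max_right _ _)))).trans (add_two_pow_le _ _ _)
  | comp cf cg hf hg =>
    obtain ⟨e, he⟩ := hf
    refine ⟨e, fun k n x h => ?_⟩
    obtain ⟨l, rfl⟩ : ∃ l, k = l + 1 := ⟨k - 1, by have := evaln_bound h; omega⟩
    simp only [evaln, Option.mem_def, Option.bind_eq_bind, Option.bind_eq_some_iff] at h
    obtain ⟨_, -, y, hy, hx⟩ := h
    exact he _ _ _ hx
  | prec cf cg hf hg =>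
    obtain ⟨e, he⟩ := hf
    obtain ⟨e', he'⟩ := hg
    refine ⟨max e e', fun k n x h => ?_⟩
    obtain ⟨l, rfl⟩ : ∃ l, k = l + 1 := ⟨k - 1, by have := evaln_bound h; omega⟩
    simp only [evaln, Option.mem_def, Option.bind_eq_bind, Option.bind_eq_some_iff,
      Nat.unpaired] at h
    obtain ⟨_, -, h⟩ := h
    revert h
    cases n.unpair.2 with
    | zero => exact fun h => (he _ _ _ h).trans (grow (le_max_left _ _))
    | succ y =>
      intro h
      simp only [Option.bind_eq_some_iff] at h
      obtain ⟨i, -, h⟩ := h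
      exact (he' _ _ _ h).trans (grow (le_max_right _ _))
  | rfind' cf hf =>
    refine ⟨1, fun k => ?_⟩
    induction k with
    | zero => intro n x h; simp [evaln] at h
    | succ k ih =>
      intro n x h
      have hn := evaln_bound h
      simp only [evaln, Option.mem_def, Option.bind_eq_bind, Option.bind_eq_some_iff,
        Nat.unpaired] at h
      obtain ⟨_, -, y, hy, h⟩ := h
      split_ifs at h with h0
      · cases h
        exact ((Nat.unpair_right_le n).trans hn.le).trans (self _)
      · exact (ih _ _ h).trans (Nat.pow_le_pow_left (by omega) _)

end EvalBounded

namespace LogSpace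

variable {F G : ℕ → ℕ}

theorem exists_le (hF : LogSpace F) : ∃ e, ∀ n, F n ≤ (n + 2) ^ e := by
  obtain ⟨c, e, h⟩ := hF
  obtain ⟨e', h'⟩ := exists_evaln_le c
  exact ⟨(e + 2) * e', fun n => (h' _ _ _ (h n)).trans (add_two_pow_le _ _ _)⟩

theorem of_code (c : Code) (h : ∀ k n, n < k → F n ∈ evaln k c n) : LogSpace F :=
  ⟨c, 1, fun n => h _ n (by rw [pow_one]; omega)⟩

theorem pair (hF : LogSpace F) (hG : LogSpace G) : LogSpace fun n => Nat.pair (F n) (G n) := by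
  obtain ⟨c, e, h⟩ := hF
  obtain ⟨c', e', h'⟩ := hG
  refine ⟨c.pair c', max e e', fun n => mem_evaln_pair (evaln_mono ?_ (h n)) (evaln_mono ?_ (h' n))⟩
  · exact Nat.pow_le_pow_right (by omega) (le_max_left _ _)
  · exact Nat.pow_le_pow_right (by omega) (le_max_right _ _)

/-- The fuel that `F` needs is polynomial in `G n`, and `G n` is polynomial in `n` by `exists_le`.
-/
theorem comp (hF : LogSpace F) (hG : LogSpace G) : LogSpace fun n => F (G n) := by
  obtain ⟨b, hb⟩ := hG.exists_le
  obtain ⟨c, e, h⟩ := hF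
  obtain ⟨c', e', h'⟩ := hG
  refine ⟨c.comp c', max ((b + 2) * e) e', fun n =>
    mem_evaln_comp (evaln_mono ?_ (h' n)) (evaln_mono ?_ (h (G n)))⟩
  · exact Nat.pow_le_pow_right (by omega) (le_max_right _ _)
  · calc (G n + 2) ^ e ≤ ((n + 2) ^ b + 2) ^ e := Nat.pow_le_pow_left (by have := hb n; omega) _
      _ ≤ _ := (add_two_pow_le _ _ _).trans (Nat.pow_le_pow_right (by omega) (le_max_left _ _))

/-- Recursion alone could leave logarithmic space; the hypothesis `hb` keeps all intermediate values
polynomial, so that every call of the step function gets by with a common power as fuel. -/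
theorem prec {H : ℕ → ℕ → ℕ} (hF : LogSpace F) (hG : LogSpace G)
    (h0 : ∀ a, H a 0 = F a) (hs : ∀ a y, H a (y + 1) = G (Nat.pair a (Nat.pair y (H a y))))
    (b : ℕ) (hb : ∀ a y, H a y ≤ (Nat.pair a y + 2) ^ b) :
    LogSpace fun n => H n.unpair.1 n.unpair.2 := by
  obtain ⟨c, e, h⟩ := hF
  obtain ⟨c', e', h'⟩ := hG
  obtain ⟨E, hE⟩ : ∃ E, E = (((b + 1 + 2) * 2 + 2) * 2 + 2) * e' + e + 1 := ⟨_, rfl⟩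
  -- `evaln` spends one unit of fuel per round of the recursion. The summand `y` pays for the
  -- rounds, and the power, which depends on the final `Y` only, is left for every single step.
  suffices key : ∀ a Y y, y ≤ Y → H a y ∈ evaln ((Nat.pair a Y + 2) ^ E + y) (c.prec c')
      (Nat.pair a y) by
    refine ⟨c.prec c', E + 1, fun n => ?_⟩
    have := key n.unpair.1 n.unpair.2 n.unpair.2 le_rfl
    rw [Nat.pair_unpair] at this
    refine evaln_mono ?_ this
    have h1 := Nat.unpair_right_le n
    have h2 : 1 ≤ (n + 2) ^ E := Nat.one_le_pow _ _ (by omega)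
    rw [pow_succ]; nlinarith
  intro a Y y hy
  have hmono {i j : ℕ} (hij : i ≤ j) : Nat.pair a i ≤ Nat.pair a j := by
    rcases hij.eq_or_lt with rfl | hij
    · exact le_rfl
    · exact (Nat.pair_lt_pair_right a hij).le
  have hpow {i : ℕ} (hi : i ≤ E) (j : ℕ) : (Nat.pair a Y + 2) ^ i ≤ (Nat.pair a Y + 2) ^ E + j :=
    (Nat.pow_le_pow_right (by omega) hi).trans (Nat.le_add_right _ _)
  have hlt {i : ℕ} (hi : i ≤ Y) (j : ℕ) : Nat.pair a i < (Nat.pair a Y + 2) ^ E + j := by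
    refine lt_of_lt_of_le ?_ (hpow (i := 1) (by omega) j)
    have := hmono hi
    rw [pow_one]; omega
  induction y with
  | zero =>
    refine mem_evaln_prec_zero (hlt hy 0) ?_
    rw [h0]
    refine evaln_mono ?_ (h a)
    refine (Nat.pow_le_pow_left ?_ e).trans (hpow (by omega) 0)
    have := Nat.left_le_pair a Y
    omega
  | succ y ih =>
    refine mem_evaln_prec_succ (hlt hy (y + 1)) (ih (by omega)) ?_
    rw [hs]
    refine evaln_mono ?_ (h' _)
    set N := Nat.pair a Y with hN
    have ha : a ≤ N := Nat.left_le_pair a Y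
    have hyN : y ≤ N := (by omega : y ≤ Y).trans (Nat.right_le_pair a Y)
    have hNb : N ≤ (N + 2) ^ (b + 1) := by
      have : 1 ≤ (N + 2) ^ b := Nat.one_le_pow _ _ (by omega)
      rw [pow_succ]; nlinarith
    have h1 : H a y ≤ (N + 2) ^ (b + 1) :=
      (hb a y).trans ((Nat.pow_le_pow_left (by have := hmono (i := y) (j := Y) (by omega); omega) b).trans
        (Nat.pow_le_pow_right (by omega) (by omega)))
    have h2 : Nat.pair y (H a y) ≤ (N + 2) ^ ((b + 1 + 2) * 2) :=
      (pair_le_sq _ _ _ (hyN.trans hNb) h1).trans (add_two_pow_le _ _ _)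
    have h3 : a ≤ (N + 2) ^ ((b + 1 + 2) * 2) :=
      ha.trans (hNb.trans (Nat.pow_le_pow_right (by omega) (by omega)))
    have h4 : Nat.pair a (Nat.pair y (H a y)) ≤ (N + 2) ^ (((b + 1 + 2) * 2 + 2) * 2) :=
      (pair_le_sq _ _ _ h3 h2).trans (add_two_pow_le _ _ _)
    refine (Nat.pow_le_pow_left (Nat.add_le_add_right h4 2) e').trans ?_
    refine (add_two_pow_le _ _ _).trans (hpow ?_ (y + 1))
    rw [hE]
    exact (Nat.le_add_right _ _).trans (Nat.le_add_right _ _)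

end LogSpace

end

/-! ### Arithmetic and case distinctions in logarithmic space. -/

section

open Encodable Denumerable

/-- A map between denumerable types that is computable in logarithmic space through the
enumerations. -/
def LS {α β : Type} [Denumerable α] [Denumerable β] (f : α → β) : Prop :=
  LogSpace fun n => encode (f (ofNat α n))

namespace LS

variable {α β γ : Type} [Denumerable α] [Denumerable β] [Denumerable γ]

theorem comp {g : β → γ} {f : α → β} (hg : LS g) (hf : LS f) : LS fun x => g (f x) := by
  simpa [LS] using LogSpace.comp hg hf

theorem prodMk {f : α → β} {g : α → γ} (hf : LS f) (hg : LS g) : LS fun x => (f x, g x) := by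
  simpa [LS] using LogSpace.pair hf hg

theorem id : LS fun x : α => x := by
  refine LogSpace.of_code (Nat.Partrec.Code.pair .left .right) fun k n h => ?_
  have := mem_evaln_pair (mem_evaln_left h) (mem_evaln_right h)
  simpa using this

theorem fst : LS fun x : α × β => x.1 := by
  refine LogSpace.of_code .left fun k n h => ?_
  have := mem_evaln_left h
  simpa using this

theorem snd : LS fun x : α × β => x.2 := by
  refine LogSpace.of_code .right fun k n h => ?_
  have := mem_evaln_right h
  simpa using this

theorem fst' {f : γ → α × β} (hf : LS f) : LS fun x => (f x).1 := fst.comp hf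

theorem snd' {f : γ → α × β} (hf : LS f) : LS fun x => (f x).2 := snd.comp hf

theorem succ {f : α → ℕ} (hf : LS f) : LS fun x => f x + 1 := by
  refine (?_ : LS fun n : ℕ => n + 1).comp hf
  refine LogSpace.of_code .succ fun k n h => ?_
  simpa using mem_evaln_succ h

theorem const (c : β) : LS fun _ : α => c := by
  have h (n : ℕ) : LS fun _ : α => n := by
    induction n with
    | zero =>
      refine LogSpace.of_code .zero fun k n h => ?_
      simpa using mem_evaln_zero h
    | succ n ih => exact ih.succ
  simpa [LS] using h (encode c)

theorem unpair {f : α → ℕ} (hf : LS f) : LS fun x => (f x).unpair := by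
  have h (n : ℕ) : Encodable.encode n.unpair = n := by
    rw [Encodable.encode_prod_val, Encodable.encode_nat, Encodable.encode_nat, Nat.pair_unpair]
  simpa only [LS, h, Encodable.encode_nat] using hf

theorem encode' : LS fun x : α => encode x := by
  simpa [LS] using id (α := ℕ)

theorem pair {f g : α → ℕ} (hf : LS f) (hg : LS g) : LS fun x => Nat.pair (f x) (g x) := by
  simpa [LS] using LogSpace.pair hf hg

theorem exists_le {f : α → ℕ} (hf : LS f) : ∃ e, ∀ x, f x ≤ (encode x + 2) ^ e := by
  obtain ⟨e, he⟩ := LogSpace.exists_le hf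
  exact ⟨e, fun x => by simpa using he (encode x)⟩

/-- The bounding function `b` enters only through its polynomial growth, which is what
`LogSpace.prec` asks for. -/
theorem rec {f : α → ℕ} {g : α × ℕ × ℕ → ℕ} {h : α → ℕ} {b : α × ℕ → ℕ}
    (hf : LS f) (hg : LS g) (hh : LS h) (H : α → ℕ → ℕ) (h0 : ∀ x, H x 0 = f x)
    (hs : ∀ x y, H x (y + 1) = g (x, y, H x y)) (hb : LS b) (hle : ∀ x y, H x y ≤ b (x, y)) :
    LS fun x => H x (h x) := by
  have key : LS fun p : α × ℕ => H p.1 p.2 := by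
    obtain ⟨e, he⟩ := hb.exists_le
    have := LogSpace.prec (H := fun a y => H (ofNat α a) y) hf hg (by simp [h0])
      (by simp [hs]) e (fun a y => (hle _ _).trans (by simpa using he (ofNat α a, y)))
    simpa [LS] using this
  exact key.comp (prodMk id hh)

/-- The natural bounding function in `LS.rec` would be the sum itself, so the recursion is justified
by a numerical bound in `LogSpace.prec` instead. -/
theorem add {f g : α → ℕ} (hf : LS f) (hg : LS g) : LS fun x => f x + g x := by
  obtain ⟨e, he⟩ := hf.exists_le
  have h1 : LS fun p : α × ℕ × ℕ => p.2.2 + 1 := (snd' (snd' id)).succ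
  have hle : ∃ e, ∀ a y : ℕ, a + y ≤ (Nat.pair a y + 2) ^ e := ⟨2, fun a y => by
    have h1 := Nat.left_le_pair a y
    have h2 := Nat.right_le_pair a y
    nlinarith⟩
  obtain ⟨e, he⟩ := hle
  have key : LS fun p : ℕ × ℕ => p.1 + p.2 := by
    have := LogSpace.prec (H := fun a y => a + y) (id (α := ℕ))
      (succ (snd' (snd' (id (α := ℕ × ℕ × ℕ))))) (by simp) (by simp [add_assoc]) e he
    simpa [LS] using this
  exact key.comp (prodMk hf hg)

/-- A case distinction is a recursion on `c x` whose step ignores the previous value. -/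
theorem ite_zero {c f g : α → ℕ} (hc : LS c) (hf : LS f) (hg : LS g) :
    LS fun x => if c x = 0 then f x else g x := by
  refine rec (b := fun p => f p.1 + g p.1) hf (g := fun p => g p.1) (hg.comp fst) hc
    (fun x y => if y = 0 then f x else g x) (by simp) (by simp)
    (((hf.comp fst)).add (hg.comp fst)) fun x y => ?_
  dsimp only; split_ifs <;> omega

theorem pred {f : α → ℕ} (hf : LS f) : LS fun x => f x - 1 := by
  have : LS fun x : ℕ => x - 1 := by
    refine rec (α := ℕ) (f := fun _ => 0) (b := fun p => p.2) (g := fun p => p.2.1) (h := fun x => x)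
      (const 0) (fst' (snd' id)) id (fun _ y => y - 1) (by simp) (by simp) (snd' id) (by simp)
  exact this.comp hf

theorem sub {f g : α → ℕ} (hf : LS f) (hg : LS g) : LS fun x => f x - g x :=
  rec (b := fun p => f p.1) (g := fun p => p.2.2 - 1) hf (snd' (snd' id)).pred hg
    (fun x y => f x - y) (by simp) (by intros; simp only; omega) (hf.comp fst) (by simp)

theorem mul {f g : α → ℕ} (hf : LS f) (hg : LS g) : LS fun x => f x * g x := by
  have key : LS fun p : ℕ × ℕ => p.1 * p.2 := by
    have := LogSpace.prec (H := fun a y => a * y) (const (α := ℕ) 0)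
      ((snd' (snd' (id (α := ℕ × ℕ × ℕ)))).add (fst' id)) (by simp)
      (by simp [Nat.mul_succ]) 2 (fun a y => by
        have h1 := Nat.left_le_pair a y
        have h2 := Nat.right_le_pair a y
        nlinarith)
    simpa [LS] using this
  exact key.comp (prodMk hf hg)

theorem pow {f : α → ℕ} (hf : LS f) (e : ℕ) : LS fun x => f x ^ e := by
  induction e with
  | zero => simpa using const 1
  | succ e ih => simpa [pow_succ] using ih.mul hf

end LS

/-- A predicate that is decidable in logarithmic space. -/
def LSPred {α : Type} [Denumerable α] (p : α → Prop) : Prop :=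
  ∃ c : α → ℕ, LS c ∧ ∀ x, p x ↔ c x = 0

namespace LSPred

variable {α : Type} [Denumerable α] {p q : α → Prop} {f g : α → ℕ}

theorem le (hf : LS f) (hg : LS g) : LSPred fun x => f x ≤ g x :=
  ⟨_, hf.sub hg, fun _ => by omega⟩

theorem lt (hf : LS f) (hg : LS g) : LSPred fun x => f x < g x :=
  ⟨_, hf.succ.sub hg, fun _ => by omega⟩

theorem eq (hf : LS f) (hg : LS g) : LSPred fun x => f x = g x :=
  ⟨_, (hf.sub hg).add (hg.sub hf), fun _ => by omega⟩

theorem and (hp : LSPred p) (hq : LSPred q) : LSPred fun x => p x ∧ q x := by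
  obtain ⟨c, hc, hc'⟩ := hp
  obtain ⟨d, hd, hd'⟩ := hq
  exact ⟨_, hc.add hd, fun x => by change _ ∧ _ ↔ _; rw [hc', hd']; omega⟩

theorem or (hp : LSPred p) (hq : LSPred q) : LSPred fun x => p x ∨ q x := by
  obtain ⟨c, hc, hc'⟩ := hp
  obtain ⟨d, hd, hd'⟩ := hq
  exact ⟨_, hc.mul hd, fun x => by change _ ∨ _ ↔ _; rw [hc', hd', mul_eq_zero]⟩

theorem comp {β : Type} [Denumerable β] {h : β → α} (hp : LSPred p) (hh : LS h) :
    LSPred fun x => p (h x) := by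
  obtain ⟨c, hc, hc'⟩ := hp
  exact ⟨_, hc.comp hh, fun x => hc' _⟩

end LSPred

namespace LS

variable {α : Type} [Denumerable α] {f g : α → ℕ}

theorem ite {p : α → Prop} [DecidablePred p] (hp : LSPred p) (hf : LS f) (hg : LS g) :
    LS fun x => if p x then f x else g x := by
  obtain ⟨c, hc, hc'⟩ := hp
  convert ite_zero hc hf hg using 3
  rw [hc']

/-- Counting the dividend upwards, the quotient `q` increases exactly when `(q + 1) * g x` is
reached. A zero divisor never triggers this, in agreement with the convention `y / 0 = 0`. -/
theorem div (hf : LS f) (hg : LS g) : LS fun x => f x / g x := by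
  refine rec (α := α) (f := fun _ => 0) (b := fun p => p.2)
    (g := fun p => if (p.2.2 + 1) * g p.1 = p.2.1 + 1 then p.2.2 + 1 else p.2.2)
    (const 0) ?_ hf (fun x y => y / g x) (by simp) ?_ (snd' id) (fun x y => Nat.div_le_self _ _)
  · exact ite (LSPred.eq ((snd' (snd' id)).succ.mul (hg.comp fst)) (fst' (snd' id)).succ)
      (snd' (snd' id)).succ (snd' (snd' id))
  · intro x y
    simp only [Nat.succ_div]
    by_cases h : g x ∣ y + 1
    · rw [if_pos h, if_pos]
      obtain ⟨k, hk⟩ := h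
      have hg : 0 < g x := Nat.pos_of_ne_zero fun h => by simp [h] at hk
      have : (y + 1) / g x = k := by rw [hk]; exact Nat.mul_div_cancel_left _ hg
      rw [Nat.succ_div, if_pos ⟨k, hk⟩] at this
      rw [this, hk, mul_comm]
    · rw [if_neg h, if_neg fun h' => h ⟨_, by rw [← h', mul_comm]⟩, add_zero]

theorem mod (hf : LS f) (hg : LS g) : LS fun x => f x % g x := by
  simp_rw [Nat.mod_eq_sub_mul_div]
  exact hf.sub (hg.mul (hf.div hg))

theorem min (hf : LS f) (hg : LS g) : LS fun x => min (f x) (g x) := by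
  simp_rw [min_def]
  exact ite (LSPred.le hf hg) hf hg

end LS

end

/-! ### Explicit families of constant-depth circuits and their closure properties. -/

section

open Encodable

/-- A field, a list of constants, and values of the input variables. -/
structure Ctx where
  K : Type u
  [field : Field K]
  const : ℕ → K
  input : ℕ → K

attribute [instance] Ctx.field

namespace GateLabel

/-- The fan-in of a gate with the given label. -/
def arity : GateLabel → ℕ
  | const _ => 0
  | input _ => 0
  | add r => r
  | mul r => r

/-- The value of a gate, `w u` being the value of its `u`-th argument. -/
def eval (Γ : Ctx.{u}) (w : ℕ → Γ.K) : GateLabel → Γ.K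
  | const t => Γ.const t
  | input i => Γ.input i
  | add r => ∑ u ∈ Finset.range r, w u
  | mul r => ∏ u ∈ Finset.range r, w u

theorem eval_congr {Γ : Ctx.{u}} {w w' : ℕ → Γ.K} {l : GateLabel} (h : ∀ u < l.arity, w u = w' u) :
    l.eval Γ w = l.eval Γ w' := by
  cases l with
  | const => rfl
  | input => rfl
  | add r => exact Finset.sum_congr rfl fun u hu => h u (Finset.mem_range.1 hu)
  | mul r => exact Finset.prod_congr rfl fun u hu => h u (Finset.mem_range.1 hu)

end GateLabel

/-- An explicit family of multi-output circuits of constant depth. -/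
structure Family (α : Type) [Denumerable α] where
  numGates : α → ℕ
  label : α → ℕ → GateLabel
  wire : α → ℕ → ℕ → ℕ
  output : α → ℕ → ℕ
  depth : ℕ
  level : α → ℕ → ℕ
  numGates_ls : LS numGates
  label_ls : LS fun p : α × ℕ => (label p.1 p.2).code
  wire_ls : LS fun p : (α × ℕ) × ℕ => wire p.1.1 p.1.2 p.2
  output_ls : LS fun p : α × ℕ => output p.1 p.2
  level_le : ∀ s i, level s i ≤ depth
  wire_lt : ∀ s i, ∀ u < (label s i).arity,
    wire s i u < i ∧ level s (wire s i u) < level s i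

/-- `val` assigns to every gate of the `s`-th circuit its value. -/
def Family.IsValuation {α : Type} [Denumerable α] (F : Family α) (Γ : Ctx.{u}) (s : α)
    (val : ℕ → Γ.K) : Prop :=
  ∀ i, val i = (F.label s i).eval Γ fun u => val (F.wire s i u)

/-- The functions `Φ Γ s j`, `j < b s`, are the outputs of an explicit family of circuits of
constant depth. -/
def ConstDepthMulti {α : Type} [Denumerable α] (b : α → ℕ) (Φ : (Γ : Ctx.{u}) → α → ℕ → Γ.K) :
    Prop :=
  ∃ F : Family α, (∀ s, ∀ j < b s, F.output s j < F.numGates s) ∧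
    ∀ Γ s, ∃ val, F.IsValuation Γ s val ∧ ∀ j < b s, val (F.output s j) = Φ Γ s j

/-- The functions `Φ Γ s` are computed by an explicit family of circuits of constant depth. -/
def ConstDepth {α : Type} [Denumerable α] (Φ : (Γ : Ctx.{u}) → α → Γ.K) : Prop :=
  ConstDepthMulti (fun _ => 1) fun Γ s _ => Φ Γ s

variable {α β : Type} [Denumerable α] [Denumerable β]

/-- One-gate circuits. -/
def Family.leaf (l : α → GateLabel) (h : LS fun s => (l s).code) (h0 : ∀ s, (l s).arity = 0) :
    Family α where
  numGates _ := 1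
  label s _ := l s
  wire _ _ _ := 0
  output _ _ := 0
  depth := 0
  level _ _ := 0
  numGates_ls := .const 1
  label_ls := h.comp .fst
  wire_ls := .const 0
  output_ls := .const 0
  level_le _ _ := le_rfl
  wire_lt s i u hu := by simp [h0] at hu

/-- The circuits with indices `f s`. -/
def Family.reindex (F : Family β) (f : α → β) (hf : LS f) : Family α where
  numGates s := F.numGates (f s)
  label s := F.label (f s)
  wire s := F.wire (f s)
  output s := F.output (f s)
  depth := F.depth
  level s := F.level (f s)
  numGates_ls := F.numGates_ls.comp hf
  label_ls := F.label_ls.comp (.prodMk (hf.comp .fst) .snd)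
  wire_ls := F.wire_ls.comp (.prodMk (.prodMk (hf.comp (.fst' .fst)) (.snd' .fst)) .snd)
  output_ls := F.output_ls.comp (.prodMk (hf.comp .fst) .snd)
  level_le _ := F.level_le _
  wire_lt _ := F.wire_lt _

/-- A choice between two circuits, according to the index. -/
def Family.ite (p : α → Prop) [DecidablePred p] (hp : LSPred p) (F G : Family α) : Family α where
  numGates s := if p s then F.numGates s else G.numGates s
  label s i := if p s then F.label s i else G.label s i
  wire s i u := if p s then F.wire s i u else G.wire s i u
  output s i := if p s then F.output s i else G.output s i
  depth := max F.depth G.depth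
  level s i := if p s then F.level s i else G.level s i
  numGates_ls := .ite hp F.numGates_ls G.numGates_ls
  label_ls := by
    simp_rw [apply_ite GateLabel.code]
    exact .ite (hp.comp .fst) F.label_ls G.label_ls
  wire_ls := .ite (hp.comp (.fst' .fst)) F.wire_ls G.wire_ls
  output_ls := .ite (hp.comp .fst) F.output_ls G.output_ls
  level_le s i := by
    split_ifs
    · exact (F.level_le s i).trans (le_max_left _ _)
    · exact (G.level_le s i).trans (le_max_right _ _)
  wire_lt s i u hu := by
    split_ifs at hu ⊢
    · exact F.wire_lt s i u hu
    · exact G.wire_lt s i u hu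

/-- The circuits `F (s, v)`, put next to each other in blocks of `N s` gates. -/
def Family.parallel (F : Family (α × ℕ)) (b N : α → ℕ) (hb : LS b) (hN : LS N) : Family α where
  numGates s := b s * N s
  -- Surplus positions of a block become empty sums. The `min` matters only for `N s = 0`, where `i
  -- % N s = i` would not lie in a block.
  label s i := if i % N s < min (N s) (F.numGates (s, i / N s)) then
    F.label (s, i / N s) (i % N s) else .add 0
  wire s i u := i / N s * N s + F.wire (s, i / N s) (i % N s) u
  output s j := j * N s + F.output (s, j) 0
  depth := F.depth
  level s i := F.level (s, i / N s) (i % N s)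
  numGates_ls := hb.mul hN
  label_ls := by
    simp_rw [apply_ite GateLabel.code]
    have h1 : LS fun p : α × ℕ => N p.1 := hN.comp .fst
    have h2 : LS fun p : α × ℕ => p.2 / N p.1 := .div .snd h1
    have h3 : LS fun p : α × ℕ => p.2 % N p.1 := .mod .snd h1
    exact .ite (.lt h3 (.min h1 (F.numGates_ls.comp (.prodMk .fst h2))))
      (F.label_ls.comp (.prodMk (.prodMk .fst h2) h3)) (.const _)
  wire_ls := by
    have h1 : LS fun p : (α × ℕ) × ℕ => N p.1.1 := hN.comp (.fst' .fst)
    have h2 : LS fun p : (α × ℕ) × ℕ => p.1.2 / N p.1.1 := .div (.snd' .fst) h1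
    have h3 : LS fun p : (α × ℕ) × ℕ => p.1.2 % N p.1.1 := .mod (.snd' .fst) h1
    exact .add (h2.mul h1)
      (F.wire_ls.comp (.prodMk (.prodMk (.prodMk (.fst' .fst) h2) h3) .snd))
  output_ls := .add (.mul .snd (hN.comp .fst)) (F.output_ls.comp (.prodMk .id (.const 0)))
  level_le s i := F.level_le _ _
  wire_lt s i u hu := by
    split_ifs at hu with h
    · have h1 := F.wire_lt _ _ u hu
      have h2 : F.wire (s, i / N s) (i % N s) u < N s := by omega
      have h3 : (i / N s * N s + F.wire (s, i / N s) (i % N s) u) / N s = i / N s := by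
        rw [mul_comm, Nat.mul_add_div (by omega), Nat.div_eq_of_lt h2, add_zero]
      have h4 : (i / N s * N s + F.wire (s, i / N s) (i % N s) u) % N s =
          F.wire (s, i / N s) (i % N s) u := by
        rw [mul_comm, Nat.mul_add_mod, Nat.mod_eq_of_lt h2]
      rw [h3, h4]
      refine ⟨?_, h1.2⟩
      have := Nat.div_add_mod' i (N s)
      omega
    · simp [GateLabel.arity] at hu

/-- A gate with label `l b` that takes the `b` outputs as arguments. -/
def Family.top (F : Family α) (b : α → ℕ) (l : α → GateLabel) (hl : LS fun s => (l s).code)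
    (hb : ∀ s, (l s).arity = b s) (h : ∀ s, ∀ j < b s, F.output s j < F.numGates s) : Family α where
  numGates s := F.numGates s + 1
  label s i := if i < F.numGates s then F.label s i else if i = F.numGates s then l s else .add 0
  wire s i u := if i < F.numGates s then F.wire s i u else F.output s u
  output s _ := F.numGates s
  depth := F.depth + 1
  level s i := if i < F.numGates s then F.level s i else F.depth + 1
  numGates_ls := F.numGates_ls.succ
  label_ls := by
    simp_rw [apply_ite GateLabel.code]
    exact .ite (.lt .snd (F.numGates_ls.comp .fst)) F.label_ls
      (.ite (.eq .snd (F.numGates_ls.comp .fst)) (hl.comp .fst) (.const _))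
  wire_ls := .ite (.lt (.snd' .fst) (F.numGates_ls.comp (.fst' .fst))) F.wire_ls
    (F.output_ls.comp (.prodMk (.fst' .fst) .snd))
  output_ls := F.numGates_ls.comp .fst
  level_le s i := by
    split_ifs
    · exact (F.level_le s i).trans (Nat.le_succ _)
    · exact le_rfl
  wire_lt s i u hu := by
    by_cases h1 : i < F.numGates s
    · simp only [h1, if_true] at hu ⊢
      have := F.wire_lt s i u hu
      rw [if_pos (by omega)]
      exact this
    · simp only [h1, if_false] at hu ⊢
      split_ifs at hu with h2
      · have := h s u (by rwa [hb] at hu)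
        rw [if_pos this]
        exact ⟨by omega, Nat.lt_succ_of_le (F.level_le _ _)⟩
      · simp [GateLabel.arity] at hu

namespace ConstDepthMulti

theorem reindex {b : β → ℕ} {Φ : (Γ : Ctx.{u}) → β → ℕ → Γ.K} (h : ConstDepthMulti b Φ) {f : α → β}
    (hf : LS f) : ConstDepthMulti (fun s => b (f s)) fun Γ s => Φ Γ (f s) := by
  obtain ⟨F, h1, h2⟩ := h
  exact ⟨F.reindex f hf, fun s => h1 (f s), fun Γ s => h2 Γ (f s)⟩

/-- Circuits of different sizes are padded to a common block size, so that gate numbers translate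
into block and offset by division with remainder. -/
theorem of_constDepth {Φ : (Γ : Ctx.{u}) → α → ℕ → Γ.K} {b : α → ℕ}
    (h : ConstDepth fun Γ (p : α × ℕ) => Φ Γ p.1 p.2) (hb : LS b) : ConstDepthMulti b Φ := by
  obtain ⟨F, h1, h2⟩ := h
  obtain ⟨e, he⟩ := F.numGates_ls.exists_le
  obtain ⟨N, hN, hNl⟩ : ∃ N : α → ℕ, LS N ∧ ∀ s, ∀ v < b s, F.numGates (s, v) ≤ N s := by
    -- Instead of a maximum over `v < b s`, the block size is the polynomial bound for the number of
    -- gates, which is monotone in `v`, taken at `v = b s`.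
    refine ⟨fun s => (Nat.pair (encode s) (b s) + 2) ^ e,
      .pow (LS.succ (LS.succ (LS.pair LS.encode' hb))) e, fun s v hv => (he (s, v)).trans ?_⟩
    refine Nat.pow_le_pow_left ?_ e
    rw [Encodable.encode_prod_val]
    have := Nat.pair_lt_pair_right (encode s) hv
    simp only [Encodable.encode_nat]
    omega
  have hout (s : α) (j : ℕ) (hj : j < b s) : F.output (s, j) 0 < N s :=
    (h1 (s, j) 0 one_pos).trans_le (hNl s j hj)
  have hdiv (s : α) (j r : ℕ) (hr : r < N s) : (j * N s + r) / N s = j := by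
    rw [mul_comm, Nat.mul_add_div (by omega), Nat.div_eq_of_lt hr, add_zero]
  have hmod (s : α) (j r : ℕ) (hr : r < N s) : (j * N s + r) % N s = r := by
    rw [mul_comm, Nat.mul_add_mod, Nat.mod_eq_of_lt hr]
  refine ⟨F.parallel b N hb hN, fun s j hj => ?_, fun Γ s => ?_⟩
  · change j * N s + F.output (s, j) 0 < b s * N s
    have := hout s j hj
    calc j * N s + F.output (s, j) 0 < (j + 1) * N s := by rw [add_mul, one_mul]; omega
      _ ≤ b s * N s := Nat.mul_le_mul_right _ hj
  choose val hval hval' using fun v => h2 Γ (s, v)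
  obtain ⟨W, hW⟩ : ∃ W : ℕ → Γ.K, ∀ i, W i =
      if i % N s < min (N s) (F.numGates (s, i / N s)) then val (i / N s) (i % N s) else 0 :=
    ⟨_, fun _ => rfl⟩
  have hW' (v r : ℕ) (hr : r < N s) (hr' : r < F.numGates (s, v)) : W (v * N s + r) = val v r := by
    rw [hW, hdiv _ _ _ hr, hmod _ _ _ hr, if_pos (by omega)]
  refine ⟨W, fun i => ?_, fun j hj => ?_⟩
  · change W i = (if i % N s < min (N s) (F.numGates (s, i / N s)) then
      F.label (s, i / N s) (i % N s) else .add 0).eval Γ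
        fun u => W (i / N s * N s + F.wire (s, i / N s) (i % N s) u)
    by_cases h : i % N s < min (N s) (F.numGates (s, i / N s))
    · rw [hW, if_pos h, if_pos h, hval]
      refine GateLabel.eval_congr fun u hu => ?_
      have hw := (F.wire_lt _ _ u hu).1
      rw [hW' _ _ (by omega) (by omega)]
    · rw [hW, if_neg h, if_neg h]
      simp [GateLabel.eval]
  · exact (hW' _ _ (hout s j hj) (h1 (s, j) 0 one_pos)).trans (hval' j 0 one_pos)

theorem top {b : α → ℕ} {Φ : (Γ : Ctx.{u}) → α → ℕ → Γ.K} (h : ConstDepthMulti b Φ)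
    (l : α → GateLabel) (hl : LS fun s => (l s).code) (hb : ∀ s, (l s).arity = b s) :
    ConstDepth fun Γ s => (l s).eval Γ (Φ Γ s) := by
  obtain ⟨F, h1, h2⟩ := h
  refine ⟨F.top b l hl hb h1, fun s j _ => Nat.lt_succ_self _, fun Γ s => ?_⟩
  obtain ⟨val, hval, hval'⟩ := h2 Γ s
  have key : (l s).eval Γ (fun u => if F.output s u < F.numGates s then val (F.output s u) else
      if F.output s u = F.numGates s then (l s).eval Γ (Φ Γ s) else 0) =
      (l s).eval Γ (Φ Γ s) := by
    refine GateLabel.eval_congr fun u hu => ?_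
    rw [hb] at hu
    rw [if_pos (h1 s u hu), hval' u hu]
  refine ⟨fun i => if i < F.numGates s then val i else
    if i = F.numGates s then (l s).eval Γ (Φ Γ s) else 0, fun i => ?_, fun j _ => ?_⟩
  · simp only [Family.top]
    rcases lt_trichotomy i (F.numGates s) with h | h | h
    · simp only [h, if_true]
      rw [hval]
      refine GateLabel.eval_congr fun u hu => ?_
      have := (F.wire_lt s i u hu).1
      rw [if_pos (by omega)]
    · subst h
      simp only [lt_irrefl, if_true, if_false]
      exact key.symm
    · simp [h.not_gt, h.ne', GateLabel.eval]
  · simp [Family.top]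

end ConstDepthMulti

namespace ConstDepth

theorem reindex {Φ : (Γ : Ctx.{u}) → β → Γ.K} (h : ConstDepth Φ) {f : α → β}
    (hf : LS f) : ConstDepth fun Γ s => Φ Γ (f s) :=
  ConstDepthMulti.reindex h hf

theorem leaf (l : α → GateLabel) (h : LS fun s => (l s).code) (h0 : ∀ s, (l s).arity = 0) :
    ConstDepth.{u} fun Γ s => (l s).eval Γ fun _ => 0 := by
  refine ⟨Family.leaf l h h0, fun s j _ => one_pos, fun Γ s =>
    ⟨fun _ => (l s).eval Γ fun _ => 0, fun i => ?_, fun j _ => rfl⟩⟩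
  exact GateLabel.eval_congr fun u hu => by simp [h0] at hu

theorem const {t : α → ℕ} (ht : LS t) : ConstDepth.{u} fun Γ s => Γ.const (t s) :=
  leaf (fun s => .const (t s)) (LS.pair (.const 0) ht) fun _ => rfl

theorem input {t : α → ℕ} (ht : LS t) : ConstDepth.{u} fun Γ s => Γ.input (t s) :=
  leaf (fun s => .input (t s)) (LS.pair (.const 1) ht) fun _ => rfl

/-- Empty sums and products supply `0` and `1` without recourse to the straight-line program. -/
theorem zero : ConstDepth.{u} fun Γ (_ : α) => (0 : Γ.K) := by
  simpa [GateLabel.eval] using leaf.{u} (fun _ : α => .add 0) (.const _) fun _ => rfl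

theorem one : ConstDepth.{u} fun Γ (_ : α) => (1 : Γ.K) := by
  simpa [GateLabel.eval] using leaf.{u} (fun _ : α => .mul 0) (.const _) fun _ => rfl

theorem sum {Φ : (Γ : Ctx.{u}) → α → ℕ → Γ.K} {b : α → ℕ}
    (h : ConstDepth fun Γ (p : α × ℕ) => Φ Γ p.1 p.2) (hb : LS b) :
    ConstDepth fun Γ s => ∑ v ∈ Finset.range (b s), Φ Γ s v :=
  (ConstDepthMulti.of_constDepth h hb).top (fun s => .add (b s)) (LS.pair (.const 2) hb) fun _ => rfl

theorem prod {Φ : (Γ : Ctx.{u}) → α → ℕ → Γ.K} {b : α → ℕ}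
    (h : ConstDepth fun Γ (p : α × ℕ) => Φ Γ p.1 p.2) (hb : LS b) :
    ConstDepth fun Γ s => ∏ v ∈ Finset.range (b s), Φ Γ s v :=
  (ConstDepthMulti.of_constDepth h hb).top (fun s => .mul (b s)) (LS.pair (.const 3) hb) fun _ => rfl

theorem ite {p : α → Prop} [DecidablePred p] (hp : LSPred p) {Φ Ψ : (Γ : Ctx.{u}) → α → Γ.K}
    (h : ConstDepth Φ) (h' : ConstDepth Ψ) :
    ConstDepth fun Γ s => if p s then Φ Γ s else Ψ Γ s := by
  obtain ⟨F, h1, h2⟩ := h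
  obtain ⟨G, h3, h4⟩ := h'
  refine ⟨F.ite p hp G, fun s j hj => ?_, fun Γ s => ?_⟩
  · simp only [Family.ite]
    split_ifs
    exacts [h1 s j hj, h3 s j hj]
  · simp only [Family.ite, Family.IsValuation]
    split_ifs
    exacts [h2 Γ s, h4 Γ s]

theorem add {Φ Ψ : (Γ : Ctx.{u}) → α → Γ.K} (h : ConstDepth Φ) (h' : ConstDepth Ψ) :
    ConstDepth fun Γ s => Φ Γ s + Ψ Γ s := by
  have := sum (b := fun _ : α => 2) (Φ := fun Γ s v => if v = 0 then Φ Γ s else Ψ Γ s) (ite (LSPred.eq LS.snd (LS.const 0)) (h.reindex LS.fst)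
    (h'.reindex (LS.fst (β := ℕ)))) (.const 2)
  simpa [Finset.sum_range_succ] using this

theorem mul {Φ Ψ : (Γ : Ctx.{u}) → α → Γ.K} (h : ConstDepth Φ) (h' : ConstDepth Ψ) :
    ConstDepth fun Γ s => Φ Γ s * Ψ Γ s := by
  have := prod (b := fun _ : α => 2) (Φ := fun Γ s v => if v = 0 then Φ Γ s else Ψ Γ s) (ite (LSPred.eq LS.snd (LS.const 0)) (h.reindex LS.fst)
    (h'.reindex (LS.fst (β := ℕ)))) (.const 2)
  simpa [Finset.prod_range_succ] using this

theorem pow {Φ : (Γ : Ctx.{u}) → α → Γ.K} (h : ConstDepth Φ) {e : α → ℕ} (he : LS e) :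
    ConstDepth fun Γ s => Φ Γ s ^ e s := by
  simpa using prod (Φ := fun Γ s _ => Φ Γ s) (h.reindex LS.fst) he

end ConstDepth

end

/-! ### From families to circuits over a field, with their sizes, depths and descriptions. -/

section

open Encodable Denumerable

namespace Circuit

section Value

variable {K : Type u} [Field K] {n m : ℕ}

theorem value_const {C : Circuit K n m} {x : Fin n → K} {i : ℕ} {a : K} (h : C.gate i = .const a) :
    C.value x i = a := by
  rw [value]; split <;> simp_all

theorem value_input {C : Circuit K n m} {x : Fin n → K} {i : ℕ} {j : Fin n}
    (h : C.gate i = .input j) : C.value x i = x j := by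
  rw [value]; split <;> simp_all

theorem value_add {C : Circuit K n m} {x : Fin n → K} {i : ℕ} {l : List ℕ} (h : C.gate i = .add l) :
    C.value x i = (l.map (C.value x)).sum := by
  rw [value]
  split
  · simp_all
  · simp_all
  · rename_i l' h'
    obtain rfl : l' = l := by simpa [h] using h'.symm
    rw [List.attach_map_val (f := C.value x)]
  · simp_all

theorem value_mul {C : Circuit K n m} {x : Fin n → K} {i : ℕ} {l : List ℕ} (h : C.gate i = .mul l) :
    C.value x i = (l.map (C.value x)).prod := by
  rw [value]
  split
  · simp_all
  · simp_all
  · simp_all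
  · rename_i l' h'
    obtain rfl : l' = l := by simpa [h] using h'.symm
    rw [List.attach_map_val (f := C.value x)]

end Value

theorem depthAt_le {K : Type u} {n m : ℕ} {C : Circuit K n m} {level : ℕ → ℕ}
    (h : ∀ i, ∀ j ∈ (C.gate i).children, level j < level i) (i : ℕ) : C.depthAt i ≤ level i := by
  induction i using Nat.strong_induction_on with
  | _ i ih =>
    rw [depthAt, List.attach_map_val (f := fun j => C.depthAt j + 1)]
    have key : ∀ l : List ℕ, (∀ j ∈ l, j < i ∧ level j < level i) →
        (l.map fun j => C.depthAt j + 1).foldr max 0 ≤ level i := by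
      intro l
      induction l with
      | nil => simp
      | cons j l ihl =>
        intro hl
        have hj := hl j List.mem_cons_self
        have := ih j hj.1
        exact max_le (by simp only; omega) (ihl fun k hk => hl k (List.mem_cons_of_mem _ hk))
    exact key _ fun j hj => ⟨C.acyclic i j hj, h i j hj⟩

end Circuit

/-- The gate with label `l` whose `u`-th argument is `w u`. Input variables that do not exist count
as zero. -/
def GateLabel.toGate {K : Type u} (v : ℕ → K) (n : ℕ) (w : ℕ → ℕ) : GateLabel → Gate K n
  | const t => .const (v t)
  | input j => if h : j < n then .input ⟨j, h⟩ else .add []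
  | add r => .add ((List.range r).map w)
  | mul r => .mul ((List.range r).map w)

theorem GateLabel.exists_of_mem_children {K : Type u} {v : ℕ → K} {n : ℕ} {w : ℕ → ℕ}
    {l : GateLabel} {j : ℕ} (h : j ∈ (l.toGate v n w).children) : ∃ u < l.arity, w u = j := by
  cases l with
  | const => simp [toGate, Gate.children] at h
  | input =>
    simp only [toGate] at h
    split_ifs at h <;> simp [Gate.children] at h
  | add r => simpa [toGate, Gate.children, arity] using h
  | mul r => simpa [toGate, Gate.children, arity] using h

/-- The fan-in is a component of the code, so a bound for the codes of labels also bounds the number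
of wires. -/
theorem GateLabel.length_children_le {K : Type u} (v : ℕ → K) (n : ℕ) (w : ℕ → ℕ)
    (l : GateLabel) : (l.toGate v n w).children.length ≤ l.code := by
  cases l with
  | const => simp [toGate, Gate.children]
  | input =>
    simp only [toGate]
    split_ifs <;> simp [Gate.children]
  | add r => simpa [toGate, Gate.children, code] using Nat.right_le_pair 2 r
  | mul r => simpa [toGate, Gate.children, code] using Nat.right_le_pair 3 r

/-- Replaces input variables from `n` on by zero. -/
def GateLabel.clip (n : ℕ) : GateLabel → GateLabel
  | const t => .const t
  | input j => if j < n then .input j else .add 0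
  | add r => .add r
  | mul r => .mul r

theorem GateLabel.code_clip (n : ℕ) (l : GateLabel) : (l.clip n).code =
    if l.code.unpair.1 = 1 ∧ n ≤ l.code.unpair.2 then Nat.pair 2 0 else l.code := by
  cases l with
  | input j =>
    simp only [clip, code, Nat.unpair_pair, true_and]
    split_ifs with h h' h'
    · omega
    · rfl
    · rfl
    · omega
  | _ => simp [clip, code]

namespace Family

section Circuit

variable {α : Type} [Denumerable α] (F : Family α)

/-- The `s`-th circuit of a family, over a field, with constants `v`. -/
def circuit (s : α) {K : Type u} (v : ℕ → K) (n m : ℕ)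
    (h : ∀ j < m, F.output s j < F.numGates s) : Circuit K n m where
  numGates := F.numGates s
  gate i := (F.label s i).toGate v n (F.wire s i)
  acyclic i j hj := by
    obtain ⟨u, hu, rfl⟩ := GateLabel.exists_of_mem_children hj
    exact (F.wire_lt s i u hu).1
  output j := F.output s j
  output_lt j := h j j.2

variable {s : α} {n m : ℕ} {h : ∀ j < m, F.output s j < F.numGates s}

theorem depth_circuit_le {K : Type u} {v : ℕ → K} :
    (F.circuit s v n m h).depth ≤ F.depth := by
  refine Finset.sup_le fun i _ => (Circuit.depthAt_le (level := F.level s) ?_ i).trans (F.level_le s i)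
  intro i j hj
  obtain ⟨u, hu, rfl⟩ := GateLabel.exists_of_mem_children hj
  exact (F.wire_lt s i u hu).2

theorem size_circuit_le {K : Type u} {v : ℕ → K} {b : ℕ}
    (hb : ∀ i < F.numGates s, (F.label s i).code ≤ b) :
    (F.circuit s v n m h).size ≤ F.numGates s + F.numGates s * b := by
  refine Nat.add_le_add_left ?_ _
  refine (Finset.sum_le_card_nsmul _ _ b fun i hi => ?_).trans (by simp [circuit])
  exact (GateLabel.length_children_le _ _ _ _).trans (hb i (Finset.mem_range.1 hi))

theorem value_circuit (Γ : Ctx.{u}) {x : Fin n → Γ.K}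
    (hx : ∀ j, Γ.input j = if h : j < n then x ⟨j, h⟩ else 0) {val : ℕ → Γ.K}
    (hval : F.IsValuation Γ s val) (i : ℕ) : (F.circuit s Γ.const n m h).value x i = val i := by
  induction i using Nat.strong_induction_on with
  | _ i ih =>
    rw [hval]
    have hw := fun u hu => (F.wire_lt s i u hu).1
    have hg : (F.circuit s Γ.const n m h).gate i = (F.label s i).toGate Γ.const n (F.wire s i) := rfl
    cases hl : F.label s i with
    | const t =>
      rw [hl] at hg
      exact Circuit.value_const hg
    | input j =>
      rw [hl] at hg
      simp only [GateLabel.toGate] at hg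
      simp only [GateLabel.eval, hx]
      split_ifs at hg ⊢
      · exact Circuit.value_input hg
      · rw [Circuit.value_add hg]; simp
    | add r =>
      rw [hl] at hg hw
      rw [Circuit.value_add hg, List.map_map]
      exact Finset.sum_congr (M := Γ.K) rfl fun u hu => ih _ (hw u (Finset.mem_range.1 hu))
    | mul r =>
      rw [hl] at hg hw
      rw [Circuit.value_mul hg, List.map_map]
      exact Finset.prod_congr (M := Γ.K) rfl fun u hu => ih _ (hw u (Finset.mem_range.1 hu))

end Circuit

/-- The index of a circuit: the degrees and the piece. -/
abbrev Index := (ℕ × ℕ) × ℕ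

/-- The number of input variables. -/
def Index.inputs (s : Index) : ℕ := (s.1.1 + 1) + (s.1.2 + 1)

variable (F : Family Index)

/-- A bound for the codes of all labels of the `s`-th circuit. -/
def codeBound (e : ℕ) (s : Index) : ℕ := (Nat.pair (encode s) (F.numGates s) + 2) ^ e

theorem codeBound_ls (e : ℕ) : LS (F.codeBound e) :=
  .pow (.succ (.succ (.pair .encode' F.numGates_ls))) e

/-- Labels are computable in logarithmic space, hence polynomially bounded in the pair of circuit
and gate. This one bound controls both the wires and the positions of the constants in use. -/
theorem exists_code_le : ∃ e, ∀ s, ∀ i < F.numGates s, (F.label s i).code ≤ F.codeBound e s := by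
  obtain ⟨e, he⟩ := F.label_ls.exists_le
  refine ⟨e, fun s i hi => (he (s, i)).trans (Nat.pow_le_pow_left ?_ e)⟩
  rw [Encodable.encode_prod_val, Encodable.encode_nat]
  have := Nat.pair_lt_pair_right (encode s) hi
  omega

/-- The description of a family of circuits, with a given straight-line program for the
constants. -/
def description (op : ℕ × ℕ → ℕ → ConstOp) (e : ℕ) : CircuitDescription where
  numGates s := F.numGates (ofNat Index s)
  label s i := (F.label (ofNat Index s) i).clip (Index.inputs (ofNat Index s))
  wire s := F.wire (ofNat Index s)
  output s := F.output (ofNat Index s)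
  -- The position of a constant is at most the code of the label that uses it, so this many steps of
  -- the program suffice.
  numConsts s := F.codeBound e (ofNat Index s) + 1
  constOp s := op (ofNat Index s).1

theorem description_explicit {op : ℕ × ℕ → ℕ → ConstOp}
    (hop : LS fun p : (ℕ × ℕ) × ℕ => (op p.1 p.2).code) (e : ℕ) :
    (F.description op e).Explicit where
  numGates := by simpa [LS, description] using F.numGates_ls
  label := by
    have : LS fun p : Index × ℕ => ((F.label p.1 p.2).clip p.1.inputs).code := by
      simp_rw [GateLabel.code_clip]
      have h : LS fun p : Index × ℕ => p.1.inputs :=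
        .add (.succ (.fst' (.fst' .fst))) (.succ (.snd' (.fst' .fst)))
      exact .ite (.and (.eq (.fst' (.unpair F.label_ls)) (.const 1))
        (.le h (.snd' (.unpair F.label_ls)))) (.const _) F.label_ls
    simpa [LS, LogSpace₂, description] using this
  wire := by
    have := F.wire_ls
    simpa [LS, LogSpace₃, LogSpace₂, description] using this
  output := by
    have := F.output_ls
    simpa [LS, LogSpace₂, description] using this
  numConsts := by
    have := (F.codeBound_ls e).succ
    simpa [LS, description] using this
  constOp := by
    have : LS fun p : Index × ℕ => (op p.1.1 p.2).code := hop.comp (.prodMk (.fst' .fst) .snd)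
    simpa [LS, LogSpace₂, description] using this

theorem description_describes {op : ℕ × ℕ → ℕ → ConstOp} {e : ℕ}
    (he : ∀ s, ∀ i < F.numGates s, (F.label s i).code ≤ F.codeBound e s) {d₁ d₂ k : ℕ} {K : Type u}
    [Field K] {N m : ℕ} {a : Fin N → K} {v : ℕ → K} (hv : ∀ t, (op (d₁, d₂) t).Holds a v t)
    {h : ∀ j < m, F.output ((d₁, d₂), k) j < F.numGates ((d₁, d₂), k)} :
    (F.description op e).Describes (Nat.pair (Nat.pair d₁ d₂) k) a
      (F.circuit ((d₁, d₂), k) v ((d₁ + 1) + (d₂ + 1)) m h) := by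
  have hs : ofNat Index (Nat.pair (Nat.pair d₁ d₂) k) = ((d₁, d₂), k) := by
    simp
  refine ⟨by simp [description, circuit], by simp [description, circuit], v,
    fun t _ => by simpa [description, hs] using hv t, fun i hi => ?_⟩
  have hc := he ((d₁, d₂), k) i hi
  simp only [circuit]
  cases hl : F.label ((d₁, d₂), k) i with
  | const t =>
    refine ⟨t, ?_, by simp [description, hl, GateLabel.clip], rfl⟩
    rw [hl] at hc
    simp only [description, hs]
    exact Nat.lt_succ_of_le ((Nat.right_le_pair 0 t).trans hc)
  | input j =>
    simp only [GateLabel.toGate]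
    split_ifs with h'
    · simp [CircuitDescription.DescribesGate, description, hl, GateLabel.clip, Index.inputs, h']
    · simp [CircuitDescription.DescribesGate, description, hl, GateLabel.clip, Index.inputs, h']
  | add r =>
    simp [CircuitDescription.DescribesGate, GateLabel.toGate, description, hl, GateLabel.clip]
  | mul r =>
    simp [CircuitDescription.DescribesGate, GateLabel.toGate, description, hl, GateLabel.clip]

end Family

open Family

/-- Each summand is polynomial in the code of its index. As `k < pieces`, that code is at most the
code of the degrees paired with the number of pieces, and the code of the degrees is quadratic in
them. -/
theorem exists_sum_le {pieces : ℕ × ℕ → ℕ} (hp : LS pieces) {G : Index → ℕ} (hG : LS G) :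
    ∃ e, ∀ d₁ d₂, ∑ k ∈ Finset.range (pieces (d₁, d₂)), G ((d₁, d₂), k) ≤ (d₁ + d₂ + 2) ^ e := by
  obtain ⟨e, he⟩ := hG.exists_le
  have h : LS fun d => pieces d * (Nat.pair (encode d) (pieces d) + 2) ^ e :=
    hp.mul (.pow (.succ (.succ (.pair .encode' hp))) e)
  obtain ⟨e', he'⟩ := h.exists_le
  refine ⟨(1 + 2 + 2) * 2 * e', fun d₁ d₂ => ?_⟩
  calc ∑ k ∈ Finset.range (pieces (d₁, d₂)), G ((d₁, d₂), k)
      ≤ pieces (d₁, d₂) * (Nat.pair (encode (d₁, d₂)) (pieces (d₁, d₂)) + 2) ^ e := by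
        refine (Finset.sum_le_card_nsmul _ _ _ fun k hk => ?_).trans (by rw [Finset.card_range, smul_eq_mul])
        refine (he _).trans (Nat.pow_le_pow_left ?_ e)
        have := Nat.pair_lt_pair_right (encode (d₁, d₂)) (Finset.mem_range.1 hk)
        rw [Encodable.encode_prod_val, Encodable.encode_nat]
        exact Nat.add_le_add_right this.le 2
    _ ≤ (encode (d₁, d₂) + 2) ^ e' := he' (d₁, d₂)
    _ ≤ ((d₁ + d₂ + 2) ^ ((1 + 2 + 2) * 2)) ^ e' := by
        refine Nat.pow_le_pow_left ?_ e'
        rw [Encodable.encode_prod_val, Encodable.encode_nat, Encodable.encode_nat]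
        have h1 := pair_le_sq d₁ d₂ (d₁ + d₂) (by omega) (by omega)
        have h2 : 2 ^ 2 ≤ (d₁ + d₂ + 2) ^ 2 := Nat.pow_le_pow_left (by omega) 2
        have h3 : 2 ≤ (d₁ + d₂ + 2) ^ 8 := by
          calc 2 ≤ d₁ + d₂ + 2 := by omega
            _ ≤ (d₁ + d₂ + 2) ^ 8 := Nat.le_self_pow (by omega) _
        have h4 : (d₁ + d₂ + 2) ^ ((1 + 2 + 2) * 2) = (d₁ + d₂ + 2) ^ 2 * (d₁ + d₂ + 2) ^ 8 := by ring
        rw [h4]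
        nlinarith
    _ = (d₁ + d₂ + 2) ^ ((1 + 2 + 2) * 2 * e') := by rw [← pow_mul]

/-- The input variables, set to the coefficients of two polynomials. -/
def inputs {K : Type u} [Field K] (d₁ d₂ : ℕ) (f g : Polynomial K) (j : ℕ) : K :=
  if h : j < (d₁ + 1) + (d₂ + 1) then coeffVec d₁ d₂ f g ⟨j, h⟩ else 0

/-- Separates complexity from algebra: what remains to be shown is that the functions `P`, `Q`, `T`
have constant depth, and the statement `H` about their values. -/
theorem exists_description_of_constDepth {pieces : ℕ × ℕ → ℕ} (hp : LS pieces)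
    {op : ℕ × ℕ → ℕ → ConstOp} (hop : LS fun p : (ℕ × ℕ) × ℕ => (op p.1 p.2).code)
    {P Q : (Γ : Ctx.{u}) → Index → ℕ → Γ.K} {T : (Γ : Ctx.{u}) → Index → Γ.K}
    (hP : ConstDepthMulti (fun s => min s.1.1 s.1.2 + 1) P)
    (hQ : ConstDepthMulti (fun s => min s.1.1 s.1.2 + 1) Q) (hT : ConstDepth T) (c : ℕ)
    (H : ∀ (K : Type u) [Field K] (d₁ d₂ : ℕ) (a : Fin ((d₁ * d₂) ^ c) → K), Function.Injective a →
      ∃ v : ℕ → K, (∀ t, (op (d₁, d₂) t).Holds a v t) ∧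
        ∀ f g : Polynomial K, f.Monic → g.Monic → f.natDegree = d₁ → g.natDegree = d₂ →
          ∃ r, IsGreatest {k | k < pieces (d₁, d₂) ∧
              T ⟨K, v, inputs d₁ d₂ f g⟩ ((d₁, d₂), k) ≠ 0} r ∧
            ∀ j ≤ min d₁ d₂, Q ⟨K, v, inputs d₁ d₂ f g⟩ ((d₁, d₂), r) j ≠ 0 ∧
              (monicGcd f g).coeff j = P ⟨K, v, inputs d₁ d₂ f g⟩ ((d₁, d₂), r) j /
                Q ⟨K, v, inputs d₁ d₂ f g⟩ ((d₁, d₂), r) j) :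
    ∃ (c e Δ : ℕ) (pieces : ℕ → ℕ → ℕ) (P Q T : GcdCircuit.CircuitDescription),
      GcdCircuit.LogSpace₂ pieces ∧ P.Explicit ∧ Q.Explicit ∧ T.Explicit ∧
      ∀ (K : Type u) [Field K] (d₁ d₂ : ℕ), (((d₁ * d₂) ^ c : ℕ) : Cardinal) ≤ Cardinal.mk K →
        ∀ a : Fin ((d₁ * d₂) ^ c) → K, Function.Injective a →
          ∃ W : GcdCircuit.PiecewiseRationalCircuit K ((d₁ + 1) + (d₂ + 1)) (min d₁ d₂ + 1),
            W.pieces = pieces d₁ d₂ ∧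
            (∀ k < W.pieces,
              P.Describes (Nat.pair (Nat.pair d₁ d₂) k) a (W.num k) ∧
              Q.Describes (Nat.pair (Nat.pair d₁ d₂) k) a (W.den k) ∧
              T.Describes (Nat.pair (Nat.pair d₁ d₂) k) a (W.test k)) ∧
            W.size ≤ (d₁ + d₂ + 2) ^ e ∧
            W.depth ≤ Δ ∧
            ∀ f g : Polynomial K, f.Monic → g.Monic → f.natDegree = d₁ → g.natDegree = d₂ →
              W.ComputesAt (GcdCircuit.coeffVec d₁ d₂ f g)
                (fun j => (GcdCircuit.monicGcd f g).coeff j) := by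
  obtain ⟨FP, hP1, hP2⟩ := hP
  obtain ⟨FQ, hQ1, hQ2⟩ := hQ
  obtain ⟨FT, hT1, hT2⟩ := hT
  obtain ⟨eP, heP⟩ := FP.exists_code_le
  obtain ⟨eQ, heQ⟩ := FQ.exists_code_le
  obtain ⟨eT, heT⟩ := FT.exists_code_le
  have hsize (F : Family Index) (e : ℕ) :
      LS fun s => F.numGates s + F.numGates s * F.codeBound e s :=
    F.numGates_ls.add (F.numGates_ls.mul (F.codeBound_ls e))
  obtain ⟨e, he⟩ := exists_sum_le hp (((hsize FP eP).add (hsize FQ eQ)).add (hsize FT eT))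
  refine ⟨c, e, max FP.depth (max FQ.depth FT.depth), fun d₁ d₂ => pieces (d₁, d₂),
    FP.description op eP, FQ.description op eQ, FT.description op eT, by simpa [LS, LogSpace₂] using hp,
    FP.description_explicit hop _, FQ.description_explicit hop _, FT.description_explicit hop _, ?_⟩
  intro K _ d₁ d₂ _ a ha
  obtain ⟨v, hv, hfg⟩ := H K d₁ d₂ a ha
  refine ⟨⟨pieces (d₁, d₂), fun k => FP.circuit ((d₁, d₂), k) v _ _ fun j hj => hP1 _ j hj,
    fun k => FQ.circuit ((d₁, d₂), k) v _ _ fun j hj => hQ1 _ j hj,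
    fun k => FT.circuit ((d₁, d₂), k) v _ _ fun j hj => hT1 _ j hj⟩, rfl,
    fun k _ => ⟨FP.description_describes heP hv (h := fun j hj => hP1 _ j hj), FQ.description_describes heQ hv (h := fun j hj => hQ1 _ j hj),
      FT.description_describes heT hv (h := fun j hj => hT1 _ j hj)⟩, ?_, ?_, ?_⟩
  · refine le_trans (Finset.sum_le_sum fun k _ => ?_) (he d₁ d₂)
    exact add_le_add (add_le_add (FP.size_circuit_le (h := fun j hj => hP1 _ j hj) (heP _)) (FQ.size_circuit_le (h := fun j hj => hQ1 _ j hj) (heQ _)))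
      (FT.size_circuit_le (h := fun j hj => hT1 _ j hj) (heT _))
  · exact Finset.sup_le fun k _ => max_le_max (FP.depth_circuit_le (h := fun j hj => hP1 _ j hj))
      (max_le_max (FQ.depth_circuit_le (h := fun j hj => hQ1 _ j hj)) (FT.depth_circuit_le (h := fun j hj => hT1 _ j hj)))
  · intro f g hf hg hf' hg'
    obtain ⟨r, hr, hr'⟩ := hfg f g hf hg hf' hg'
    set Γ : Ctx.{u} := ⟨K, v, inputs d₁ d₂ f g⟩ with hΓ
    have hx : ∀ j, Γ.input j = if h : j < (d₁ + 1) + (d₂ + 1) then coeffVec d₁ d₂ f g ⟨j, h⟩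
        else 0 := fun j => rfl
    have hT' (k : ℕ) : (FT.circuit ((d₁, d₂), k) v ((d₁ + 1) + (d₂ + 1)) 1
        fun j hj => hT1 _ j hj).eval (coeffVec d₁ d₂ f g) 0 = T Γ ((d₁, d₂), k) := by
      obtain ⟨val, h1, h2⟩ := hT2 Γ ((d₁, d₂), k)
      exact (FT.value_circuit Γ hx h1 _).trans (h2 0 one_pos)
    have hP' (j : Fin (min d₁ d₂ + 1)) : (FP.circuit ((d₁, d₂), r) v ((d₁ + 1) + (d₂ + 1)) _
        fun j hj => hP1 _ j hj).eval (coeffVec d₁ d₂ f g) j = P Γ ((d₁, d₂), r) j := by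
      obtain ⟨val, h1, h2⟩ := hP2 Γ ((d₁, d₂), r)
      exact (FP.value_circuit Γ hx h1 _).trans (h2 j j.2)
    have hQ' (j : Fin (min d₁ d₂ + 1)) : (FQ.circuit ((d₁, d₂), r) v ((d₁ + 1) + (d₂ + 1)) _
        fun j hj => hQ1 _ j hj).eval (coeffVec d₁ d₂ f g) j = Q Γ ((d₁, d₂), r) j := by
      obtain ⟨val, h1, h2⟩ := hQ2 Γ ((d₁, d₂), r)
      exact (FQ.value_circuit Γ hx h1 _).trans (h2 j j.2)
    refine ⟨r, ?_, fun j => ?_⟩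
    · simp only [hT']
      exact hr
    · simp only [hP', hQ']
      exact hr' j (Nat.le_of_lt_succ j.2)

end

/-! ### Lagrange inversion over a commutative ring. -/

section

section LagrangeInversion

open PowerSeries

variable {R : Type u} [CommRing R]

/-- The power series `ψ - y ψ'`. -/
def eulerDiff (ψ : R⟦X⟧) : R⟦X⟧ := ψ - X * d⁄dX R ψ

theorem coeff_eulerDiff (ψ : R⟦X⟧) (n : ℕ) :
    coeff n (eulerDiff ψ) = (1 - n) * coeff n ψ := by
  cases n with
  | zero => simp [eulerDiff]
  | succ n =>
    rw [eulerDiff, map_sub, coeff_succ_X_mul, coeff_derivative]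
    push_cast; ring

theorem map_eulerDiff {S : Type*} [CommRing S] (φ : R →+* S) (ψ : R⟦X⟧) :
    PowerSeries.map φ (eulerDiff ψ) = eulerDiff (PowerSeries.map φ ψ) := by
  ext n; simp [coeff_eulerDiff]

/-- Multiplied by `n + 1`, the series is `(n + 1) ψ^(n+1) - X (ψ^(n+1))'`, whose coefficient at `n +
1` cancels. To divide by `n + 1` in any characteristic, this is done for the universal series over
`ℤ[x₀, x₁, …]` and then specialised. -/
theorem coeff_pow_mul_eulerDiff (ψ : R⟦X⟧) (n : ℕ) :
    coeff (n + 1) (ψ ^ n * eulerDiff ψ) = 0 := by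
  let Ψ : (MvPolynomial ℕ ℤ)⟦X⟧ := mk fun i => MvPolynomial.X i
  let φ : MvPolynomial ℕ ℤ →+* R := MvPolynomial.eval₂Hom (Int.castRingHom R) fun i => coeff i ψ
  have hΨ : PowerSeries.map φ Ψ = ψ := by ext i; simp [Ψ, φ]
  have key : coeff (n + 1) (Ψ ^ n * eulerDiff Ψ) = 0 := by
    have h : ((n + 1 : ℕ) : MvPolynomial ℕ ℤ) * coeff (n + 1) (Ψ ^ n * eulerDiff Ψ) = 0 := by
      have h1 : Ψ ^ n * eulerDiff Ψ = Ψ ^ (n + 1) - X * (Ψ ^ n * d⁄dX _ Ψ) := by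
        rw [eulerDiff]; ring
      have h2 := coeff_derivative (Ψ ^ (n + 1)) n
      rw [derivative_pow, Nat.add_sub_cancel, mul_assoc, ← map_natCast (C (R := MvPolynomial ℕ ℤ)),
        coeff_C_mul] at h2
      rw [h1, map_sub, coeff_succ_X_mul, mul_sub, h2]
      push_cast; ring
    exact (mul_eq_zero.1 h).resolve_left (Nat.cast_ne_zero.2 n.succ_ne_zero)
  rw [← hΨ, ← map_eulerDiff, ← map_pow, ← map_mul, coeff_map, key, map_zero]

/-- The weight in the Lagrange inversion formula. -/
def lagrangeWeight (ψ : R⟦X⟧) : ℕ → R⟦X⟧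
  | 0 => 1
  | k + 1 => ψ ^ k * eulerDiff ψ

/-- The power series with the coefficients of the Lagrange inversion formula. -/
def lagrangeSeries (ψ H : R⟦X⟧) : R⟦X⟧ := mk fun k => coeff k (H * lagrangeWeight ψ k)

theorem lagrangeSeries_add (ψ H G : R⟦X⟧) :
    lagrangeSeries ψ (H + G) = lagrangeSeries ψ H + lagrangeSeries ψ G := by
  ext k; simp [lagrangeSeries, add_mul]

theorem lagrangeSeries_C_mul (ψ H : R⟦X⟧) (c : R) :
    lagrangeSeries ψ (C c * H) = C c * lagrangeSeries ψ H := by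
  ext k; simp [lagrangeSeries, mul_assoc]

theorem lagrangeSeries_one (ψ : R⟦X⟧) : lagrangeSeries ψ 1 = 1 := by
  ext k
  cases k with
  | zero => simp [lagrangeSeries, lagrangeWeight]
  | succ k =>
    simp only [lagrangeSeries, coeff_mk, one_mul, lagrangeWeight, coeff_pow_mul_eulerDiff]
    simp [coeff_one]

/-- This is the functional equation `φ = z ψ(φ)` in disguise; it holds because consecutive weights
differ by the factor `ψ`. For the first coefficient one uses that `ψ` and `ψ - X ψ'` have the same
constant term. -/
theorem lagrangeSeries_X_mul (ψ H : R⟦X⟧) :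
    lagrangeSeries ψ (X * H) = X * lagrangeSeries ψ (ψ * H) := by
  ext k
  cases k with
  | zero => simp [lagrangeSeries, lagrangeWeight]
  | succ k =>
    rw [coeff_succ_X_mul]
    simp only [lagrangeSeries, coeff_mk, mul_assoc, coeff_succ_X_mul]
    cases k with
    | zero => simp [lagrangeWeight, eulerDiff, mul_comm]
    | succ k =>
      simp only [lagrangeWeight]
      congr 1; ring

/-- With `H = X H' + c`, the defect of multiplicativity at `H` is `X` times the defect at `ψ H'`.
Iterating, it is divisible by every power of `X`. -/
theorem lagrangeSeries_mul (ψ H G : R⟦X⟧) :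
    lagrangeSeries ψ (H * G) = lagrangeSeries ψ H * lagrangeSeries ψ G := by
  have key : ∀ k, ∀ H : R⟦X⟧, X ^ k ∣
      lagrangeSeries ψ (H * G) - lagrangeSeries ψ H * lagrangeSeries ψ G := by
    intro k
    induction k with
    | zero => simp
    | succ k ih =>
      intro H
      rw [eq_X_mul_shift_add_const H]
      set H' : R⟦X⟧ := mk fun p => coeff (p + 1) H
      have h1 : lagrangeSeries ψ ((X * H' + C (constantCoeff H)) * G) -
          lagrangeSeries ψ (X * H' + C (constantCoeff H)) * lagrangeSeries ψ G =
          X * (lagrangeSeries ψ (ψ * H' * G) - lagrangeSeries ψ (ψ * H') * lagrangeSeries ψ G) := by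
        have h2 : lagrangeSeries ψ (C (constantCoeff H)) = C (constantCoeff H) := by
          have := lagrangeSeries_C_mul ψ 1 (constantCoeff H)
          rwa [mul_one, lagrangeSeries_one, mul_one] at this
        rw [add_mul, lagrangeSeries_add, lagrangeSeries_add, lagrangeSeries_C_mul, mul_assoc X,
          lagrangeSeries_X_mul, lagrangeSeries_X_mul, h2, mul_assoc ψ]
        ring
      rw [h1, pow_succ']
      exact mul_dvd_mul_left X (ih _)
  refine sub_eq_zero.1 (PowerSeries.ext fun k => ?_)
  exact X_pow_dvd_iff.1 (key (k + 1) H) k (Nat.lt_succ_self k)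

theorem lagrangeSeries_zero (ψ : R⟦X⟧) : lagrangeSeries ψ 0 = 0 := by
  ext; simp [lagrangeSeries]

/-- Lagrange inversion, as a ring homomorphism: substitution of the solution `φ` of
`φ = z ψ(φ)`. -/
def lagrangeHom (ψ : R⟦X⟧) : R⟦X⟧ →+* R⟦X⟧ where
  toFun := lagrangeSeries ψ
  map_one' := lagrangeSeries_one ψ
  map_zero' := lagrangeSeries_zero ψ
  map_add' := lagrangeSeries_add ψ
  map_mul' := lagrangeSeries_mul ψ

theorem coeff_lagrangeHom (ψ H : R⟦X⟧) (k : ℕ) :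
    coeff k (lagrangeHom ψ H) = coeff k (H * lagrangeWeight ψ k) := by
  simp [lagrangeHom, lagrangeSeries]

theorem lagrangeHom_C (ψ : R⟦X⟧) (c : R) : lagrangeHom ψ (C c) = C c := by
  have := lagrangeSeries_C_mul ψ 1 c
  rwa [mul_one, lagrangeSeries_one, mul_one] at this

theorem lagrangeHom_X_mul (ψ H : R⟦X⟧) : lagrangeHom ψ (X * H) = X * lagrangeHom ψ (ψ * H) :=
  lagrangeSeries_X_mul ψ H

theorem constantCoeff_lagrangeHom_X (ψ : R⟦X⟧) : constantCoeff (lagrangeHom ψ X) = 0 := by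
  rw [← coeff_zero_eq_constantCoeff_apply, coeff_lagrangeHom]
  simp [lagrangeWeight]

end LagrangeInversion

/-! ### Power series roots of the deformed polynomial. -/

section Roots

open Polynomial

variable {K : Type u} [Field K]

/-- A ring homomorphism that fixes constants commutes with the evaluation of polynomials. -/
theorem eval_lagrangeHom (ψ : PowerSeries K) (a : K) (H : K[X]) :
    (H.map (PowerSeries.C (R := K))).eval (PowerSeries.C a + lagrangeHom ψ PowerSeries.X) =
      lagrangeHom ψ (taylor a H : K[X]) := by
  rw [eval_map]
  induction H using Polynomial.induction_on' with
  | add p q hp hq => rw [eval₂_add, hp, hq, map_add, Polynomial.coe_add, map_add]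
  | monomial n c =>
    rw [eval₂_monomial, ← C_mul_X_pow_eq_monomial, taylor_mul, taylor_pow, taylor_X, taylor_C,
      Polynomial.coe_mul, Polynomial.coe_pow, Polynomial.coe_add, Polynomial.coe_X,
      Polynomial.coe_C, Polynomial.coe_C, map_mul, map_pow, map_add, lagrangeHom_C, lagrangeHom_C,
      add_comm (PowerSeries.C a)]

/-- The polynomial `∏ (y - a i)`, `i < n`. -/
def nodal (a : ℕ → K) (n : ℕ) : K[X] := ∏ i ∈ Finset.range n, (X - C (a i))

/-- The cofactor `∏ (y + a i - a j)`, `j < n`, `j ≠ i`, of `y` in `nodal a n (y + a i)`. -/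
def nodalCofactor (a : ℕ → K) (n i : ℕ) : K[X] :=
  ∏ j ∈ Finset.range n, if j = i then 1 else X + C (a i - a j)

theorem taylor_nodal (a : ℕ → K) {n i : ℕ} (hi : i < n) :
    taylor (a i) (nodal a n) = X * nodalCofactor a n i := by
  have h := Finset.mem_range.2 hi
  rw [nodal, nodalCofactor, ← Finset.mul_prod_erase _ _ h, ← Finset.mul_prod_erase _ _ h, if_pos rfl,
    one_mul, taylor_mul, map_sub, taylor_X, taylor_C, add_sub_cancel_right, ← taylorAlgHom_apply,
    map_prod]
  congr 1
  refine Finset.prod_congr rfl fun j hj => ?_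
  rw [if_neg (Finset.ne_of_mem_erase hj), taylorAlgHom_apply, map_sub, taylor_X, taylor_C, C_sub]
  ring

theorem nodalCofactor_eval_zero_ne_zero {a : ℕ → K} {n i : ℕ} (hi : i < n)
    (ha : Set.InjOn a (Set.Iio n)) : (nodalCofactor a n i).eval 0 ≠ 0 := by
  rw [nodalCofactor, eval_prod, Finset.prod_ne_zero_iff]
  intro j hj
  split_ifs with h
  · simp
  · simp only [eval_add, eval_X, eval_C, zero_add]
    exact sub_ne_zero.2 fun h' => h (ha hi (Finset.mem_range.1 hj) h').symm

theorem nodal_monic (a : ℕ → K) (n : ℕ) : (nodal a n).Monic :=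
  monic_prod_of_monic _ _ fun _ _ => monic_X_sub_C _

theorem nodal_natDegree (a : ℕ → K) (n : ℕ) : (nodal a n).natDegree = n := by
  rw [nodal, natDegree_prod_of_monic _ _ fun _ _ => monic_X_sub_C _]
  simp

/-- The power series `-u(y + a i) / ∏ (y + a i - a j)`. -/
def rootSeries (a : ℕ → K) (n : ℕ) (u : K[X]) (i : ℕ) : PowerSeries K :=
  -(taylor (a i) u : K[X]) * (nodalCofactor a n i : PowerSeries K)⁻¹

/-- The root of `∏ (y - a i) + z u(y)` with constant coefficient `a i`. -/
def rootAt (a : ℕ → K) (n : ℕ) (u : K[X]) (i : ℕ) : PowerSeries K :=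
  PowerSeries.C (a i) + lagrangeHom (rootSeries a n u i) PowerSeries.X

/-- The deformation `∏ (y - a i) + z u(y)`. -/
def deformation (a : ℕ → K) (n : ℕ) (u : K[X]) : K[X][X] :=
  (nodal a n).map C + C X * u.map C

variable {a : ℕ → K} {n : ℕ} {u : K[X]}

theorem map_map_coe (H : K[X]) :
    (H.map C).map (coeToPowerSeries.ringHom (R := K)) = H.map (PowerSeries.C (R := K)) := by
  rw [Polynomial.map_map]
  congr 1
  ext x : 1
  simp

/-- After the shift by `a i` the node polynomial is `y c(y)`. The homomorphism sends it to `z` times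
the image of `ψ c`, and `ψ` is chosen such that `ψ c = -u(y + a i)`, which cancels the term `z u`.
-/
theorem eval_deformation_rootAt (ha : Set.InjOn a (Set.Iio n)) {i : ℕ} (hi : i < n) :
    ((deformation a n u).map (coeToPowerSeries.ringHom (R := K))).eval (rootAt a n u i) = 0 := by
  have hc : PowerSeries.constantCoeff (nodalCofactor a n i : PowerSeries K) ≠ 0 := by
    rw [Polynomial.constantCoeff_coe, coeff_zero_eq_eval_zero]
    exact nodalCofactor_eval_zero_ne_zero hi ha
  rw [deformation, Polynomial.map_add, Polynomial.map_mul, map_map_coe, map_map_coe, map_C, eval_add,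
    eval_mul, eval_C, rootAt, eval_lagrangeHom, eval_lagrangeHom, taylor_nodal a hi,
    Polynomial.coe_mul, Polynomial.coe_X, lagrangeHom_X_mul, rootSeries, neg_mul, neg_mul, mul_assoc,
    PowerSeries.inv_mul_cancel _ hc, mul_one, map_neg]
  simp

theorem constantCoeff_rootAt (i : ℕ) : PowerSeries.constantCoeff (rootAt a n u i) = a i := by
  rw [rootAt, map_add, constantCoeff_lagrangeHom_X]; simp

/-- Both sides are monic of degree `n` and vanish at the `n` roots, which are distinct because their
constant terms are. -/
theorem deformation_eq_prod (ha : Set.InjOn a (Set.Iio n)) (hu : u.degree < n) :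
    (deformation a n u).map (coeToPowerSeries.ringHom (R := K)) =
      ∏ i ∈ Finset.range n, (X - C (rootAt a n u i)) := by
  refine eq_of_degree_sub_lt_of_eval_index_eq (s := Finset.range n) (v := rootAt a n u) ?_ ?_ ?_
  · intro i hi j hj hij
    refine ha (by simpa using hi) (by simpa using hj) ?_
    rw [← constantCoeff_rootAt (a := a) (n := n) (u := u) i, hij, constantCoeff_rootAt]
  · rw [Finset.card_range]
    have h1 : ((nodal a n).map (PowerSeries.C (R := K))).degree = n := by
      rw [degree_map, degree_eq_natDegree (nodal_monic a n).ne_zero, nodal_natDegree]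
    have hm : (∏ i ∈ Finset.range n, (X - C (rootAt a n u i))).Monic :=
      monic_prod_of_monic _ _ fun _ _ => monic_X_sub_C _
    have h2 : (∏ i ∈ Finset.range n, (X - C (rootAt a n u i))).degree = (n : WithBot ℕ) := by
      rw [degree_eq_natDegree hm.ne_zero, natDegree_prod_of_monic _ _ fun _ _ => monic_X_sub_C _]
      simp
    rw [deformation, Polynomial.map_add, Polynomial.map_mul, map_map_coe, map_map_coe, map_C,
      add_sub_right_comm]
    refine (degree_add_le _ _).trans_lt (max_lt ?_ ?_)
    · have := degree_sub_lt_left (h1.trans h2.symm) ((nodal_monic a n).map _).ne_zero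
        (by rw [((nodal_monic a n).map _).leadingCoeff, hm.leadingCoeff])
      rwa [h1] at this
    · refine ((degree_mul_le _ _).trans (add_le_add_left degree_C_le _)).trans_lt ?_
      rwa [zero_add, degree_map]
  · intro i hi
    rw [eval_deformation_rootAt ha (Finset.mem_range.1 hi), eval_prod]
    exact (Finset.prod_eq_zero hi (by simp)).symm

end Roots

end

/-! ### Resultants: dependence on a parameter, root products and the pencil identity. -/

section

open Polynomial

section ResultantDegree

variable {R : Type u} [CommRing R]

theorem sylvester_add_X_mul (f₀ f₁ g₀ g₁ : R[X]) (m n : ℕ) :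
    sylvester (f₀.map C + C X * f₁.map C) (g₀.map C + C X * g₁.map C) m n =
      (X : R[X]) • (sylvester f₁ g₁ m n).map C + (sylvester f₀ g₀ m n).map C := by
  ext i j : 2
  induction j using Fin.addCases <;>
  · simp only [sylvester, Matrix.of_apply, Matrix.add_apply, Matrix.smul_apply, Matrix.map_apply,
      Fin.addCases_left, Fin.addCases_right, coeff_add, coeff_C_mul, coeff_map, smul_eq_mul]
    split_ifs <;> simp [add_comm]

/-- The Sylvester matrix of a pencil is itself a pencil of matrices of size `m + n`. The bound
serves twice: for the parameter `z` of the deformation and for `t`. -/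
theorem natDegree_resultant_add_X_mul_le (f₀ f₁ g₀ g₁ : R[X]) (m n : ℕ) :
    (resultant (f₀.map C + C X * f₁.map C) (g₀.map C + C X * g₁.map C) m n).natDegree ≤ m + n := by
  rw [resultant, sylvester_add_X_mul]
  simpa using natDegree_det_X_add_C_le (sylvester f₁ g₁ m n) (sylvester f₀ g₀ m n)

theorem eval_resultant_add_X_mul (f₀ f₁ g₀ g₁ : R[X]) (m n : ℕ) (t : R) :
    (resultant (f₀.map C + C X * f₁.map C) (g₀.map C + C X * g₁.map C) m n).eval t =
      resultant (f₀ + C t * f₁) (g₀ + C t * g₁) m n := by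
  have h : (evalRingHom t).comp C = RingHom.id R := by ext; simp
  have h' (p q : R[X]) : (p.map C + C X * q.map C).map (evalRingHom t) = p + C t * q := by
    simp [Polynomial.map_map, h]
  rw [← coe_evalRingHom, ← resultant_map_map, h', h']

end ResultantDegree

section Roots

variable {K : Type u} [Field K] {a : ℕ → K} {n : ℕ} {u : K[X]}

/-- The deformed resultant is a polynomial in `z`, so evaluation at `z = 1` is legitimate and adds
up its coefficients, although the roots are only power series. -/
theorem resultant_eq_sum_coeff (ha : Set.InjOn a (Set.Iio n)) (hu : u.degree < n) {G : K[X]} {m : ℕ}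
    (hG : G.natDegree ≤ m) : resultant (nodal a n + u) G n m =
      ∑ l ∈ Finset.range (n + m + 1), PowerSeries.coeff l
        (∏ i ∈ Finset.range n, lagrangeHom (rootSeries a n u i) (taylor (a i) G : K[X])) := by
  set P : K[X] := resultant (deformation a n u) (G.map C) n m with hP
  have hGC : G.map C = G.map (C : K →+* K[X]) + C X * (0 : K[X]).map C := by simp
  have h1 : P.natDegree < n + m + 1 := by
    rw [hP, hGC]
    exact Nat.lt_succ_of_le (natDegree_resultant_add_X_mul_le _ _ _ _ _ _)
  have h2 : P.eval 1 = resultant (nodal a n + u) G n m := by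
    rw [hP, hGC, deformation, eval_resultant_add_X_mul, C_1, one_mul, one_mul, add_zero]
  have h3 : (P : PowerSeries K) =
      ∏ i ∈ Finset.range n, lagrangeHom (rootSeries a n u i) (taylor (a i) G : K[X]) := by
    rw [← coeToPowerSeries.ringHom_apply, hP, ← resultant_map_map, map_map_coe,
      deformation_eq_prod ha hu]
    have hd : (∏ i ∈ Finset.range n, (X - C (rootAt a n u i))).natDegree = n := by
      rw [natDegree_prod_of_monic _ _ fun _ _ => monic_X_sub_C _]
      simp
    have hG' : (G.map (PowerSeries.C (R := K))).natDegree ≤ m := natDegree_map_le.trans hG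
    have := resultant_prod_left (Finset.range n) (fun i => X - C (rootAt a n u i))
      (G.map (PowerSeries.C (R := K))) m (by simp) hG'
    rw [hd] at this
    rw [this]
    refine Finset.prod_congr rfl fun i _ => ?_
    rw [natDegree_X_sub_C, resultant_X_sub_C_left _ _ _ hG', rootAt, eval_lagrangeHom]
  rw [← h2, eval_eq_sum_range' h1, ← h3]
  simp

end Roots

section MonicResultant

variable {R : Type u} [CommRing R]

/-- Padding the formal degree of `P` multiplies the resultant by powers of the leading coefficient
of `F`, here `1`. -/
theorem resultant_eq_of_monic {F P : R[X]} (hF : F.Monic) {k : ℕ} (hk : P.natDegree ≤ k) :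
    resultant F P F.natDegree k = resultant F P := by
  obtain ⟨j, rfl⟩ := Nat.exists_eq_add_of_le hk
  rw [resultant_add_right_deg _ _ _ _ _ le_rfl, hF.coeff_natDegree, one_pow, one_mul]

theorem resultant_mul_of_monic {F : R[X]} (hF : F.Monic) (P Q : R[X]) :
    resultant F (P * Q) = resultant F P * resultant F Q := by
  rw [← resultant_mul_right _ _ _ _ le_rfl, resultant_eq_of_monic hF natDegree_mul_le]

theorem resultant_add_mul_of_monic {F : R[X]} (hF : F.Monic) (P Q : R[X]) :
    resultant F (P + F * Q) = resultant F P := by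
  set k := max (P + F * Q).natDegree (max P.natDegree (Q.natDegree + F.natDegree))
  rw [← resultant_eq_of_monic hF (le_max_left _ _ : _ ≤ k), resultant_add_mul_right _ _ _ _ _
    ((le_max_right _ _).trans (le_max_right _ _)) le_rfl,
    resultant_eq_of_monic hF ((le_max_left _ _).trans (le_max_right _ _))]

theorem resultant_C_mul_of_monic {F : R[X]} (hF : F.Monic) (c : R) (P : R[X]) :
    resultant F (C c * P) = c ^ F.natDegree * resultant F P := by
  rw [← resultant_C_mul_right, resultant_eq_of_monic hF (natDegree_C_mul_le _ _)]

theorem resultant_C_sub_X {F : R[X]} (hF : F.Monic) (x : R) :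
    resultant F (C x - X) = F.eval x := by
  have h : (C x - X : R[X]) = C (-1) * (X - C x) := by simp
  have h1 : resultant F (X - C x) = (-1) ^ F.natDegree * F.eval x := by
    rw [← resultant_eq_of_monic hF (natDegree_X_sub_C_le x), resultant_X_sub_C_right _ _ _ le_rfl]
  rw [h, resultant_C_mul_of_monic hF, h1, ← mul_assoc, ← mul_pow]
  simp

theorem natDegree_C_sub_X_le (x : R) : (C x - X : R[X]).natDegree ≤ 1 := by
  rw [← natDegree_neg, neg_sub]
  exact natDegree_X_sub_C_le x

/-- The resultant of the pencil spanned by `(d f', d g')` and `(C x - X) (-1, s)`. -/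
theorem resultant_pencil [IsDomain R] {d f' g' : R[X]} (hd : d.Monic) (hf : f'.Monic)
    {t x : R} (s : R) (ht : t ≠ 0) (hx : f'.eval x ≠ 0) (h2 : 2 ≤ (d * f').natDegree) :
    resultant (d * f' - C t * (C x - X)) (d * g' + C (s * t) * (C x - X)) =
      (-1) ^ ((d * f').natDegree * f'.natDegree + f'.natDegree) * t ^ d.natDegree * d.eval x *
        resultant (d * f' - C t * (C x - X)) (g' + C s * f') := by
  nontriviality R
  set ℓ : R[X] := C x - X with hℓ
  set F := d * f' - C t * ℓ with hF
  -- Degree at least two is needed for the linear perturbation to leave `F` monic of the same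
  -- degree.
  have hdeg : (C t * ℓ).natDegree < (d * f').natDegree :=
    ((natDegree_C_mul_le _ _).trans (natDegree_C_sub_X_le x)).trans_lt h2
  have hFm : F.Monic := (hd.mul hf).sub_of_left (by
    exact degree_lt_degree hdeg)
  have hFn : F.natDegree = (d * f').natDegree := natDegree_sub_eq_left_of_natDegree_lt hdeg
  have hn : (d * f').natDegree = d.natDegree + f'.natDegree := hd.natDegree_mul hf
  have hFx : F.eval x = d.eval x * f'.eval x := by simp [hF, hℓ]
  -- Modulo `f'`, the polynomial `F` is `-tℓ`, whose resultant is an evaluation at `x`.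
  have h1 : resultant F f' =
      (-1) ^ ((d * f').natDegree * f'.natDegree + f'.natDegree) * t ^ f'.natDegree * f'.eval x := by
    have h : F = C (-t) * ℓ + f' * d := by rw [hF, C_neg]; ring
    have e : resultant f' F = (-t) ^ f'.natDegree * f'.eval x := by
      rw [h, resultant_add_mul_of_monic hf, resultant_C_mul_of_monic hf, resultant_C_sub_X hf]
    rw [resultant_comm, e, hFn, neg_pow]
    ring
  -- Multiplied by `f'`, the second member of the pencil becomes `tℓ (g' + s f')` modulo `F`; the
  -- factor `ℓ` contributes `F(x) = d(x) f'(x)`.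
  have h3 : resultant F f' * resultant F (d * g' + C (s * t) * ℓ) =
      t ^ (d * f').natDegree * (d.eval x * f'.eval x) * resultant F (g' + C s * f') := by
    have h4 : f' * (d * g' + C (s * t) * ℓ) = C t * (ℓ * (g' + C s * f')) + F * g' := by
      rw [hF, C_mul]; ring
    rw [← resultant_mul_of_monic hFm, h4, resultant_add_mul_of_monic hFm,
      resultant_C_mul_of_monic hFm, resultant_mul_of_monic hFm, resultant_C_sub_X hFm, hFx, hFn]
    ring
  have hsq : ((-1 : R) ^ ((d * f').natDegree * f'.natDegree + f'.natDegree)) ^ 2 = 1 := by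
    rw [← pow_mul, mul_comm, pow_mul]; simp
  set ε := (-1 : R) ^ ((d * f').natDegree * f'.natDegree + f'.natDegree)
  rw [h1, hn, pow_add] at h3
  have hne : t ^ f'.natDegree * f'.eval x ≠ 0 := mul_ne_zero (pow_ne_zero _ ht) hx
  refine mul_left_cancel₀ hne ?_
  linear_combination ε * h3 - (t ^ f'.natDegree * f'.eval x *
    resultant F (d * g' + C (s * t) * ℓ)) * hsq

end MonicResultant

end

/-! ### The lowest coefficient of the pencil resultant, and the choice of the shift. -/

section

open Polynomial

section Pencil

variable {K : Type u} [Field K]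

/-- The resultant of `f - t (x - y)` and `g + s t (x - y)` as a polynomial in `t`. -/
def pencilResultant (f g : K[X]) (n m : ℕ) (s x : K) : K[X] :=
  resultant (f.map C + C X * (X - C x).map C) (g.map C + C X * (C s * (C x - X)).map C) n m

/-- `resultant_pencil` cancels `t` and `f'(x)`, and the latter may vanish at a given `x`. So it is
applied over `K[x][t]` with both variables generic, and `x` is specialised afterwards. At `t = 0`
the cofactor `S` no longer depends on `x`. -/
theorem exists_pencilResultant_eq {d f' g' : K[X]} (hd : d.Monic) (hf : f'.Monic) {n m : ℕ}
    (hn : (d * f').natDegree = n) (hm : (d * g').natDegree ≤ m) (h2 : 2 ≤ n) (h1 : 1 ≤ m)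
    (s x : K) : ∃ S : K[X], S.coeff 0 = resultant (d * f') (g' + C s * f') ∧
      pencilResultant (d * f') (d * g') n m s x =
        C ((-1) ^ (n * f'.natDegree + f'.natDegree) * d.eval x) * (X ^ d.natDegree * S) := by
  let ι : K →+* K[X][X] := C.comp C
  let φ : K[X][X] →+* K[X] := mapRingHom (evalRingHom x)
  have hι : Function.Injective ι := ι.injective
  have hφι : φ.comp ι = C := by ext; simp [φ, ι]
  have h0 : ((evalRingHom (0 : K)).comp φ).comp ι = RingHom.id K := by ext; simp [φ, ι]
  have hev (p : K[X]) : (p.map ι).eval (C X) = C p := by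
    rw [eval_map, show ι = C.comp C from rfl, ← hom_eval₂, eval₂_C_X]
  have hfd : (d * f').map ι = d.map ι * f'.map ι := Polynomial.map_mul ι
  have hgd : (d * g').map ι = d.map ι * g'.map ι := Polynomial.map_mul ι
  have hdeg (p : K[X]) : (p.map ι).natDegree = p.natDegree := natDegree_map_eq_of_injective hι p
  have key := resultant_pencil (d := d.map ι) (f' := f'.map ι) (g' := g'.map ι) (hd.map ι) (hf.map ι)
    (t := X) (x := C X) (ι s) X_ne_zero (by rw [hev, Ne, C_eq_zero]; exact hf.ne_zero)
    (by rw [← hfd, hdeg, hn]; exact h2)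
  set F : K[X][X][X] := d.map ι * f'.map ι - C X * (C (C X) - X) with hF
  set H : K[X][X][X] := g'.map ι + C (ι s) * f'.map ι with hH
  set G : K[X][X][X] := d.map ι * g'.map ι + C (ι s * X) * (C (C X) - X) with hG
  have hlt : (C X * (C (C X) - X) : K[X][X][X]).natDegree < (d.map ι * f'.map ι).natDegree := by
    rw [← hfd, hdeg, hn]
    exact ((natDegree_C_mul_le _ _).trans (natDegree_C_sub_X_le _)).trans_lt h2
  have hFm : F.Monic := ((hd.map ι).mul (hf.map ι)).sub_of_left (degree_lt_degree hlt)
  have hFn : F.natDegree = n := by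
    rw [hF, natDegree_sub_eq_left_of_natDegree_lt hlt, ← hfd, hdeg, hn]
  have hGm : G.natDegree ≤ m := by
    refine natDegree_add_le_of_degree_le ?_ ?_
    · rwa [← hgd, hdeg]
    · exact (natDegree_C_mul_le _ _).trans ((natDegree_C_sub_X_le _).trans h1)
  have hFφ : F.map φ = (d * f').map C + C X * (X - C x).map C := by
    rw [hF, ← hfd]
    simp only [Polynomial.map_sub, Polynomial.map_mul, Polynomial.map_map, hφι, map_C, map_X]
    simp only [φ, coe_mapRingHom, map_X, map_C, coe_evalRingHom, eval_X]
    ring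
  have hGφ : G.map φ = (d * g').map C + C X * (C s * (C x - X)).map C := by
    have : φ (ι s) = C s := by rw [← RingHom.comp_apply, hφι]
    rw [hG, ← hgd]
    simp only [Polynomial.map_add, Polynomial.map_sub, Polynomial.map_mul, Polynomial.map_map, hφι,
      map_C, map_X, map_mul, this]
    simp only [φ, coe_mapRingHom, map_X, map_C, coe_evalRingHom, eval_X]
    ring
  have hF0 : F.map ((evalRingHom (0 : K)).comp φ) = d * f' := by
    rw [← Polynomial.map_map, hFφ]
    have : (evalRingHom (0 : K)).comp C = RingHom.id K := by ext; simp
    simp [Polynomial.map_map, this]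
  have hH0 : H = (g' + C s * f').map ι := by simp [hH]
  refine ⟨φ (resultant F H), ?_, ?_⟩
  · rw [coeff_zero_eq_eval_zero, ← coe_evalRingHom, ← RingHom.comp_apply, ← resultant_map_map, hF0,
      hFn, hH0, hdeg, Polynomial.map_map, h0, Polynomial.map_id, hn]
  · rw [pencilResultant, ← hFφ, ← hGφ, resultant_map_map]
    have h3 : resultant F G n m = resultant F G := by
      rw [← hFn]; exact resultant_eq_of_monic hFm hGm
    rw [h3, hG, key, ← hfd, hdeg, hn, hdeg, hdeg, hev]
    simp only [map_mul, map_pow, map_neg, map_one]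
    simp only [φ, coe_mapRingHom, map_X, map_C, coe_evalRingHom]
    ring

/-- Each bad `s` yields an irreducible common factor `p s` of `d` and `g' + a s f'`. A factor shared
by two values of `s` would divide `f'` and then `g'`, so the `p s` are pairwise coprime and their
product divides `d`; hence at most `deg d` values are bad. -/
theorem exists_isCoprime_add {d f' g' : K[X]} (hd : d ≠ 0) (h : IsCoprime f' g') {a : ℕ → K} {N : ℕ}
    (ha : Set.InjOn a (Set.Iio N)) (hN : d.natDegree < N) :
    ∃ s < N, IsCoprime (d * f') (g' + C (a s) * f') := by
  classical
  by_contra! hc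
  have hex : ∀ s < N, ∃ p : K[X], Irreducible p ∧ p ∣ d ∧ p ∣ g' + C (a s) * f' := by
    intro s hs
    have h1 : ¬ IsCoprime d (g' + C (a s) * f') := fun h1 =>
      hc s hs (h1.mul_left (h.add_mul_right_right (C (a s))))
    have h2 : EuclideanDomain.gcd d (g' + C (a s) * f') ≠ 0 := fun h0 =>
      hd (EuclideanDomain.gcd_eq_zero_iff.1 h0).1
    obtain ⟨p, hp, hpd⟩ := WfDvdMonoid.exists_irreducible_factor
      (fun hu => h1 (EuclideanDomain.gcd_isUnit_iff.1 hu)) h2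
    exact ⟨p, hp, hpd.trans (EuclideanDomain.gcd_dvd_left _ _),
      hpd.trans (EuclideanDomain.gcd_dvd_right _ _)⟩
  choose! p hp hpd hpg using hex
  have hdvd : ∏ s ∈ Finset.range N, p s ∣ d := by
    refine Finset.prod_dvd_of_coprime ?_ fun s hs => hpd s (Finset.mem_range.1 hs)
    intro s hs t ht hst
    have hs' := Finset.mem_range.1 hs
    have ht' := Finset.mem_range.1 ht
    refine ((hp s hs').isCoprime_or_dvd (p t)).resolve_right fun hdvd => ?_
    have h1 : p s ∣ C (a s - a t) * f' := by
      have := dvd_sub (hpg s hs') (hdvd.trans (hpg t ht'))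
      rwa [add_sub_add_left_eq_sub, ← sub_mul, ← C_sub] at this
    have h2 : p s ∣ f' := by
      rwa [IsUnit.dvd_mul_left] at h1
      exact isUnit_C.2 (sub_ne_zero.2 fun h' => hst (ha hs' ht' h')).isUnit
    have h3 : p s ∣ g' := (dvd_add_left (h2.mul_left _)).1 (hpg s hs')
    exact (hp s hs').not_isUnit (h.isUnit_of_dvd' h2 h3)
  have h1 := natDegree_le_of_dvd hdvd hd
  rw [natDegree_prod _ _ fun s hs => (hp s (Finset.mem_range.1 hs)).ne_zero] at h1
  have h2 : ∑ s ∈ Finset.range N, 1 ≤ ∑ s ∈ Finset.range N, (p s).natDegree :=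
    Finset.sum_le_sum fun s hs => (hp s (Finset.mem_range.1 hs)).natDegree_pos
  simp at h2
  omega

end Pencil

section Gcd

variable {K : Type u} [Field K]

theorem exists_monicGcd_factorization {f g : K[X]} (hf : f.Monic) :
    ∃ f' g' : K[X], f = monicGcd f g * f' ∧ g = monicGcd f g * g' ∧ (monicGcd f g).Monic ∧ f'.Monic ∧
      IsCoprime f' g' := by
  classical
  have h0 : EuclideanDomain.gcd f g ≠ 0 := fun h => hf.ne_zero (EuclideanDomain.gcd_eq_zero_iff.1 h).1
  have hdm : (monicGcd f g).Monic := by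
    rw [monicGcd]; convert monic_normalize h0
  have hda : Associated (EuclideanDomain.gcd f g) (monicGcd f g) := by
    rw [monicGcd]; convert (associated_normalize (EuclideanDomain.gcd f g))
  have hdvdf : monicGcd f g ∣ f := hda.symm.dvd.trans (EuclideanDomain.gcd_dvd_left f g)
  have hdvdg : monicGcd f g ∣ g := hda.symm.dvd.trans (EuclideanDomain.gcd_dvd_right f g)
  obtain ⟨f', hf'⟩ := hdvdf
  obtain ⟨g', hg'⟩ := hdvdg
  refine ⟨f', g', hf', hg', hdm, ?_, ?_⟩
  · rw [hf'] at hf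
    exact hdm.of_mul_monic_left hf
  · obtain ⟨c, hc⟩ := hda.dvd
    obtain ⟨e, he⟩ := hda.symm.dvd
    have hb := EuclideanDomain.gcd_eq_gcd_ab f g
    refine ⟨EuclideanDomain.gcdA f g * c, EuclideanDomain.gcdB f g * c, ?_⟩
    refine mul_left_cancel₀ hdm.ne_zero ?_
    calc monicGcd f g * (EuclideanDomain.gcdA f g * c * f' + EuclideanDomain.gcdB f g * c * g')
        = ((monicGcd f g * f') * EuclideanDomain.gcdA f g +
          (monicGcd f g * g') * EuclideanDomain.gcdB f g) * c := by ring
      _ = monicGcd f g * 1 := by rw [← hf', ← hg', ← hb, ← hc, mul_one]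

end Gcd

end

/-! ### Evaluating the pencil resultant by interpolation. -/

section

open Polynomial

theorem lagrangeWeight_sub_dvd {R : Type u} [CommRing R] {ψ φ : PowerSeries R} {N : ℕ}
    (h : PowerSeries.X ^ N ∣ ψ - φ) (k : ℕ) :
    PowerSeries.X ^ N ∣ lagrangeWeight ψ k - lagrangeWeight φ k := by
  cases k with
  | zero => simp [lagrangeWeight]
  | succ k =>
    have h1 : PowerSeries.X ^ N ∣ ψ ^ k - φ ^ k := h.trans (sub_dvd_pow_sub_pow _ _ _)
    have h2 : PowerSeries.X ^ N ∣ eulerDiff ψ - eulerDiff φ := by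
      rw [PowerSeries.X_pow_dvd_iff] at h ⊢
      intro l hl
      rw [map_sub, coeff_eulerDiff, coeff_eulerDiff, ← mul_sub, ← map_sub, h l hl, mul_zero]
    have h3 : lagrangeWeight ψ (k + 1) - lagrangeWeight φ (k + 1) =
        (ψ ^ k - φ ^ k) * eulerDiff ψ + φ ^ k * (eulerDiff ψ - eulerDiff φ) := by
      simp only [lagrangeWeight]; ring
    rw [h3]
    exact dvd_add (h1.mul_right _) (h2.mul_left _)

/-- Low coefficients need `ψ` only modulo `X^N`, which allows the root series to be replaced by a
polynomial that circuits can evaluate. -/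
theorem coeff_lagrangeHom_congr {R : Type u} [CommRing R] {ψ φ : PowerSeries R} {N : ℕ}
    (h : PowerSeries.X ^ N ∣ ψ - φ) (H : PowerSeries R) {k : ℕ} (hk : k < N) :
    PowerSeries.coeff k (lagrangeHom ψ H) = PowerSeries.coeff k (H * lagrangeWeight φ k) := by
  rw [coeff_lagrangeHom, ← sub_eq_zero, ← map_sub, ← mul_sub]
  exact PowerSeries.X_pow_dvd_iff.1 ((lagrangeWeight_sub_dvd h k).mul_left H) k hk

/-- The data that the circuits work with: interpolation nodes `node i`, a table of coefficients of
Lagrange basis polynomials, the constant `-1`, and the coefficients of two polynomials of degrees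
`n` and `m`. -/
structure CoeffData (K : Type u) where
  n : ℕ
  m : ℕ
  node : ℕ → K
  table : ℕ → ℕ → ℕ → K
  negOne : K
  f : ℕ → K
  g : ℕ → K

namespace CoeffData

/-- The number of interpolation nodes. -/
def numNodes (n m : ℕ) : ℕ := (n + m + 1) ^ 4

theorem lt_numNodes (n m : ℕ) : n + m < numNodes n m := by
  have := Nat.le_self_pow (n := 4) (by omega) (n + m + 1)
  rw [numNodes]; omega

variable {K : Type u} [Field K] (D : CoeffData K)

/-- The difference of two field elements. -/
def sub (x y : K) : K := x + D.negOne * y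

/-- The value of the first polynomial. -/
def evalF (y : K) : K := ∑ l ∈ Finset.range (D.n + 1), D.f l * y ^ l

/-- The value of the second polynomial. -/
def evalG (y : K) : K := ∑ l ∈ Finset.range (D.m + 1), D.g l * y ^ l

/-- The value of `nodalCofactor`. -/
def cofactor (i : ℕ) (y : K) : K :=
  ∏ j ∈ Finset.range D.n, if j = i then 1 else y + D.sub (D.node i) (D.node j)

/-- The value of a truncated inverse of `nodalCofactor`. -/
def invCofactor (i : ℕ) (y : K) : K :=
  ∑ l ∈ Finset.range (D.n + D.m + 1), D.table D.n i (D.n - 1) *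
    (D.sub 1 (D.table D.n i (D.n - 1) * D.cofactor i y)) ^ l

/-- The value of `f - t (x - y) - ∏ (y - a i)`. -/
def perturbation (t x y : K) : K :=
  D.sub (D.evalF y + t * D.sub y x) (∏ j ∈ Finset.range D.n, D.sub y (D.node j))

/-- The value at the `v`-th node of a polynomial approximation of the `i`-th `rootSeries`. -/
def series (t x : K) (i v : ℕ) : K :=
  D.negOne * (D.perturbation t x (D.node i + D.node v) * D.invCofactor i (D.node v))

/-- The value at the `v`-th node of the `eulerDiff` of the approximation of `rootSeries`. -/
def euler (t x : K) (i v : ℕ) : K :=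
  ∑ l ∈ Finset.range (numNodes D.n D.m), D.sub 1 (∑ _u ∈ Finset.range l, 1) *
    (∑ e ∈ Finset.range (numNodes D.n D.m), D.table (numNodes D.n D.m) e l * D.series t x i e) *
    D.node v ^ l

/-- The `k`-th coefficient of the value of `g + s t (x - y)` at the `i`-th root. -/
def rootCoeff (t x s : K) (i k : ℕ) : K :=
  ∑ v ∈ Finset.range (numNodes D.n D.m), D.table (numNodes D.n D.m) v k *
    ((D.evalG (D.node i + D.node v) + t * (s * D.sub x (D.node i + D.node v))) *
      if k = 0 then 1 else D.series t x i v ^ (k - 1) * D.euler t x i v)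

/-- The resultant of `f - t (x - y)` and `g + s t (x - y)`. -/
def res (t x s : K) : K :=
  ∑ l ∈ Finset.range (D.n + D.m + 1), ∑ w ∈ Finset.range (numNodes D.n D.m),
    D.table (numNodes D.n D.m) w l * ∏ i ∈ Finset.range D.n,
      ∑ k ∈ Finset.range (D.n + D.m + 1), D.rootCoeff t x s i k * D.node w ^ k

/-- The coefficient of `t ^ r` in the resultant of `f - t (x - y)` and `g + s t (x - y)`. -/
def pencilCoeff (x s : K) (r : ℕ) : K :=
  ∑ p ∈ Finset.range (numNodes D.n D.m), D.table (numNodes D.n D.m) p r * D.res (D.node p) x s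

/-- The coefficient of `t ^ r x ^ j` in the resultant of `f - t (x - y)` and `g + s t (x - y)`. -/
def pencilCoeff₂ (s : K) (r j : ℕ) : K :=
  ∑ q ∈ Finset.range (numNodes D.n D.m), D.table (numNodes D.n D.m) q j *
    D.pencilCoeff (D.node q) s r

/-- The data are those of the polynomials `f` and `g`. -/
structure IsValid (f g : K[X]) : Prop where
  injOn : Set.InjOn D.node (Set.Iio (numNodes D.n D.m))
  table_eq : ∀ w ≤ numNodes D.n D.m, ∀ p < numNodes D.n D.m, ∀ k < numNodes D.n D.m,
    D.table w p k = (Lagrange.basis (Finset.range w) D.node p).coeff k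
  negOne_eq : D.negOne = -1
  monic_f : f.Monic
  monic_g : g.Monic
  natDegree_f : f.natDegree = D.n
  natDegree_g : g.natDegree = D.m
  f_eq : ∀ l ≤ D.n, D.f l = f.coeff l
  g_eq : ∀ l ≤ D.m, D.g l = g.coeff l
  two_le : 2 ≤ D.n
  one_le : 1 ≤ D.m

namespace IsValid

variable {D} {f g : K[X]} (h : D.IsValid f g)
include h

theorem injOn_n : Set.InjOn D.node (Set.Iio D.n) :=
  h.injOn.mono (Set.Iio_subset_Iio (by have := lt_numNodes D.n D.m; omega))

theorem sub_eq (x y : K) : D.sub x y = x - y := by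
  rw [sub, h.negOne_eq]; ring

/-- The basic move of all the circuits: a coefficient is a sum of values at the nodes, weighted by
tabulated constants. -/
theorem coeff_eq_sum {P : K[X]} (hP : P.natDegree < numNodes D.n D.m) {k : ℕ}
    (hk : k < numNodes D.n D.m) : P.coeff k = ∑ p ∈ Finset.range (numNodes D.n D.m),
      D.table (numNodes D.n D.m) p k * P.eval (D.node p) := by
  have hinj : Set.InjOn D.node (Finset.range (numNodes D.n D.m)) := by
    simpa using h.injOn
  have := Lagrange.eq_interpolate (f := P) hinj (by
    rw [Finset.card_range]
    exact degree_le_natDegree.trans_lt (by exact_mod_cast hP))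
  conv_lhs => rw [this]
  rw [Lagrange.interpolate_apply, finsetSum_coeff]
  refine Finset.sum_congr rfl fun p hp => ?_
  rw [coeff_C_mul, h.table_eq _ le_rfl p (Finset.mem_range.1 hp) k hk, mul_comm]

theorem evalF_eq (y : K) : D.evalF y = f.eval y := by
  rw [eval_eq_sum_range' (n := D.n + 1) (by rw [h.natDegree_f]; omega), evalF]
  refine Finset.sum_congr rfl fun l hl => ?_
  rw [h.f_eq l (by have := Finset.mem_range.1 hl; omega)]

theorem evalG_eq (y : K) : D.evalG y = g.eval y := by
  rw [eval_eq_sum_range' (n := D.m + 1) (by rw [h.natDegree_g]; omega), evalG]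
  refine Finset.sum_congr rfl fun l hl => ?_
  rw [h.g_eq l (by have := Finset.mem_range.1 hl; omega)]

theorem cofactor_eq (i : ℕ) (y : K) : D.cofactor i y = (nodalCofactor D.node D.n i).eval y := by
  rw [cofactor, nodalCofactor, eval_prod]
  refine Finset.prod_congr rfl fun j _ => ?_
  split_ifs
  · simp
  · rw [h.sub_eq]; simp

/-- The leading coefficient of a Lagrange basis polynomial is the reciprocal of the product of node
differences. So the table provides this inverse and the circuits need no division. -/
theorem table_n_eq {i : ℕ} (hi : i < D.n) :
    D.table D.n i (D.n - 1) = ((nodalCofactor D.node D.n i).eval 0)⁻¹ := by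
  have hlt := lt_numNodes D.n D.m
  have hinj : Set.InjOn D.node (Finset.range D.n) := by simpa using h.injOn_n
  have hmem := Finset.mem_range.2 hi
  rw [h.table_eq _ (by omega) _ (by omega) _ (by omega)]
  have h1 := Lagrange.leadingCoeff_basis hinj hmem
  rw [leadingCoeff, Lagrange.natDegree_basis hinj hmem, Finset.card_range] at h1
  rw [h1, nodalCofactor, eval_prod, ← Finset.mul_prod_erase _ _ hmem]
  simp only [if_true, eval_one, one_mul]
  congr 1
  refine Finset.prod_congr rfl fun j hj => ?_
  rw [if_neg (Finset.ne_of_mem_erase hj)]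
  simp

end IsValid

/-- The polynomial with values `invCofactor`. -/
def invCofactorPoly (i : ℕ) : K[X] :=
  ∑ l ∈ Finset.range (D.n + D.m + 1), C ((nodalCofactor D.node D.n i).eval 0)⁻¹ *
    (1 - C ((nodalCofactor D.node D.n i).eval 0)⁻¹ * nodalCofactor D.node D.n i) ^ l

/-- The polynomial with values `perturbation`. -/
def perturbationPoly (f : K[X]) (t x : K) : K[X] := f + C t * (X - C x) - nodal D.node D.n

/-- The polynomial with values `series`. -/
def seriesPoly (f : K[X]) (t x : K) (i : ℕ) : K[X] :=
  -(taylor (D.node i) (D.perturbationPoly f t x) * D.invCofactorPoly i)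

theorem natDegree_eulerPoly_le (φ : K[X]) : (φ - X * derivative φ).natDegree ≤ φ.natDegree := by
  refine (natDegree_sub_le φ (X * derivative φ)).trans (max_le le_rfl ?_)
  rcases Nat.eq_zero_or_pos φ.natDegree with h0 | h0
  · rw [eq_C_of_natDegree_eq_zero h0]; simp
  · refine natDegree_mul_le.trans ?_
    have := natDegree_derivative_le φ
    have := natDegree_X_le (R := K)
    omega

theorem natDegree_nodalCofactor_le {a : ℕ → K} {n i : ℕ} (hi : i < n) :
    (nodalCofactor a n i).natDegree ≤ n - 1 := by
  rw [nodalCofactor, ← Finset.mul_prod_erase _ _ (Finset.mem_range.2 hi), if_pos rfl, one_mul]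
  refine (natDegree_prod_le _ _).trans ((Finset.sum_le_card_nsmul _ _ 1 fun j hj => ?_).trans ?_)
  · rw [if_neg (Finset.ne_of_mem_erase hj)]
    exact (natDegree_X_add_C _).le
  · simp [Finset.card_erase_of_mem (Finset.mem_range.2 hi)]

theorem natDegree_invCofactorPoly_le {i : ℕ} (hi : i < D.n) :
    (D.invCofactorPoly i).natDegree ≤ (D.n + D.m) * (D.n - 1) := by
  refine natDegree_sum_le_of_forall_le _ _ fun l hl => (natDegree_C_mul_le _ _).trans ?_
  refine natDegree_pow_le.trans (Nat.mul_le_mul (by have := Finset.mem_range.1 hl; omega) ?_)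
  exact (natDegree_sub_le _ _).trans (max_le (by simp)
    ((natDegree_C_mul_le _ _).trans (natDegree_nodalCofactor_le hi)))

namespace IsValid

variable {D} {f g : K[X]} (h : D.IsValid f g)
include h

theorem invCofactor_eq {i : ℕ} (hi : i < D.n) (y : K) :
    D.invCofactor i y = (D.invCofactorPoly i).eval y := by
  rw [invCofactor, invCofactorPoly, eval_finsetSum]
  refine Finset.sum_congr rfl fun l _ => ?_
  rw [h.table_n_eq hi, h.sub_eq, h.cofactor_eq]
  simp

/-- A truncated geometric series: with `e = 1 - c / c(0)`, which is divisible by `X`, the error is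
`e^(n+m+1)`. -/
theorem dvd_one_sub_mul_invCofactorPoly {i : ℕ} (hi : i < D.n) :
    X ^ (D.n + D.m + 1) ∣ 1 - nodalCofactor D.node D.n i * D.invCofactorPoly i := by
  have hc := nodalCofactor_eval_zero_ne_zero hi h.injOn_n
  set c := nodalCofactor D.node D.n i
  set e : K[X] := 1 - C (c.eval 0)⁻¹ * c with he
  have h1 : 1 - c * D.invCofactorPoly i = e ^ (D.n + D.m + 1) := by
    have := mul_neg_geom_sum e (D.n + D.m + 1)
    rw [invCofactorPoly, ← Finset.mul_sum, ← mul_assoc]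
    have h2 : c * C (c.eval 0)⁻¹ = 1 - e := by rw [he]; ring
    rw [h2, this]; ring
  rw [h1]
  refine pow_dvd_pow_of_dvd (X_dvd_iff.2 ?_) _
  rw [coeff_zero_eq_eval_zero, he]
  simp [hc]

theorem perturbation_eq (t x y : K) :
    D.perturbation t x y = (D.perturbationPoly f t x).eval y := by
  rw [perturbation, perturbationPoly, h.sub_eq, h.sub_eq, h.evalF_eq, nodal, eval_sub, eval_prod]
  simp only [h.sub_eq]
  simp

theorem degree_perturbationPoly_lt (t x : K) : (D.perturbationPoly f t x).degree < D.n := by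
  have h1 : f.degree = D.n := by rw [degree_eq_natDegree h.monic_f.ne_zero, h.natDegree_f]
  have h2 : (nodal D.node D.n).degree = D.n := by
    rw [degree_eq_natDegree (nodal_monic _ _).ne_zero, nodal_natDegree]
  rw [perturbationPoly, add_sub_right_comm]
  refine (degree_add_le _ _).trans_lt (max_lt ?_ ?_)
  · have := degree_sub_lt_left (h1.trans h2.symm) h.monic_f.ne_zero
      (by rw [h.monic_f.leadingCoeff, (nodal_monic _ _).leadingCoeff])
    rwa [h1] at this
  · have h3 : (C t * (X - C x)).natDegree ≤ 1 :=
      (natDegree_C_mul_le _ _).trans (natDegree_X_sub_C_le x)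
    refine (degree_le_of_natDegree_le h3).trans_lt ?_
    have := h.two_le
    exact_mod_cast (by omega : 1 < D.n)

theorem natDegree_perturbationPoly_le (t x : K) : (D.perturbationPoly f t x).natDegree ≤ D.n - 1 := by
  have h1 := h.degree_perturbationPoly_lt t x
  refine natDegree_le_iff_coeff_eq_zero.2 fun N hN => coeff_eq_zero_of_degree_lt (h1.trans_le ?_)
  exact_mod_cast (by omega : D.n ≤ N)

theorem series_eq {i : ℕ} (hi : i < D.n) (t x : K) (v : ℕ) :
    D.series t x i v = (D.seriesPoly f t x i).eval (D.node v) := by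
  rw [series, seriesPoly, h.negOne_eq, h.perturbation_eq, h.invCofactor_eq hi, eval_neg, eval_mul,
    taylor_eval, add_comm (D.node i)]
  ring

theorem natDegree_seriesPoly_le {i : ℕ} (hi : i < D.n) (t x : K) :
    (D.seriesPoly f t x i).natDegree ≤ (D.n + D.m + 1) * (D.n - 1) := by
  rw [seriesPoly, natDegree_neg]
  refine natDegree_mul_le.trans ?_
  rw [natDegree_taylor]
  have h1 := h.natDegree_perturbationPoly_le t x
  have h2 := D.natDegree_invCofactorPoly_le hi
  calc _ ≤ (D.n - 1) + (D.n + D.m) * (D.n - 1) := add_le_add h1 h2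
    _ = _ := by ring

theorem rootSeries_sub_dvd {i : ℕ} (hi : i < D.n) (t x : K) :
    PowerSeries.X ^ (D.n + D.m + 1) ∣
      rootSeries D.node D.n (D.perturbationPoly f t x) i - (D.seriesPoly f t x i : PowerSeries K) := by
  obtain ⟨w, hw⟩ := h.dvd_one_sub_mul_invCofactorPoly hi
  have hc : PowerSeries.constantCoeff (nodalCofactor D.node D.n i : PowerSeries K) ≠ 0 := by
    rw [Polynomial.constantCoeff_coe, coeff_zero_eq_eval_zero]
    exact nodalCofactor_eval_zero_ne_zero hi h.injOn_n
  set c : PowerSeries K := (nodalCofactor D.node D.n i : PowerSeries K)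
  have hcc : c⁻¹ * c = 1 := PowerSeries.inv_mul_cancel _ hc
  have hw' : 1 - c * (D.invCofactorPoly i : PowerSeries K) =
      PowerSeries.X ^ (D.n + D.m + 1) * (w : PowerSeries K) := by
    have := congrArg (fun p : K[X] => (p : PowerSeries K)) hw
    simpa [c] using this
  refine ⟨-(taylor (D.node i) (D.perturbationPoly f t x) : K[X]) * c⁻¹ * (w : PowerSeries K), ?_⟩
  rw [rootSeries, seriesPoly, Polynomial.coe_neg, Polynomial.coe_mul]
  set T : PowerSeries K := ((taylor (D.node i) (D.perturbationPoly f t x) : K[X]) : PowerSeries K)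
  linear_combination (-T * c⁻¹) * hw' - (T * (D.invCofactorPoly i : PowerSeries K)) * hcc

/-- The polynomials interpolated in Lagrange inversion have degree cubic in `n + m`; the fourth
power of `n + m + 1` leaves enough nodes. -/
theorem numNodes_gt (k : ℕ) (hk : k ≤ D.n + D.m) :
    D.m + k * ((D.n + D.m + 1) * (D.n - 1)) < numNodes D.n D.m := by
  have h1 : k * ((D.n + D.m + 1) * (D.n - 1)) ≤
      (D.n + D.m + 1) * ((D.n + D.m + 1) * (D.n + D.m + 1)) :=
    Nat.mul_le_mul (by omega) (Nat.mul_le_mul le_rfl (by omega))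
  have h2 : numNodes D.n D.m = (D.n + D.m + 1) * ((D.n + D.m + 1) * ((D.n + D.m + 1) *
      (D.n + D.m + 1))) := by rw [numNodes]; ring
  have h3 := h.two_le
  set N := D.n + D.m + 1
  have h4 : D.m < N := by omega
  have h5 : 3 ≤ N := by omega
  rw [h2]
  nlinarith [Nat.mul_le_mul h5 (le_refl (N * (N * N))), Nat.mul_le_mul h5 (le_refl (N * N)),
    Nat.mul_le_mul h5 (le_refl N)]

theorem natDegree_seriesPoly_lt {i : ℕ} (hi : i < D.n) (t x : K) :
    (D.seriesPoly f t x i).natDegree < numNodes D.n D.m := by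
  have := h.numNodes_gt 1 (by have := h.two_le; omega)
  have := h.natDegree_seriesPoly_le hi t x
  omega

/-- On coefficients, `φ - X φ'` is multiplication by `1 - l`, so interpolated coefficients replace
differentiation. -/
theorem euler_eq {i : ℕ} (hi : i < D.n) (t x : K) (v : ℕ) :
    D.euler t x i v =
      (D.seriesPoly f t x i - X * derivative (D.seriesPoly f t x i)).eval (D.node v) := by
  set φ := D.seriesPoly f t x i with hφ
  have hd := h.natDegree_seriesPoly_lt hi t x
  rw [eval_eq_sum_range' ((natDegree_eulerPoly_le φ).trans_lt hd), euler]
  refine Finset.sum_congr rfl fun l hl => ?_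
  have h1 := h.coeff_eq_sum hd (Finset.mem_range.1 hl)
  simp_rw [h.series_eq hi]
  rw [← h1, h.sub_eq]
  congr 1
  cases l with
  | zero => simp [φ]
  | succ l =>
    rw [coeff_sub, coeff_X_mul, coeff_derivative]
    simp only [Finset.sum_const, Finset.card_range, nsmul_eq_mul, mul_one]
    push_cast; ring

/-- By Lagrange inversion, `rootCoeff` is a coefficient of `g + s t (x - y)` at a root. -/
theorem rootCoeff_eq {i : ℕ} (hi : i < D.n) (t x s : K) {k : ℕ} (hk : k ≤ D.n + D.m) :
    D.rootCoeff t x s i k = PowerSeries.coeff k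
      (lagrangeHom (rootSeries D.node D.n (D.perturbationPoly f t x) i)
        (taylor (D.node i) (g + C t * (C s * (C x - X))) : K[X])) := by
  rw [coeff_lagrangeHom_congr (h.rootSeries_sub_dvd hi t x) _ (Nat.lt_succ_of_le hk)]
  set φ := D.seriesPoly f t x i with hφ
  set G := g + C t * (C s * (C x - X)) with hG
  have hGm : G.natDegree ≤ D.m := by
    refine natDegree_add_le_of_degree_le h.natDegree_g.le ?_
    refine (natDegree_C_mul_le _ _).trans ((natDegree_C_mul_le _ _).trans ?_)
    exact (natDegree_C_sub_X_le x).trans h.one_le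
  have hφd : φ.natDegree ≤ _ := h.natDegree_seriesPoly_le hi t x
  -- With `φ` a polynomial, the weight is a polynomial too, of controlled degree and with values
  -- that the circuit knows; so its product with the shifted `G` can be interpolated.
  obtain ⟨W, hW, hWd, hWe⟩ : ∃ W : K[X], (W : PowerSeries K) = lagrangeWeight (φ : PowerSeries K) k ∧
      W.natDegree ≤ k * ((D.n + D.m + 1) * (D.n - 1)) ∧ ∀ v, W.eval (D.node v) =
        if k = 0 then 1 else D.series t x i v ^ (k - 1) * D.euler t x i v := by
    cases k with
    | zero => exact ⟨1, by simp [lagrangeWeight], by simp, by simp⟩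
    | succ k =>
      refine ⟨φ ^ k * (φ - X * derivative φ), ?_, ?_, fun v => ?_⟩
      · simp [lagrangeWeight, eulerDiff, PowerSeries.derivative_coe]
      · refine natDegree_mul_le.trans ?_
        have h1 : (φ ^ k).natDegree ≤ k * ((D.n + D.m + 1) * (D.n - 1)) :=
          natDegree_pow_le.trans (Nat.mul_le_mul le_rfl hφd)
        have h2 := natDegree_eulerPoly_le φ
        rw [Nat.succ_mul]
        omega
      · rw [h.series_eq hi, h.euler_eq hi]; simp [hφ]
  rw [← hW, ← Polynomial.coe_mul, Polynomial.coeff_coe]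
  have hdeg : (taylor (D.node i) G * W).natDegree < numNodes D.n D.m := by
    have := h.numNodes_gt k hk
    refine lt_of_le_of_lt natDegree_mul_le ?_
    rw [natDegree_taylor]
    omega
  have hkN : k < numNodes D.n D.m := by
    have := lt_numNodes D.n D.m
    omega
  rw [h.coeff_eq_sum hdeg hkN, rootCoeff]
  refine Finset.sum_congr rfl fun v _ => ?_
  rw [eval_mul, hWe, taylor_eval, hG, h.evalG_eq, h.sub_eq, add_comm (D.node i)]
  simp

/-- The values of `G` at the roots are known only up to order `n + m` in `z`, but no higher
coefficient of their product is used. The product of the truncations is a polynomial in `z` of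
degree at most `n (n + m)`, so its coefficients are again found by interpolation. -/
theorem res_eq (t x s : K) :
    D.res t x s = (pencilResultant f g D.n D.m s x).eval t := by
  have hF : f + C t * (X - C x) = nodal D.node D.n + D.perturbationPoly f t x := by
    rw [perturbationPoly]; ring
  have hGm : (g + C t * (C s * (C x - X))).natDegree ≤ D.m := by
    refine natDegree_add_le_of_degree_le h.natDegree_g.le ?_
    refine (natDegree_C_mul_le _ _).trans ((natDegree_C_mul_le _ _).trans ?_)
    exact (natDegree_C_sub_X_le x).trans h.one_le
  rw [pencilResultant, eval_resultant_add_X_mul, hF,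
    resultant_eq_sum_coeff h.injOn_n (h.degree_perturbationPoly_lt t x) hGm, res]
  refine Finset.sum_congr rfl fun l hl => ?_
  have hl' := Finset.mem_range.1 hl
  set Λ : ℕ → PowerSeries K := fun i =>
    lagrangeHom (rootSeries D.node D.n (D.perturbationPoly f t x) i)
      (taylor (D.node i) (g + C t * (C s * (C x - X))) : K[X])
  set P : ℕ → K[X] := fun i => ∑ k ∈ Finset.range (D.n + D.m + 1), C (D.rootCoeff t x s i k) * X ^ k
    with hP
  have hPd (i : ℕ) : (P i).natDegree ≤ D.n + D.m :=
    natDegree_sum_le_of_forall_le _ _ fun k hk =>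
      (natDegree_C_mul_X_pow_le _ _).trans (by have := Finset.mem_range.1 hk; omega)
  have hdvd : ∀ i < D.n, PowerSeries.X ^ (D.n + D.m + 1) ∣ Λ i - (P i : PowerSeries K) := by
    intro i hi
    refine PowerSeries.X_pow_dvd_iff.2 fun k hk => ?_
    rw [map_sub, Polynomial.coeff_coe, hP]
    simp only [finsetSum_coeff, coeff_C_mul_X_pow, Finset.sum_ite_eq, Finset.mem_range, hk, if_true]
    rw [h.rootCoeff_eq hi t x s (by omega), sub_self]
  have hprod : ∀ n' ≤ D.n, PowerSeries.X ^ (D.n + D.m + 1) ∣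
      ∏ i ∈ Finset.range n', Λ i - ((∏ i ∈ Finset.range n', P i : K[X]) : PowerSeries K) := by
    intro n' hn'
    induction n' with
    | zero => simp
    | succ n' ih =>
      rw [Finset.prod_range_succ, Finset.prod_range_succ, Polynomial.coe_mul]
      have h1 := ih (by omega)
      have h2 := hdvd n' (by omega)
      convert dvd_add (h1.mul_right (Λ n'))
        (h2.mul_left ((∏ i ∈ Finset.range n', P i : K[X]) : PowerSeries K)) using 1
      ring
  have hcoeff := PowerSeries.X_pow_dvd_iff.1 (hprod D.n le_rfl) l hl'
  rw [map_sub, sub_eq_zero, Polynomial.coeff_coe] at hcoeff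
  rw [hcoeff, h.coeff_eq_sum]
  · refine Finset.sum_congr rfl fun w _ => ?_
    rw [eval_prod]
    congr 1
    refine Finset.prod_congr rfl fun i _ => ?_
    rw [hP, eval_finsetSum]
    simp
  · refine (natDegree_prod_le _ _).trans_lt
      ((Finset.sum_le_card_nsmul _ _ (D.n + D.m) fun i _ => hPd i).trans_lt ?_)
    rw [Finset.card_range, smul_eq_mul, numNodes]
    calc D.n * (D.n + D.m) ≤ (D.n + D.m + 1) * (D.n + D.m) := Nat.mul_le_mul (by omega) le_rfl
      _ < (D.n + D.m + 1) * (D.n + D.m + 1) := Nat.mul_lt_mul_of_pos_left (by omega) (by omega)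
      _ = (D.n + D.m + 1) ^ 2 := by ring
      _ ≤ _ := Nat.pow_le_pow_right (by omega) (by omega)
  · have := lt_numNodes D.n D.m
    omega

theorem pencilCoeff_eq (x s : K) {r : ℕ} (hr : r ≤ D.n) :
    D.pencilCoeff x s r = (pencilResultant f g D.n D.m s x).coeff r := by
  have h1 : (pencilResultant f g D.n D.m s x).natDegree ≤ D.n + D.m :=
    natDegree_resultant_add_X_mul_le _ _ _ _ _ _
  have h2 := lt_numNodes D.n D.m
  rw [h.coeff_eq_sum (by omega) (by omega), pencilCoeff]
  simp_rw [h.res_eq]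

/-- The coefficients of the pencil resultant up to `t ^ deg (gcd f g)`. -/
theorem exists_pencilCoeff₂_eq {f' g' : K[X]} (hf : f = monicGcd f g * f')
    (hg : g = monicGcd f g * g') (hd : (monicGcd f g).Monic) (hf' : f'.Monic) (s : K) :
    (∀ r < (monicGcd f g).natDegree, ∀ j ≤ D.n, D.pencilCoeff₂ s r j = 0) ∧
    ∃ ε : K, ε ≠ 0 ∧ ∀ j ≤ D.n, D.pencilCoeff₂ s (monicGcd f g).natDegree j =
      ε * resultant (monicGcd f g * f') (g' + C s * f') * (monicGcd f g).coeff j := by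
  set d := monicGcd f g with hdef
  have hlt := lt_numNodes D.n D.m
  have hdn : d.natDegree ≤ D.n := by
    rw [← h.natDegree_f, hf, hd.natDegree_mul hf']; omega
  have key (x : K) := exists_pencilResultant_eq (n := D.n) (m := D.m) (g' := g') hd hf'
    (by rw [← hf, h.natDegree_f]) (by rw [← hg, h.natDegree_g]) h.two_le h.one_le s x
  rw [← hf, ← hg] at key
  choose S hS0 hS using key
  -- At every node `x` the coefficient of `t^(deg d)` is `d(x)` times one and the same scalar,
  -- although `S` varies with `x`. Interpolation in `x` therefore recovers the coefficients of a
  -- multiple of `d`.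
  refine ⟨fun r hr j hj => ?_, (-1) ^ (D.n * f'.natDegree + f'.natDegree), by simp, fun j hj => ?_⟩
  · refine Finset.sum_eq_zero fun q _ => ?_
    rw [h.pencilCoeff_eq _ _ (by omega), hS, coeff_C_mul, coeff_X_pow_mul', if_neg (by omega)]
    simp
  · set κ := resultant (d * f') (g' + C s * f') with hκ
    rw [← coeff_C_mul, h.coeff_eq_sum ((natDegree_C_mul_le _ _).trans_lt (by omega)) (by omega),
      pencilCoeff₂]
    refine Finset.sum_congr rfl fun q _ => ?_
    rw [h.pencilCoeff_eq _ _ hdn, hS, coeff_C_mul, coeff_X_pow_mul', if_pos le_rfl, Nat.sub_self,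
      hS0, eval_C_mul]
    rw [hκ, ← hf]
    ring

end IsValid

end CoeffData

end

section

open Polynomial CoeffData

/-! ### Circuits for the coefficients of the pencil resultant -/

/-- The position, in the straight-line program for the constants, of the `j`-th step of the block
that computes the entry `(w, p, k)` of the table of Lagrange basis polynomials. -/
def address (n m w p k j : ℕ) : ℕ := ((w * numNodes n m + p) * numNodes n m + k) * 8 + j

/-- The data for polynomials of degrees `n` and `m`, given by the constants and the inputs. -/
def Ctx.data (Γ : Ctx.{u}) (n m : ℕ) : CoeffData Γ.K where
  n := n
  m := m
  -- Addresses into `blockOp`: slot 2 of a block with `w ≠ 0` holds the node `p`, slot 6 the entry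
  -- of the table, and slot 7 of the block `(0, 0, 0)` holds `-1`.
  node i := Γ.const (address n m 1 i 0 2)
  table w p k := Γ.const (address n m w p k 6)
  negOne := Γ.const (address n m 0 0 0 7)
  f l := Γ.input l
  g l := Γ.input (n + 1 + l)

section

variable {α : Type} [Denumerable α] {n m w p k i v r j : α → ℕ}

theorem LS.numNodes (hn : LS n) (hm : LS m) : LS fun s => numNodes (n s) (m s) :=
  ((hn.add hm).succ).pow 4

theorem LS.address (hn : LS n) (hm : LS m) (hw : LS w) (hp : LS p) (hk : LS k) (hj : LS j) :
    LS fun s => address (n s) (m s) (w s) (p s) (k s) (j s) :=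
  have hN := hn.numNodes hm
  ((((hw.mul hN).add hp).mul hN |>.add hk).mul (.const 8)).add hj

namespace ConstDepth

theorem node (hn : LS n) (hm : LS m) (hi : LS i) :
    ConstDepth.{u} fun Γ s => (Γ.data (n s) (m s)).node (i s) :=
  const (hn.address hm (.const 1) hi (.const 0) (.const 2))

theorem table (hn : LS n) (hm : LS m) (hw : LS w) (hp : LS p) (hk : LS k) :
    ConstDepth.{u} fun Γ s => (Γ.data (n s) (m s)).table (w s) (p s) (k s) :=
  const (hn.address hm hw hp hk (.const 6))

theorem negOne (hn : LS n) (hm : LS m) :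
    ConstDepth.{u} fun Γ s => (Γ.data (n s) (m s)).negOne :=
  const (hn.address hm (.const 0) (.const 0) (.const 0) (.const 7))

variable {Φ Ψ Θ : (Γ : Ctx.{u}) → α → Γ.K}

theorem sub (hn : LS n) (hm : LS m) (hΦ : ConstDepth Φ) (hΨ : ConstDepth Ψ) :
    ConstDepth fun Γ s => (Γ.data (n s) (m s)).sub (Φ Γ s) (Ψ Γ s) :=
  hΦ.add ((negOne hn hm).mul hΨ)

theorem evalF (hn : LS n) (hΦ : ConstDepth Φ) :
    ConstDepth fun Γ s => (Γ.data (n s) (m s)).evalF (Φ Γ s) :=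
  sum (Φ := fun Γ s l => (Γ.data (n s) (m s)).f l * Φ Γ s ^ l)
    ((input .snd).mul ((hΦ.reindex .fst).pow .snd)) hn.succ

theorem evalG (hn : LS n) (hm : LS m) (hΦ : ConstDepth Φ) :
    ConstDepth fun Γ s => (Γ.data (n s) (m s)).evalG (Φ Γ s) :=
  sum (Φ := fun Γ s l => (Γ.data (n s) (m s)).g l * Φ Γ s ^ l)
    ((input ((hn.comp .fst).succ.add .snd)).mul ((hΦ.reindex .fst).pow .snd)) hm.succ

theorem cofactor (hn : LS n) (hm : LS m) (hi : LS i) (hΦ : ConstDepth Φ) :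
    ConstDepth fun Γ s => (Γ.data (n s) (m s)).cofactor (i s) (Φ Γ s) :=
  prod (Φ := fun Γ s j => if j = i s then 1 else
      Φ Γ s + (Γ.data (n s) (m s)).sub ((Γ.data (n s) (m s)).node (i s))
        ((Γ.data (n s) (m s)).node j))
    (.ite (.eq .snd (hi.comp .fst)) one ((hΦ.reindex .fst).add
      (sub (hn.comp .fst) (hm.comp .fst) (node (hn.comp .fst) (hm.comp .fst) (hi.comp .fst))
        (node (hn.comp .fst) (hm.comp .fst) .snd)))) hn

theorem invCofactor (hn : LS n) (hm : LS m) (hi : LS i) (hΦ : ConstDepth Φ) :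
    ConstDepth fun Γ s => (Γ.data (n s) (m s)).invCofactor (i s) (Φ Γ s) := by
  have ht : ConstDepth.{u} fun Γ s => (Γ.data (n s) (m s)).table (n s) (i s) (n s - 1) :=
    table hn hm hn hi hn.pred
  exact sum (Φ := fun Γ s l => (Γ.data (n s) (m s)).table (n s) (i s) (n s - 1) *
      ((Γ.data (n s) (m s)).sub 1 ((Γ.data (n s) (m s)).table (n s) (i s) (n s - 1) *
        (Γ.data (n s) (m s)).cofactor (i s) (Φ Γ s))) ^ l)
    ((ht.reindex .fst).mul (((sub hn hm one (ht.mul (cofactor hn hm hi hΦ))).reindex .fst).pow .snd))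
    (hn.add hm).succ

theorem perturbation (hn : LS n) (hm : LS m) (hΦ : ConstDepth Φ) (hΨ : ConstDepth Ψ)
    (hΘ : ConstDepth Θ) :
    ConstDepth fun Γ s => (Γ.data (n s) (m s)).perturbation (Φ Γ s) (Ψ Γ s) (Θ Γ s) :=
  sub hn hm ((evalF hn hΘ).add (hΦ.mul (sub hn hm hΘ hΨ)))
    (prod (Φ := fun Γ s j => (Γ.data (n s) (m s)).sub (Θ Γ s) ((Γ.data (n s) (m s)).node j))
      (sub (hn.comp .fst) (hm.comp .fst) (hΘ.reindex .fst)
        (node (hn.comp .fst) (hm.comp .fst) .snd)) hn)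

theorem series (hn : LS n) (hm : LS m) (hΦ : ConstDepth Φ) (hΨ : ConstDepth Ψ) (hi : LS i)
    (hv : LS v) :
    ConstDepth fun Γ s => (Γ.data (n s) (m s)).series (Φ Γ s) (Ψ Γ s) (i s) (v s) :=
  (negOne hn hm).mul ((perturbation hn hm hΦ hΨ ((node hn hm hi).add (node hn hm hv))).mul
    (invCofactor hn hm hi (node hn hm hv)))

theorem euler (hn : LS n) (hm : LS m) (hΦ : ConstDepth Φ) (hΨ : ConstDepth Ψ) (hi : LS i)
    (hv : LS v) :
    ConstDepth fun Γ s => (Γ.data (n s) (m s)).euler (Φ Γ s) (Ψ Γ s) (i s) (v s) := by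
  have hn1 := hn.comp (.fst (β := ℕ))
  have hm1 := hm.comp (.fst (β := ℕ))
  have hn2 := hn1.comp (.fst (β := ℕ))
  have hm2 := hm1.comp (.fst (β := ℕ))
  refine sum (Φ := fun Γ s l => (Γ.data (n s) (m s)).sub 1 (∑ _u ∈ Finset.range l, 1) *
    (∑ e ∈ Finset.range (CoeffData.numNodes (n s) (m s)),
      (Γ.data (n s) (m s)).table (CoeffData.numNodes (n s) (m s)) e l *
        (Γ.data (n s) (m s)).series (Φ Γ s) (Ψ Γ s) (i s) e) *
    (Γ.data (n s) (m s)).node (v s) ^ l) ?_ (hn.numNodes hm)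
  refine ((sub hn1 hm1 one (sum one .snd)).mul
    (sum (Φ := fun Γ (s : α × ℕ) e => (Γ.data (n s.1) (m s.1)).table
      (CoeffData.numNodes (n s.1) (m s.1)) e s.2 *
        (Γ.data (n s.1) (m s.1)).series (Φ Γ s.1) (Ψ Γ s.1) (i s.1) e) ?_ (hn1.numNodes hm1))).mul
    ((node hn1 hm1 (hv.comp .fst)).pow .snd)
  exact (table hn2 hm2 (hn2.numNodes hm2) .snd (.snd' .fst)).mul
    (series hn2 hm2 (hΦ.reindex (.fst' .fst)) (hΨ.reindex (.fst' .fst)) (hi.comp (.fst' .fst)) .snd)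

theorem rootCoeff (hn : LS n) (hm : LS m) (hΦ : ConstDepth Φ) (hΨ : ConstDepth Ψ)
    (hΘ : ConstDepth Θ) (hi : LS i) (hk : LS k) :
    ConstDepth fun Γ s => (Γ.data (n s) (m s)).rootCoeff (Φ Γ s) (Ψ Γ s) (Θ Γ s) (i s) (k s) := by
  have hn1 := hn.comp (.fst (β := ℕ))
  have hm1 := hm.comp (.fst (β := ℕ))
  have hi1 := hi.comp (.fst (β := ℕ))
  have hk1 := hk.comp (.fst (β := ℕ))
  have hΦ1 := hΦ.reindex (.fst (β := ℕ))
  have hΨ1 := hΨ.reindex (.fst (β := ℕ))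
  have hΘ1 := hΘ.reindex (.fst (β := ℕ))
  have hnode := (node.{u} hn1 hm1 hi1).add (node hn1 hm1 .snd)
  exact sum (Φ := fun Γ s v => (Γ.data (n s) (m s)).table (CoeffData.numNodes (n s) (m s)) v (k s) *
      (((Γ.data (n s) (m s)).evalG ((Γ.data (n s) (m s)).node (i s) + (Γ.data (n s) (m s)).node v) +
        Φ Γ s * (Θ Γ s * (Γ.data (n s) (m s)).sub (Ψ Γ s)
          ((Γ.data (n s) (m s)).node (i s) + (Γ.data (n s) (m s)).node v))) *
      if k s = 0 then 1 else (Γ.data (n s) (m s)).series (Φ Γ s) (Ψ Γ s) (i s) v ^ (k s - 1) *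
        (Γ.data (n s) (m s)).euler (Φ Γ s) (Ψ Γ s) (i s) v))
    ((table hn1 hm1 (hn1.numNodes hm1) .snd hk1).mul
      (((evalG hn1 hm1 hnode).add (hΦ1.mul (hΘ1.mul (sub hn1 hm1 hΨ1 hnode)))).mul
        (.ite (.eq hk1 (.const 0)) one (((series hn1 hm1 hΦ1 hΨ1 hi1 .snd).pow hk1.pred).mul
          (euler hn1 hm1 hΦ1 hΨ1 hi1 .snd)))))
    (hn.numNodes hm)

theorem res (hn : LS n) (hm : LS m) (hΦ : ConstDepth Φ) (hΨ : ConstDepth Ψ) (hΘ : ConstDepth Θ) :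
    ConstDepth fun Γ s => (Γ.data (n s) (m s)).res (Φ Γ s) (Ψ Γ s) (Θ Γ s) := by
  have hn1 := hn.comp (.fst (β := ℕ))
  have hm1 := hm.comp (.fst (β := ℕ))
  have hn2 := hn1.comp (.fst (β := ℕ))
  have hm2 := hm1.comp (.fst (β := ℕ))
  have hn3 := hn2.comp (.fst (β := ℕ))
  have hm3 := hm2.comp (.fst (β := ℕ))
  have hn4 := hn3.comp (.fst (β := ℕ))
  have hm4 := hm3.comp (.fst (β := ℕ))
  have h4 : LS fun p : (((α × ℕ) × ℕ) × ℕ) × ℕ => p.1.1.1.1 := .fst' (.fst' (.fst' .fst))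
  -- The nested index is `((((s, l), w), i), k)`, built from the outermost sum inwards.
  have hterm : ConstDepth fun Γ (p : (((α × ℕ) × ℕ) × ℕ) × ℕ) =>
      (Γ.data (n p.1.1.1.1) (m p.1.1.1.1)).rootCoeff (Φ Γ p.1.1.1.1) (Ψ Γ p.1.1.1.1)
        (Θ Γ p.1.1.1.1) p.1.2 p.2 *
      (Γ.data (n p.1.1.1.1) (m p.1.1.1.1)).node p.1.1.2 ^ p.2 :=
    (rootCoeff hn4 hm4 (hΦ.reindex h4) (hΨ.reindex h4) (hΘ.reindex h4) (.snd' .fst) .snd).mul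
      ((node hn4 hm4 (.snd' (.fst' .fst))).pow .snd)
  have hsum : ConstDepth fun Γ (p : ((α × ℕ) × ℕ) × ℕ) =>
      ∑ k ∈ Finset.range (n p.1.1.1 + m p.1.1.1 + 1),
        (Γ.data (n p.1.1.1) (m p.1.1.1)).rootCoeff (Φ Γ p.1.1.1) (Ψ Γ p.1.1.1)
          (Θ Γ p.1.1.1) p.2 k * (Γ.data (n p.1.1.1) (m p.1.1.1)).node p.1.2 ^ k :=
    sum (Φ := fun Γ (p : ((α × ℕ) × ℕ) × ℕ) k =>
      (Γ.data (n p.1.1.1) (m p.1.1.1)).rootCoeff (Φ Γ p.1.1.1) (Ψ Γ p.1.1.1)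
          (Θ Γ p.1.1.1) p.2 k * (Γ.data (n p.1.1.1) (m p.1.1.1)).node p.1.2 ^ k)
      hterm (hn3.add hm3).succ
  have hprod : ConstDepth fun Γ (p : (α × ℕ) × ℕ) =>
      ∏ i ∈ Finset.range (n p.1.1), ∑ k ∈ Finset.range (n p.1.1 + m p.1.1 + 1),
        (Γ.data (n p.1.1) (m p.1.1)).rootCoeff (Φ Γ p.1.1) (Ψ Γ p.1.1) (Θ Γ p.1.1) i k *
          (Γ.data (n p.1.1) (m p.1.1)).node p.2 ^ k :=
    prod (Φ := fun Γ (p : (α × ℕ) × ℕ) i => ∑ k ∈ Finset.range (n p.1.1 + m p.1.1 + 1),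
        (Γ.data (n p.1.1) (m p.1.1)).rootCoeff (Φ Γ p.1.1) (Ψ Γ p.1.1) (Θ Γ p.1.1) i k *
          (Γ.data (n p.1.1) (m p.1.1)).node p.2 ^ k) hsum hn2
  have hsum' : ConstDepth fun Γ (p : α × ℕ) => ∑ w ∈ Finset.range (CoeffData.numNodes (n p.1) (m p.1)),
      (Γ.data (n p.1) (m p.1)).table (CoeffData.numNodes (n p.1) (m p.1)) w p.2 *
      ∏ i ∈ Finset.range (n p.1), ∑ k ∈ Finset.range (n p.1 + m p.1 + 1),
        (Γ.data (n p.1) (m p.1)).rootCoeff (Φ Γ p.1) (Ψ Γ p.1) (Θ Γ p.1) i k *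
          (Γ.data (n p.1) (m p.1)).node w ^ k :=
    sum (Φ := fun Γ (p : α × ℕ) w =>
      (Γ.data (n p.1) (m p.1)).table (CoeffData.numNodes (n p.1) (m p.1)) w p.2 *
      ∏ i ∈ Finset.range (n p.1), ∑ k ∈ Finset.range (n p.1 + m p.1 + 1),
        (Γ.data (n p.1) (m p.1)).rootCoeff (Φ Γ p.1) (Ψ Γ p.1) (Θ Γ p.1) i k *
          (Γ.data (n p.1) (m p.1)).node w ^ k)
      ((table hn2 hm2 (hn2.numNodes hm2) .snd (.snd' .fst)).mul hprod) (hn1.numNodes hm1)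
  exact sum (Φ := fun Γ s l => ∑ w ∈ Finset.range (CoeffData.numNodes (n s) (m s)),
      (Γ.data (n s) (m s)).table (CoeffData.numNodes (n s) (m s)) w l *
      ∏ i ∈ Finset.range (n s), ∑ k ∈ Finset.range (n s + m s + 1),
        (Γ.data (n s) (m s)).rootCoeff (Φ Γ s) (Ψ Γ s) (Θ Γ s) i k *
          (Γ.data (n s) (m s)).node w ^ k)
    hsum' (hn.add hm).succ

theorem pencilCoeff (hn : LS n) (hm : LS m) (hΦ : ConstDepth Φ) (hΨ : ConstDepth Ψ) (hr : LS r) :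
    ConstDepth fun Γ s => (Γ.data (n s) (m s)).pencilCoeff (Φ Γ s) (Ψ Γ s) (r s) := by
  have hn1 := hn.comp (.fst (β := ℕ))
  have hm1 := hm.comp (.fst (β := ℕ))
  exact sum (Φ := fun Γ s p => (Γ.data (n s) (m s)).table (CoeffData.numNodes (n s) (m s)) p (r s) *
      (Γ.data (n s) (m s)).res ((Γ.data (n s) (m s)).node p) (Φ Γ s) (Ψ Γ s))
    ((table hn1 hm1 (hn1.numNodes hm1) .snd (hr.comp .fst)).mul
      (res hn1 hm1 (node hn1 hm1 .snd) (hΦ.reindex .fst) (hΨ.reindex .fst)))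
    (hn.numNodes hm)

theorem pencilCoeff₂ (hn : LS n) (hm : LS m) (hΦ : ConstDepth Φ) (hr : LS r) (hj : LS j) :
    ConstDepth fun Γ s => (Γ.data (n s) (m s)).pencilCoeff₂ (Φ Γ s) (r s) (j s) := by
  have hn1 := hn.comp (.fst (β := ℕ))
  have hm1 := hm.comp (.fst (β := ℕ))
  exact sum (Φ := fun Γ s q => (Γ.data (n s) (m s)).table (CoeffData.numNodes (n s) (m s)) q (j s) *
      (Γ.data (n s) (m s)).pencilCoeff ((Γ.data (n s) (m s)).node q) (Φ Γ s) (r s))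
    ((table hn1 hm1 (hn1.numNodes hm1) .snd (hj.comp .fst)).mul
      (pencilCoeff hn1 hm1 (node hn1 hm1 .snd) (hΦ.reindex .fst) (hr.comp .fst)))
    (hn.numNodes hm)

end ConstDepth

end

end

section

open Polynomial CoeffData

/-! ### The straight-line program for the constants -/

/-- The `j`-th step of the block that computes the entry `(w, p, k)` of the table. -/
def blockOp (n m w p k j : ℕ) : ConstOp :=
  -- The layer `w = 0` is the empty product, with coefficients `1, 0, 0, …` in slot 6; its slot 7
  -- holds their negatives, whence `-1`. In every block slot 0 is zero.
  if w = 0 then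
    if j = 6 then if k = 0 then .one else .zero
    else if j = 7 then .sub (address n m w p k 0) (address n m w p k 6)
    else .zero
  else if j = 1 then .node (w - 1)
  else if j = 2 then .node p
  else if j = 3 then .sub (address n m w p k 2) (address n m w p k 1)
  else if j = 4 then .mul (address n m w p k 1) (address n m (w - 1) p k 6)
  else if j = 5 then
    .sub (if k = 0 then address n m w p k 0 else address n m (w - 1) p (k - 1) 6)
      (address n m w p k 4)
  else if j = 6 then
    -- The basis polynomial of `p` has no factor for the node `p` itself, so the entry is copied by
    -- adding zero.
    if w - 1 = p then .add (address n m (w - 1) p k 6) (address n m w p k 0)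
    else .div (address n m w p k 5) (address n m w p k 3)
  else .zero

/-- The `t`-th step of the straight-line program for the constants. -/
def constOp (d : ℕ × ℕ) (t : ℕ) : ConstOp :=
  -- In the degenerate degrees there may be too few given elements, so only the layer `w = 0` is
  -- run, which uses none and still produces `-1`.
  if t / 8 / numNodes d.1 d.2 / numNodes d.1 d.2 = 0 ∨
      (2 ≤ d.1 ∧ 1 ≤ d.2) ∧ t / 8 / numNodes d.1 d.2 / numNodes d.1 d.2 ≤ numNodes d.1 d.2 then
    blockOp d.1 d.2 (t / 8 / numNodes d.1 d.2 / numNodes d.1 d.2)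
      (t / 8 / numNodes d.1 d.2 % numNodes d.1 d.2) (t / 8 % numNodes d.1 d.2) (t % 8)
  else .zero

theorem blockOp_code_ls {α : Type} [Denumerable α] {n m w p k j : α → ℕ} (hn : LS n) (hm : LS m)
    (hw : LS w) (hp : LS p) (hk : LS k) (hj : LS j) :
    LS fun s => (blockOp (n s) (m s) (w s) (p s) (k s) (j s)).code := by
  have h (l : ℕ) : LS fun s => address (n s) (m s) (w s) (p s) (k s) l :=
    hn.address hm hw hp hk (.const l)
  have h' : LS fun s => address (n s) (m s) (w s - 1) (p s) (k s) 6 :=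
    hn.address hm hw.pred hp hk (.const 6)
  have h'' : LS fun s => address (n s) (m s) (w s - 1) (p s) (k s - 1) 6 :=
    hn.address hm hw.pred hp hk.pred (.const 6)
  have hz : LS fun _ : α => ConstOp.zero.code := .const _
  simp only [blockOp, apply_ite ConstOp.code]
  refine .ite (.eq hw (.const 0)) (.ite (.eq hj (.const 6))
    (.ite (.eq hk (.const 0)) (.const _) hz)
    (.ite (.eq hj (.const 7)) (.pair (.const 4) (.pair (h 0) (h 6))) hz)) ?_
  refine .ite (.eq hj (.const 1)) (.pair (.const 2) hw.pred) ?_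
  refine .ite (.eq hj (.const 2)) (.pair (.const 2) hp) ?_
  refine .ite (.eq hj (.const 3)) (.pair (.const 4) (.pair (h 2) (h 1))) ?_
  refine .ite (.eq hj (.const 4)) (.pair (.const 5) (.pair (h 1) h')) ?_
  refine .ite (.eq hj (.const 5)) (.pair (.const 4) (.pair (.ite (.eq hk (.const 0)) (h 0) h'')
    (h 4))) ?_
  refine .ite (.eq hj (.const 6)) (.ite (.eq hw.pred hp) (.pair (.const 3) (.pair h' (h 0)))
    (.pair (.const 6) (.pair (h 5) (h 3)))) hz

theorem constOp_code_ls : LS fun p : (ℕ × ℕ) × ℕ => (constOp p.1 p.2).code := by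
  have hn : LS fun p : (ℕ × ℕ) × ℕ => p.1.1 := .fst' .fst
  have hm : LS fun p : (ℕ × ℕ) × ℕ => p.1.2 := .snd' .fst
  have hN := hn.numNodes hm
  have ht : LS fun p : (ℕ × ℕ) × ℕ => p.2 := .snd
  have h8 := ht.div (.const 8)
  simp only [constOp, apply_ite ConstOp.code]
  exact .ite (.or (.eq ((h8.div hN).div hN) (.const 0))
      (.and (.and (.le (.const 2) hn) (.le (.const 1) hm)) (.le ((h8.div hN).div hN) hN)))
    (blockOp_code_ls hn hm ((h8.div hN).div hN) ((h8.div hN).mod hN) (h8.mod hN) (ht.mod (.const 8)))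
    (.const _)

section

variable {n m w p k j : ℕ}

theorem numNodes_pos (n m : ℕ) : 0 < numNodes n m := (Nat.zero_le _).trans_lt (lt_numNodes n m)

theorem exists_address_eq (n m t : ℕ) : ∃ w p k j, p < numNodes n m ∧ k < numNodes n m ∧ j < 8 ∧
    t = address n m w p k j := by
  have hN := numNodes_pos n m
  refine ⟨t / 8 / numNodes n m / numNodes n m, t / 8 / numNodes n m % numNodes n m,
    t / 8 % numNodes n m, t % 8, Nat.mod_lt _ hN, Nat.mod_lt _ hN, Nat.mod_lt _ (by norm_num), ?_⟩
  rw [address, Nat.div_add_mod', Nat.div_add_mod', Nat.div_add_mod']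

theorem address_div (hp : p < numNodes n m) (hk : k < numNodes n m) (hj : j < 8) :
    address n m w p k j / 8 / numNodes n m / numNodes n m = w ∧
    address n m w p k j / 8 / numNodes n m % numNodes n m = p ∧
    address n m w p k j / 8 % numNodes n m = k ∧ address n m w p k j % 8 = j := by
  have key (a b N : ℕ) (hb : b < N) : (a * N + b) / N = a ∧ (a * N + b) % N = b := by
    rw [mul_comm, Nat.mul_add_div (by omega), Nat.mul_add_mod, Nat.div_eq_of_lt hb,
      Nat.mod_eq_of_lt hb]
    exact ⟨rfl, rfl⟩
  rw [address, (key _ _ _ hj).1, (key _ _ _ hj).2, (key _ _ _ hk).1, (key _ _ _ hk).2,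
    (key _ _ _ hp).1, (key _ _ _ hp).2]
  exact ⟨rfl, rfl, rfl, rfl⟩

theorem address_lt_address {w' p' k' j' : ℕ} (hp : p < numNodes n m) (hk : k < numNodes n m)
    (hj : j < 8) (h : w < w') : address n m w p k j < address n m w' p' k' j' := by
  have h1 : w * numNodes n m + p < w' * numNodes n m := by
    calc _ < (w + 1) * numNodes n m := by rw [add_mul]; omega
      _ ≤ _ := Nat.mul_le_mul_right _ h
  have h2 : (w * numNodes n m + p) * numNodes n m + k <
      (w' * numNodes n m + p') * numNodes n m := by
    calc _ < (w * numNodes n m + p + 1) * numNodes n m := by rw [add_mul _ 1]; omega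
      _ ≤ _ := Nat.mul_le_mul_right _ (by omega)
  rw [address, address]
  omega

theorem constOp_address (hw : w = 0 ∨ (2 ≤ n ∧ 1 ≤ m) ∧ w ≤ numNodes n m)
    (hp : p < numNodes n m) (hk : k < numNodes n m) (hj : j < 8) :
    constOp (n, m) (address n m w p k j) = blockOp n m w p k j := by
  obtain ⟨h1, h2, h3, h4⟩ := address_div (w := w) hp hk hj
  simp only [constOp, h1, h2, h3, h4]
  rw [if_pos hw]

variable {K : Type u} [Field K] (a : ℕ → K)

/-- A coefficient of a Lagrange basis polynomial. -/
def lagrangeCoeff (w p k : ℕ) : K := (Lagrange.basis (Finset.range w) a p).coeff k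

theorem lagrangeCoeff_zero (p k : ℕ) : lagrangeCoeff a 0 p k = if k = 0 then 1 else 0 := by
  simp [lagrangeCoeff, Lagrange.basis, coeff_one]

/-- Adding a node other than `p` multiplies the basis polynomial by `(X - a w) / (a p - a w)`. On
coefficients this is a two-term recursion, which `blockOp` implements. -/
theorem lagrangeCoeff_succ (w p k : ℕ) : lagrangeCoeff a (w + 1) p k =
    if w = p then lagrangeCoeff a w p k else
      ((if k = 0 then 0 else lagrangeCoeff a w p (k - 1)) - a w * lagrangeCoeff a w p k) /
        (a p - a w) := by
  split_ifs with h hk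
  · subst h
    simp [lagrangeCoeff, Lagrange.basis, Finset.range_add_one]
  all_goals
    have h1 : Lagrange.basis (Finset.range (w + 1)) a p =
        C (a p - a w)⁻¹ * ((X - C (a w)) * Lagrange.basis (Finset.range w) a p) := by
      rw [Lagrange.basis, Finset.range_add_one, Finset.erase_insert_of_ne h,
        Finset.prod_insert (by simp), Lagrange.basisDivisor, mul_assoc]
      rfl
    rw [lagrangeCoeff, h1, coeff_C_mul, sub_mul, coeff_sub, coeff_C_mul, div_eq_inv_mul]
  · subst hk
    simp [lagrangeCoeff]
  · obtain ⟨k, rfl⟩ := Nat.exists_eq_succ_of_ne_zero hk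
    simp [lagrangeCoeff, coeff_X_mul]

/-- The value of the `j`-th step of the block that computes the entry `(w, p, k)` of the table. -/
def blockValue (w p k j : ℕ) : K :=
  if w = 0 then if j = 6 then lagrangeCoeff a w p k else if j = 7 then -lagrangeCoeff a w p k else 0
  else if j = 1 then a (w - 1)
  else if j = 2 then a p
  else if j = 3 then a p - a (w - 1)
  else if j = 4 then a (w - 1) * lagrangeCoeff a (w - 1) p k
  else if j = 5 then (if k = 0 then 0 else lagrangeCoeff a (w - 1) p (k - 1)) -
    a (w - 1) * lagrangeCoeff a (w - 1) p k
  else if j = 6 then lagrangeCoeff a w p k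
  else 0

theorem blockValue_zero : blockValue a w p k 0 = 0 := by simp [blockValue]

theorem blockValue_six : blockValue a w p k 6 = lagrangeCoeff a w p k := by simp [blockValue]

/-- The values of the straight-line program for the constants. -/
def constValue (n m t : ℕ) : K :=
  if t / 8 / numNodes n m / numNodes n m = 0 ∨
      (2 ≤ n ∧ 1 ≤ m) ∧ t / 8 / numNodes n m / numNodes n m ≤ numNodes n m then
    blockValue a (t / 8 / numNodes n m / numNodes n m)
      (t / 8 / numNodes n m % numNodes n m) (t / 8 % numNodes n m) (t % 8)
  else 0

theorem constValue_address (hw : w = 0 ∨ (2 ≤ n ∧ 1 ≤ m) ∧ w ≤ numNodes n m)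
    (hp : p < numNodes n m) (hk : k < numNodes n m) (hj : j < 8) :
    constValue a n m (address n m w p k j) = blockValue a w p k j := by
  obtain ⟨h1, h2, h3, h4⟩ := address_div (w := w) hp hk hj
  simp only [constValue, h1, h2, h3, h4]
  rw [if_pos hw]

/-- Each step refers to earlier slots of its own block or to the layer `w - 1`. The only divisions
are by differences of distinct nodes, so the program never fails. -/
theorem constOp_holds (n m : ℕ) {N : ℕ} (b : Fin N → K)
    (hN : 2 ≤ n → 1 ≤ m → numNodes n m ≤ N) (ha : 2 ≤ n → 1 ≤ m → Set.InjOn a (Set.Iio (numNodes n m)))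
    (hab : ∀ i (h : i < N), a i = b ⟨i, h⟩) (t : ℕ) :
    (constOp (n, m) t).Holds b (constValue a n m) t := by
  by_cases hw : t / 8 / numNodes n m / numNodes n m = 0 ∨
      (2 ≤ n ∧ 1 ≤ m) ∧ t / 8 / numNodes n m / numNodes n m ≤ numNodes n m
  swap
  · rw [constOp, if_neg hw]
    exact if_neg hw
  obtain ⟨w, p, k, j, hp, hk, hj, rfl⟩ := exists_address_eq n m t
  rw [(address_div hp hk hj).1] at hw
  have hlt {i j : ℕ} (h : i < j) : address n m w p k i < address n m w p k j :=
    Nat.add_lt_add_left h _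
  have hv' {i : ℕ} (hi : i < 8) := constValue_address a hw hp hk hi
  rw [constOp_address hw hp hk hj]
  rcases Nat.eq_zero_or_pos w with rfl | hw0
  · rw [blockOp, if_pos rfl]
    split_ifs with h1 h2 h3
    · subst h1 h2
      simp only [ConstOp.Holds]
      rw [hv' hj, blockValue_six, lagrangeCoeff_zero, if_pos rfl]
    · subst h1
      simp only [ConstOp.Holds]
      rw [hv' hj, blockValue_six, lagrangeCoeff_zero, if_neg h2]
    · subst h3
      refine ⟨hlt (by norm_num), hlt (by norm_num), ?_⟩
      rw [hv' hj, hv' (by norm_num), hv' (by norm_num), blockValue_six, blockValue_zero]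
      simp [blockValue]
    · simp only [ConstOp.Holds]
      rw [hv' hj]
      simp [blockValue, h1, h3]
  have hprev {k' j : ℕ} (hk' : k' < numNodes n m) : address n m (w - 1) p k' 6 < address n m w p k j :=
    address_lt_address hp hk' (by norm_num) (by omega)
  obtain ⟨hnm, hwN⟩ := hw.resolve_left hw0.ne'
  have hNN := hN hnm.1 hnm.2
  have hv {k : ℕ} (hk : k < numNodes n m) :=
    constValue_address a (w := w - 1) (j := 6) (.inr ⟨hnm, by omega⟩) hp hk (by norm_num)
  rw [blockOp, if_neg hw0.ne']
  split_ifs with h1 h2 h3 h4 h5 h6 h7 h8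
  · subst h1
    exact ⟨by omega, by rw [hv' hj, ← hab]; simp [blockValue, hw0.ne']⟩
  · subst h2
    exact ⟨by omega, by rw [hv' hj, ← hab]; simp [blockValue, hw0.ne']⟩
  · subst h3
    refine ⟨hlt (by norm_num), hlt (by norm_num), ?_⟩
    rw [hv' hj, hv' (by norm_num), hv' (by norm_num)]
    simp [blockValue, hw0.ne']
  · subst h4
    refine ⟨hlt (by norm_num), hprev hk, ?_⟩
    rw [hv' hj, hv' (by norm_num), hv hk, blockValue_six]
    simp [blockValue, hw0.ne']
  · subst h5 h6
    refine ⟨hlt (by norm_num), hlt (by norm_num), ?_⟩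
    rw [hv' hj, hv' (by norm_num), hv' (by norm_num), blockValue_zero]
    simp [blockValue, hw0.ne']
  · subst h5
    refine ⟨hprev (by omega), hlt (by norm_num), ?_⟩
    rw [hv' hj, hv' (by norm_num), hv (k := k - 1) (by omega), blockValue_six]
    simp [blockValue, hw0.ne', h6]
  · subst h7
    refine ⟨hprev hk, hlt (by norm_num), ?_⟩
    rw [hv' hj, hv' (by norm_num), hv hk, blockValue_six, blockValue_six,
      blockValue_zero, add_zero]
    conv_lhs => rw [← Nat.sub_add_cancel hw0, lagrangeCoeff_succ, if_pos h8]
  · subst h7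
    have hne : a p - a (w - 1) ≠ 0 := by
      rw [sub_ne_zero]
      intro h
      exact h8 (ha hnm.1 hnm.2 (Set.mem_Iio.2 hp) (Set.mem_Iio.2 (by omega)) h).symm
    refine ⟨hlt (by norm_num), hlt (by norm_num), ?_⟩
    rw [hv' hj, hv' (by norm_num), hv' (by norm_num), blockValue_six]
    have h3 : blockValue a w p k 3 = a p - a (w - 1) := by simp [blockValue, hw0.ne']
    refine ⟨h3 ▸ hne, ?_⟩
    conv_lhs => rw [← Nat.sub_add_cancel hw0, lagrangeCoeff_succ, if_neg h8]
    rw [h3]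
    simp [blockValue, hw0.ne']
  · simp only [ConstOp.Holds]
    rw [hv' hj, blockValue, if_neg hw0.ne']
    simp [*]

end

end

section

open Polynomial CoeffData Family

/-! ### The piece-wise rational circuit for the greatest common divisor -/

section

variable {K : Type u} [Field K]

theorem inputs_left {d₁ d₂ l : ℕ} (f g : K[X]) (hl : l ≤ d₁) : inputs d₁ d₂ f g l = f.coeff l := by
  rw [inputs, dif_pos (by omega), coeffVec]
  have : (⟨l, by omega⟩ : Fin ((d₁ + 1) + (d₂ + 1))) = Fin.castAdd (d₂ + 1) ⟨l, by omega⟩ := rfl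
  rw [this, Fin.append_left]

theorem inputs_right {d₁ d₂ l : ℕ} (f g : K[X]) (hl : l ≤ d₂) :
    inputs d₁ d₂ f g (d₁ + 1 + l) = g.coeff l := by
  rw [inputs, dif_pos (by omega), coeffVec]
  have : (⟨d₁ + 1 + l, by omega⟩ : Fin ((d₁ + 1) + (d₂ + 1))) = Fin.natAdd (d₁ + 1) ⟨l, by omega⟩ :=
    rfl
  rw [this, Fin.append_right]

/-- The constants from the nodes `a` and the inputs from the polynomials `f` and `g`. -/
def context (a : ℕ → K) (n m : ℕ) (f g : K[X]) : Ctx.{u} := ⟨K, constValue a n m, inputs n m f g⟩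

theorem basis_congr {a b : ℕ → K} {w p : ℕ} (h : ∀ i < w, a i = b i) (hp : a p = b p) :
    Lagrange.basis (Finset.range w) a p = Lagrange.basis (Finset.range w) b p := by
  refine Finset.prod_congr rfl fun i hi => ?_
  rw [hp, h i (Finset.mem_range.1 (Finset.mem_of_mem_erase hi))]

theorem context_negOne (a : ℕ → K) (n m : ℕ) (f g : K[X]) :
    ((context a n m f g).data n m).negOne = -1 := by
  have hN := numNodes_pos n m
  refine (constValue_address a (.inl rfl) hN hN (by norm_num)).trans ?_
  simp only [blockValue, lagrangeCoeff_zero]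
  norm_num
  rfl

theorem context_evalG (a : ℕ → K) (n m : ℕ) (f : K[X]) {g : K[X]} (hg : g.natDegree = m) (y : K) :
    ((context a n m f g).data n m).evalG y = g.eval y := by
  rw [eval_eq_sum_range, hg]
  refine Finset.sum_congr rfl fun l hl => ?_
  have h1 : ((context a n m f g).data n m).g l = g.coeff l :=
    inputs_right f g (Nat.lt_succ_iff.1 (Finset.mem_range.1 hl))
  rw [h1]
  rfl

theorem context_node {a : ℕ → K} {n m : ℕ} (f g : K[X]) (hn : 2 ≤ n) (hm : 1 ≤ m) {i : ℕ}
    (hi : i < numNodes n m) : ((context a n m f g).data n m).node i = a i := by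
  have hN := numNodes_pos n m
  refine (constValue_address a (.inr ⟨⟨hn, hm⟩, hN⟩) hi hN (by norm_num)).trans ?_
  simp [blockValue]

theorem isValid_context {a : ℕ → K} {n m : ℕ} {f g : K[X]}
    (ha : Set.InjOn a (Set.Iio (numNodes n m))) (hn : 2 ≤ n) (hm : 1 ≤ m) (hf : f.Monic)
    (hg : g.Monic) (hfn : f.natDegree = n) (hgm : g.natDegree = m) :
    ((context a n m f g).data n m).IsValid f g where
  injOn i hi j hj hij := by
    rw [context_node f g hn hm hi, context_node f g hn hm hj] at hij
    exact ha hi hj hij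
  table_eq w hw p hp k hk := by
    refine (constValue_address a (.inr ⟨⟨hn, hm⟩, hw⟩) hp hk (by norm_num)).trans ?_
    rw [blockValue_six, lagrangeCoeff]
    congr 1
    exact basis_congr (fun i hi => (context_node f g hn hm (hi.trans_le hw)).symm)
      (context_node f g hn hm hp).symm
  negOne_eq := context_negOne a n m f g
  monic_f := hf
  monic_g := hg
  natDegree_f := hfn
  natDegree_g := hgm
  f_eq l hl := inputs_left f g hl
  g_eq l hl := inputs_right f g hl
  two_le := hn
  one_le := hm

end

/-- The degree of the greatest common divisor that belongs to a piece. -/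
def Family.Index.gcdDegree (s : Index) : ℕ := min s.1.1 s.1.2 - s.2 / (min s.1.1 s.1.2 + 1)

/-- The multiplier of the first polynomial that belongs to a piece. -/
def Family.Index.shift (Γ : Ctx.{u}) (s : Index) : Γ.K :=
  (Γ.data s.1.1 s.1.2).node (s.2 % (min s.1.1 s.1.2 + 1))

/-- The number of pieces. -/
def pieces (d : ℕ × ℕ) : ℕ := if 2 ≤ d.1 ∧ 1 ≤ d.2 then (min d.1 d.2 + 1) ^ 2 else 2

/-- The numerators. -/
def numerator (Γ : Ctx.{u}) (s : Index) (j : ℕ) : Γ.K :=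
  if 2 ≤ s.1.1 ∧ 1 ≤ s.1.2 then
    (Γ.data s.1.1 s.1.2).pencilCoeff₂ (s.shift Γ) s.gcdDegree j
  else if s.2 = 0 then if j = 0 then Γ.input 0 else 1
  else if j = 0 then 1 else 0

/-- The denominators, which do not depend on the output. -/
def denominator (Γ : Ctx.{u}) (s : Index) : Γ.K :=
  if 2 ≤ s.1.1 ∧ 1 ≤ s.1.2 then
    (Γ.data s.1.1 s.1.2).pencilCoeff₂ (s.shift Γ) s.gcdDegree s.gcdDegree
  else 1

/-- The tests. -/
def test (Γ : Ctx.{u}) (s : Index) : Γ.K :=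
  if 2 ≤ s.1.1 ∧ 1 ≤ s.1.2 then denominator Γ s
  else if s.2 = 1 ∧ s.1.1 = 1 then
    -- For a linear `f` its root is `-f₀`, so this vanishes exactly when `f` divides `g`; piece `1`,
    -- with answer `1`, is then skipped in favour of piece `0`, with answer `f`.
    (Γ.data s.1.1 s.1.2).evalG ((Γ.data s.1.1 s.1.2).negOne * Γ.input 0)
  else 1

section

variable {α : Type} [Denumerable α] {t : α → Index}

theorem LS.gcdDegree (ht : LS t) : LS fun s => (t s).gcdDegree :=
  have hμ := (ht.fst'.fst').min ht.fst'.snd'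
  hμ.sub (ht.snd'.div hμ.succ)

theorem ConstDepth.shift (ht : LS t) : ConstDepth.{u} fun Γ s => (t s).shift Γ :=
  ConstDepth.node ht.fst'.fst' ht.fst'.snd'
    (ht.snd'.mod ((ht.fst'.fst').min ht.fst'.snd').succ)

theorem LSPred.main (ht : LS t) : LSPred fun s => 2 ≤ (t s).1.1 ∧ 1 ≤ (t s).1.2 :=
  .and (.le (.const 2) ht.fst'.fst') (.le (.const 1) ht.fst'.snd')

theorem pieces_ls : LS pieces :=
  .ite (.and (.le (.const 2) .fst) (.le (.const 1) .snd)) (((LS.fst).min .snd).succ.pow 2) (.const 2)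

theorem numerator_constDepth :
    ConstDepthMulti.{u} (fun s => min s.1.1 s.1.2 + 1) numerator := by
  have ht : LS fun p : Index × ℕ => p.1 := .fst
  exact .of_constDepth (.ite (.main ht) (.pencilCoeff₂ ht.fst'.fst' ht.fst'.snd' (.shift ht)
      ht.gcdDegree .snd)
    (.ite (.eq ht.snd' (.const 0)) (.ite (.eq .snd (.const 0)) (.input (.const 0)) .one)
      (.ite (.eq .snd (.const 0)) .one .zero)))
    ((LS.id.fst'.fst').min LS.id.fst'.snd').succ

theorem denominator_constDepth : ConstDepth.{u} denominator :=
  have ht : LS fun p : Index => p := .id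
  .ite (.main ht) (.pencilCoeff₂ ht.fst'.fst' ht.fst'.snd' (.shift ht) ht.gcdDegree ht.gcdDegree)
    .one

theorem test_constDepth : ConstDepth.{u} test :=
  have ht : LS fun p : Index => p := .id
  .ite (.main ht) denominator_constDepth (.ite (.and (.eq ht.snd' (.const 1))
    (.eq ht.fst'.fst' (.const 1))) (.evalG ht.fst'.fst' ht.fst'.snd'
      ((ConstDepth.negOne ht.fst'.fst' ht.fst'.snd').mul (.input (.const 0)))) .one)

end

section

variable {K : Type u} [Field K] {a : ℕ → K} {n m : ℕ} {f g : K[X]}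

/-- With `μ = min n m`, the index `k` encodes the guess `deg d = μ - k / (μ + 1)` and the shift with
number `k % (μ + 1)`. Later pieces guess smaller degrees, and too small a degree gives vanishing
coefficients, so the last nonzero test has guessed right. Earlier pieces may pass their tests
without being meaningful. -/
theorem CoeffData.IsValid.exists_isGreatest {D : CoeffData K} (h : D.IsValid f g) :
    ∃ r, IsGreatest {k | k < (min D.n D.m + 1) ^ 2 ∧
        D.pencilCoeff₂ (D.node (k % (min D.n D.m + 1))) (min D.n D.m - k / (min D.n D.m + 1))
          (min D.n D.m - k / (min D.n D.m + 1)) ≠ 0} r ∧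
      ∀ j ≤ min D.n D.m,
        D.pencilCoeff₂ (D.node (r % (min D.n D.m + 1))) (min D.n D.m - r / (min D.n D.m + 1))
          (min D.n D.m - r / (min D.n D.m + 1)) ≠ 0 ∧
        (monicGcd f g).coeff j =
          D.pencilCoeff₂ (D.node (r % (min D.n D.m + 1))) (min D.n D.m - r / (min D.n D.m + 1)) j /
          D.pencilCoeff₂ (D.node (r % (min D.n D.m + 1))) (min D.n D.m - r / (min D.n D.m + 1))
            (min D.n D.m - r / (min D.n D.m + 1)) := by
  obtain ⟨f', g', hff, hgg, hd, hf', hco⟩ := exists_monicGcd_factorization (g := g) h.monic_f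
  have key (s : K) := h.exists_pencilCoeff₂_eq hff hgg hd hf' s
  generalize monicGcd f g = d at *
  have hdn : d.natDegree ≤ D.n := by
    rw [← h.natDegree_f, hff, hd.natDegree_mul hf']; omega
  have hdm : d.natDegree ≤ D.m := by
    rw [← h.natDegree_g]
    exact natDegree_le_of_dvd ⟨g', hgg⟩ h.monic_g.ne_zero
  generalize hμ : min D.n D.m = μ
  have hlt := lt_numNodes D.n D.m
  obtain ⟨i, hi, hicop⟩ := exists_isCoprime_add hd.ne_zero hco
    (h.injOn.mono (Set.Iio_subset_Iio (by omega : μ + 1 ≤ numNodes D.n D.m))) (by omega)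
  set S := {k | k < (μ + 1) ^ 2 ∧
    D.pencilCoeff₂ (D.node (k % (μ + 1))) (μ - k / (μ + 1)) (μ - k / (μ + 1)) ≠ 0}
  -- The true degree together with a good shift `i`, which exists among the first `μ + 1 > deg d`
  -- nodes.
  have hmem : (μ - d.natDegree) * (μ + 1) + i ∈ S := by
    constructor
    · calc _ < (μ - d.natDegree) * (μ + 1) + (μ + 1) := by omega
        _ = (μ - d.natDegree + 1) * (μ + 1) := by ring
        _ ≤ (μ + 1) * (μ + 1) := Nat.mul_le_mul_right _ (by omega)
        _ = _ := by ring
    · have h1 : ((μ - d.natDegree) * (μ + 1) + i) / (μ + 1) = μ - d.natDegree := by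
        rw [mul_comm, Nat.mul_add_div (by omega), Nat.div_eq_of_lt hi, add_zero]
      have h2 : ((μ - d.natDegree) * (μ + 1) + i) % (μ + 1) = i := by
        rw [mul_comm, Nat.mul_add_mod, Nat.mod_eq_of_lt hi]
      obtain ⟨ε, hε, h3⟩ := (key (D.node i)).2
      rw [h1, h2, Nat.sub_sub_self (by omega), h3 _ hdn, hd.coeff_natDegree, mul_one]
      exact mul_ne_zero hε (resultant_ne_zero _ _ hicop)
  have hbdd : BddAbove S := ⟨(μ + 1) ^ 2, fun k hk => hk.1.le⟩
  have hr : IsGreatest S (sSup S) := ⟨Nat.sSup_mem ⟨_, hmem⟩ hbdd, fun _ h => le_csSup hbdd h⟩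
  refine ⟨sSup S, hr, fun j hj => ?_⟩
  generalize sSup S = r at hr
  have h0 := hr.1.2
  -- Maximality gives a guess of at most `deg d`; a strictly smaller one would make the test vanish.
  -- The shift of `r` need not be `i`: its nonzero test is all that is needed.
  have h1 : μ - r / (μ + 1) = d.natDegree := by
    have h2 : μ - d.natDegree ≤ r / (μ + 1) :=
      (Nat.le_div_iff_mul_le (by omega)).2 ((Nat.le_add_right _ _).trans (hr.2 hmem))
    by_contra h3
    exact h0 ((key _).1 _ (by omega) _ (by omega))
  refine ⟨h0, ?_⟩
  rw [eq_div_iff h0]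
  obtain ⟨ε, -, h3⟩ := (key (D.node (r % (μ + 1)))).2
  rw [h1, h3 _ hdn, h3 _ (by omega), hd.coeff_natDegree]
  ring

/-- The gcd has degree at most `min (deg f) (deg g) ≤ 1`, and degree `1` is possible only if `f` is
linear and divides `g`. In all other cases the gcd is `1`. -/
theorem exists_isGreatest_of_degenerate (h : ¬ (2 ≤ f.natDegree ∧ 1 ≤ g.natDegree)) (hf : f.Monic)
    (hg : g.Monic) :
    ∃ r, IsGreatest {k | k < 2 ∧
        (if k = 1 ∧ f.natDegree = 1 then g.eval (-f.coeff 0) else 1) ≠ 0} r ∧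
      ∀ j ≤ min f.natDegree g.natDegree, (1 : K) ≠ 0 ∧ (monicGcd f g).coeff j =
        (if r = 0 then if j = 0 then f.coeff 0 else 1 else if j = 0 then 1 else 0) / 1 := by
  obtain ⟨f', g', hff, hgg, hd, hf', hco⟩ := exists_monicGcd_factorization (g := g) hf
  generalize monicGcd f g = d at *
  have hdn : f.natDegree = d.natDegree + f'.natDegree := by
    conv_lhs => rw [hff, hd.natDegree_mul hf']
  have hdm : d.natDegree ≤ g.natDegree := natDegree_le_of_dvd ⟨g', hgg⟩ hg.ne_zero
  have hroot (h1 : f.natDegree = 1) : f ∣ g ↔ g.eval (-f.coeff 0) = 0 := by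
    conv_lhs => rw [hf.eq_X_add_C h1, ← sub_neg_eq_add, ← C_neg]
    exact dvd_iff_isRoot
  by_cases hcase : f.natDegree = 1 ∧ g.eval (-f.coeff 0) = 0
  · obtain ⟨h1, h2⟩ := hcase
    have hfu : IsUnit f' := by
      obtain ⟨q, hq⟩ := (hroot h1).2 h2
      refine hco.isUnit_of_dvd' dvd_rfl ⟨q, mul_left_cancel₀ hd.ne_zero ?_⟩
      rw [← hgg, hq, ← mul_assoc, ← hff]
    have hdf : d = f := by rw [hff, hf'.eq_one_of_isUnit hfu, mul_one]
    refine ⟨0, ⟨by simp, fun k hk => ?_⟩, fun j hj => ⟨one_ne_zero, ?_⟩⟩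
    · by_contra hk0
      obtain rfl : k = 1 := by have := hk.1; omega
      exact hk.2 (by simp [h1, h2])
    · have hj1 : j ≤ 1 := by omega
      rw [hdf]
      interval_cases j
      · simp
      · simpa [h1] using hf.coeff_natDegree
  · have hd0 : d.natDegree = 0 := by
      by_contra hd0
      have h1 : f.natDegree = 1 := by omega
      have hf1 : f' = 1 := hf'.natDegree_eq_zero.1 (by omega)
      refine hcase ⟨h1, (hroot h1).1 ⟨g', ?_⟩⟩
      rw [hff, hf1, mul_one, ← hgg]
    have hd1 : d = 1 := hd.natDegree_eq_zero.1 hd0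
    refine ⟨1, ⟨⟨by simp, ?_⟩, fun k hk => by have := hk.1; omega⟩, fun j hj => ⟨one_ne_zero, ?_⟩⟩
    · split_ifs with h1
      · exact fun h2 => hcase ⟨h1.2, h2⟩
      · exact one_ne_zero
    · rw [hd1, coeff_one]
      simp

/-- The circuits compute the greatest common divisor. -/
theorem exists_isGreatest_test_ne_zero
    (ha : 2 ≤ n → 1 ≤ m → Set.InjOn a (Set.Iio (numNodes n m))) (hf : f.Monic) (hg : g.Monic)
    (hfn : f.natDegree = n) (hgm : g.natDegree = m) :
    ∃ r, IsGreatest {k | k < pieces (n, m) ∧ test (context a n m f g) ((n, m), k) ≠ 0} r ∧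
      ∀ j ≤ min n m, denominator (context a n m f g) ((n, m), r) ≠ 0 ∧
        (monicGcd f g).coeff j = numerator (context a n m f g) ((n, m), r) j /
          denominator (context a n m f g) ((n, m), r) := by
  by_cases h : 2 ≤ n ∧ 1 ≤ m
  · simp only [pieces, test, denominator, numerator, if_pos h]
    exact (isValid_context (ha h.1 h.2) h.1 h.2 hf hg hfn hgm).exists_isGreatest
  · have h0 : (context a n m f g).input 0 = f.coeff 0 := inputs_left (d₂ := m) f g (Nat.zero_le n)
    have h1 : ((context a n m f g).data n m).evalG (((context a n m f g).data n m).negOne *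
        (context a n m f g).input 0) = g.eval (-f.coeff 0) := by
      refine (context_evalG a n m f hgm _).trans ?_
      rw [context_negOne, h0]
      congr 1
      exact neg_one_mul _
    simp only [pieces, test, denominator, numerator, if_neg h]
    simp only [h1]
    simp only [h0]
    subst hfn hgm
    exact exists_isGreatest_of_degenerate h hf hg

end

end

end GcdCircuit

end

/-! ### The theorem. -/

theorem theorem1p1 :
    ∃ (c e Δ : ℕ) (pieces : ℕ → ℕ → ℕ) (P Q T : GcdCircuit.CircuitDescription),
      GcdCircuit.LogSpace₂ pieces ∧ P.Explicit ∧ Q.Explicit ∧ T.Explicit ∧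
      ∀ (K : Type*) [Field K] (d₁ d₂ : ℕ), (((d₁ * d₂) ^ c : ℕ) : Cardinal) ≤ Cardinal.mk K →
        ∀ a : Fin ((d₁ * d₂) ^ c) → K, Function.Injective a →
          ∃ W : GcdCircuit.PiecewiseRationalCircuit K ((d₁ + 1) + (d₂ + 1)) (min d₁ d₂ + 1),
            W.pieces = pieces d₁ d₂ ∧
            (∀ k < W.pieces,
              P.Describes (Nat.pair (Nat.pair d₁ d₂) k) a (W.num k) ∧
              Q.Describes (Nat.pair (Nat.pair d₁ d₂) k) a (W.den k) ∧
              T.Describes (Nat.pair (Nat.pair d₁ d₂) k) a (W.test k)) ∧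
            W.size ≤ (d₁ + d₂ + 2) ^ e ∧
            W.depth ≤ Δ ∧
            ∀ f g : Polynomial K, f.Monic → g.Monic → f.natDegree = d₁ → g.natDegree = d₂ →
              W.ComputesAt (GcdCircuit.coeffVec d₁ d₂ f g)
                (fun j => (GcdCircuit.monicGcd f g).coeff j) := by
  refine GcdCircuit.exists_description_of_constDepth GcdCircuit.pieces_ls GcdCircuit.constOp_code_ls
    GcdCircuit.numerator_constDepth
    (.of_constDepth (Φ := fun Γ s _ => GcdCircuit.denominator Γ s) (GcdCircuit.denominator_constDepth.reindex .fst)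
      ((GcdCircuit.LS.id.fst'.fst').min GcdCircuit.LS.id.fst'.snd').succ)
    GcdCircuit.test_constDepth 8 fun K _ n m b hb => ?_
  obtain ⟨a, hab⟩ : ∃ a : ℕ → K, ∀ i (h : i < (n * m) ^ 8), a i = b ⟨i, h⟩ :=
    ⟨fun i => if h : i < (n * m) ^ 8 then b ⟨i, h⟩ else 0, fun i h => dif_pos h⟩
  have hinj {N : ℕ} (hN : N ≤ (n * m) ^ 8) : Set.InjOn a (Set.Iio N) := by
    intro i hi j hj hij
    rw [hab i (hi.trans_le hN), hab j (hj.trans_le hN)] at hij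
    simpa using hb hij
  -- This fixes the exponent `8`: the number of nodes is the fourth power of `n + m + 1`, and `n + m
  -- + 1 ≤ (n m)^2` for these degrees, with equality at `n = 2`, `m = 1`.
  have hN (hn : 2 ≤ n) (hm : 1 ≤ m) : GcdCircuit.CoeffData.numNodes n m ≤ (n * m) ^ 8 := by
    rw [GcdCircuit.CoeffData.numNodes, show (n * m) ^ 8 = ((n * m) ^ 2) ^ 4 by ring]
    refine Nat.pow_le_pow_left ?_ 4
    obtain ⟨n, rfl⟩ := Nat.exists_eq_add_of_le hn
    obtain ⟨m, rfl⟩ := Nat.exists_eq_add_of_le hm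
    nlinarith [Nat.zero_le (n * m)]
  have ha (hn : 2 ≤ n) (hm : 1 ≤ m) := hinj (hN hn hm)
  exact ⟨_, GcdCircuit.constOp_holds a n m b hN ha hab, fun f g hf hg hfn hgm =>
    GcdCircuit.exists_isGreatest_test_ne_zero ha hf hg hfn hgm⟩
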